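/- **Conventions.** Let $\mathcal F$ be a free group with a finite free basis $X=\{x_1,\dots,x_n\}$ and let $B$ be the bouquet of $n$ circles labelled by $X$, so $\pi_1B=\mathcal F$. All graphs are finite directed graphs $\Gamma$ with a labelling $\ell:\Gamma\to B$ that is an immersion (locally injective). A finite connected graph $H$ with base vertex $v$ and immersion $\ell:H\to B$ *represents* $\mathcal H\le\mathcal F$ if $\ell_*\pi_1(H,v)=\mathcal H$. The *Stallings graph* of a finitely generated $\mathcal H$ is the graph obtained from a wedge of subdivided circles, on which the reduced words of finitely many generators of $\mathcal H$ are read, by performing all possible foldings. The *reduced rank* $\overline{\mathrm r}(\Gamma)$ is $\sum_i\max\{0,-\chi(\Gamma_i)\}$ over the components $\Gamma_i$ of $\Gamma$. A set $\mathcal E$ of edges is *maximal essential* if $\overline{\mathrm r}(\Gamma-\mathcal E)=\overline{\mathrm r}(\Gamma)-|\mathcal E|$ and $\overline{\mathrm r}(\Gamma)=|\mathcal E|$. An *arc* of $\Gamma$ is a connected component of $\Gamma$ minus its vertices of degree $\ge 3$. Given a maximal essential set $\mathcal E=\{e_1,\dots,e_k\}$, let $A_i$ be the arc containing $e_i$,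 let $C_i$ be the core (largest subgraph with all degrees $\ge 2$) of the component of $\Gamma-\bigcup_{j\ne i}A_j$ containing $e_i$, and let $\Gamma_i=\bigcup_{j\le i}C_j$. The ordered set $\mathcal E$ satisfies the *nesting condition* if $\ell(\Gamma_i)\cap\ell(\{e_{i+1},\dots,e_k\})=\emptyset$ for all $i$. The graph $\Gamma$ is *generalized echelon* if it has a maximal essential set $\{e_1,\dots,e_k\}$ on which $\ell$ is injective and which satisfies the nesting condition. A finitely generated subgroup is *generalized echelon* with respect to $X$ if its Stallings graph is. A subgroup $\mathcal H\le\mathcal F$ is in *echelon form* with respect to $X$ if it has an ordered free basis $y_1,\dots,y_m$ such that for each $i$ the reduced word of $y_i$ contains (possibly inverted) a letter $x^{i}\in X$ that does not occur in $y_1,\dots,y_{i-1}$. It is an *echelon subgroup* if it is in echelon form with respect to some finite free basis of $\mathcal F$. It is *inert* if $\mathrm{rank}(\mathcal H\cap\mathcal K)\le\mathrm{rank}(\mathcal K)$ for every subgroup $\mathcal K\le\mathcal F$, where the rank of a group is the least cardinality of a generating set. **Proposition.** (1) Let $\mathcal H$ be in echelon form with respect to $X$, with basis $y_1,\dots,y_m$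 and new letters $x^{1},\dots,x^{m}$ as above. Then the Stallings graph built from $y_1,\dots,y_m$ is a finite connected immersed graph that represents $\mathcal H$. Let $(H,v)$ be this graph, or any other finite connected immersed graph representing $\mathcal H$. Then $H$ is generalized echelon. For each $i$ the closed path $p_i$ at $v$ that reads $y_i$ traverses an edge with label $x^{i}$, and for every choice of edges $e^{i}$ $(2\le i\le m)$ traversed by $p_i$ with $\ell(e^{i})=x^{i}$, the set $\mathcal E=\{e^{2},\dots,e^{m}\}$ is maximal essential in $H$, $\ell|_{\mathcal E}$ is injective, and $\mathcal E$, ordered in this way, satisfies the nesting condition. (2) Every subgroup in echelon form with respect to $X$ is generalized echelon with respect to $X$. (3) Every echelon subgroup of $\mathcal F$ is inert. -/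

import Mathlib

noncomputable section

/-- A directed graph (loops and multiple edges allowed) whose edges are labelled by `X`: a graph
together with a morphism to the bouquet of circles whose set of edges is `X`. -/
structure LabelledGraph (X : Type) where
  /-- the vertices -/
  V : Type
  /-- the edges -/
  E : Type
  /-- the origin of an edge -/
  o : E → V
  /-- the terminus of an edge -/
  t : E → V
  /-- the label of an edge -/
  lab : E → X

namespace LabelledGraph

variable {X : Type}

/-- The labelling is an immersion: it is injective on the link of every vertex. -/
def IsImmersion (Γ : LabelledGraph X) : Prop :=
  (∀ e f : Γ.E, Γ.lab e = Γ.lab f → Γ.o e = Γ.o f → e = f) ∧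
  (∀ e f : Γ.E, Γ.lab e = Γ.lab f → Γ.t e = Γ.t f → e = f)

/-- The set of connected components. -/
def Components (Γ : LabelledGraph X) : Type :=
  Quot fun u v : Γ.V => ∃ e : Γ.E, Γ.o e = u ∧ Γ.t e = v

/-- The connected component of a vertex. -/
def component (Γ : LabelledGraph X) (v : Γ.V) : Γ.Components :=
  Quot.mk _ v

def IsConnected (Γ : LabelledGraph X) : Prop :=
  Nonempty Γ.V ∧ Subsingleton Γ.Components

/-- The Euler characteristic of a connected component: vertices minus edges. -/
def eulerChar (Γ : LabelledGraph X) (c : Γ.Components) : ℤ :=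
  (Nat.card {v : Γ.V // Γ.component v = c} : ℤ)
    - (Nat.card {e : Γ.E // Γ.component (Γ.o e) = c} : ℤ)

/-- The reduced rank of a finite graph: the sum of `max 0 (-χ)` over its components. -/
def reducedRank (Γ : LabelledGraph X) : ℤ :=
  ∑ᶠ c : Γ.Components, max 0 (-Γ.eulerChar c)

/-- Remove a set of (open) edges and keep all the vertices. -/
def deleteEdges (Γ : LabelledGraph X) (D : Set Γ.E) : LabelledGraph X where
  V := Γ.V
  E := {e : Γ.E // e ∉ D}
  o := fun e => Γ.o e.1
  t := fun e => Γ.t e.1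
  lab := fun e => Γ.lab e.1

/-- A set of edges `S` is essential if removing it drops the reduced rank by `|S|`. -/
def IsEssential (Γ : LabelledGraph X) (S : Set Γ.E) : Prop :=
  (Γ.deleteEdges S).reducedRank = Γ.reducedRank - (S.ncard : ℤ)

/-- An essential set is maximal essential if its cardinality is the reduced rank. -/
def IsMaximalEssential (Γ : LabelledGraph X) (S : Set Γ.E) : Prop :=
  Γ.IsEssential S ∧ Γ.reducedRank = (S.ncard : ℤ)

/-- The degree of `v` in the subgraph with edge set `T`; a loop counts twice. -/
def degreeIn (Γ : LabelledGraph X) (T : Set Γ.E) (v : Γ.V) : ℕ :=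
  {e ∈ T | Γ.o e = v}.ncard + {e ∈ T | Γ.t e = v}.ncard

/-- A branching vertex: a vertex of degree at least three. -/
def IsBranching (Γ : LabelledGraph X) (v : Γ.V) : Prop :=
  3 ≤ Γ.degreeIn Set.univ v

/-- Two edges have a common boundary vertex that is not a branching vertex. -/
def ArcAdj (Γ : LabelledGraph X) (e f : Γ.E) : Prop :=
  ∃ v : Γ.V, ¬ Γ.IsBranching v ∧ (Γ.o e = v ∨ Γ.t e = v) ∧ (Γ.o f = v ∨ Γ.t f = v)

/-- The edges of the arc containing `e`, that is, of the connected component containing `e` of the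
space obtained from the graph by removing all branching vertices. -/
def arc (Γ : LabelledGraph X) (e : Γ.E) : Set Γ.E :=
  {f | Relation.ReflTransGen Γ.ArcAdj e f}

/-- The edges of the connected component containing `e` of the graph with the edges in `D`
removed (used for `e ∉ D`). -/
def componentEdges (Γ : LabelledGraph X) (D : Set Γ.E) (e : Γ.E) : Set Γ.E :=
  {f | f ∉ D ∧ (Γ.deleteEdges D).component (Γ.o f) = (Γ.deleteEdges D).component (Γ.o e)}

/-- The edges of the core of the subgraph with edge set `S`: the union of all subgraphs in which
every vertex incident to an edge has degree at least two. -/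
def coreEdges (Γ : LabelledGraph X) (S : Set Γ.E) : Set Γ.E :=
  {f | ∃ T : Set Γ.E, T ⊆ S ∧ f ∈ T ∧ ∀ v : Γ.V, Γ.degreeIn T v ≠ 1}

/-- The edges of the subgraph `C i` attached to the edge `e i` of a family of edges: the core of
the component containing `e i` of the graph with the arcs of the other `e j` removed. -/
def pieceEdges (Γ : LabelledGraph X) {k : ℕ} (e : Fin k → Γ.E) (i : Fin k) : Set Γ.E :=
  Γ.coreEdges (Γ.componentEdges (⋃ j ∈ {j : Fin k | j ≠ i}, Γ.arc (e j)) (e i))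

/-- The edges of `H i`, the union of the `C j` with `j ≤ i`. -/
def filtrationEdges (Γ : LabelledGraph X) {k : ℕ} (e : Fin k → Γ.E) (i : Fin k) : Set Γ.E :=
  ⋃ j ∈ {j : Fin k | j ≤ i}, Γ.pieceEdges e j

/-- The nesting condition: no label of `H i` is the label of a later edge of the family. -/
def IsNested (Γ : LabelledGraph X) {k : ℕ} (e : Fin k → Γ.E) : Prop :=
  ∀ i : Fin k, (Γ.lab '' Γ.filtrationEdges e i) ∩ (Γ.lab '' (e '' {j : Fin k | i < j})) = ∅

/-- The edges `e 0, …, e (k-1)` form a maximal essential set with pairwise distinct labels that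
satisfies the nesting condition. -/
def IsEchelonSystem (Γ : LabelledGraph X) {k : ℕ} (e : Fin k → Γ.E) : Prop :=
  Γ.IsMaximalEssential (Set.range e) ∧
  Function.Injective (fun i => Γ.lab (e i)) ∧
  Γ.IsNested e

/-- Generalized echelon graphs. -/
def IsGeneralizedEchelon (Γ : LabelledGraph X) : Prop :=
  Finite Γ.V ∧ Finite Γ.E ∧ Γ.IsImmersion ∧ ∃ (k : ℕ) (e : Fin k → Γ.E), Γ.IsEchelonSystem e

/-- `Γ.Path u w v`: there is a path from `u` to `v` along which one reads the word `w`. The letter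
`(x, true)` is read along an edge labelled `x`, and `(x, false)` against such an edge. -/
inductive Path (Γ : LabelledGraph X) : Γ.V → List (X × Bool) → Γ.V → Prop
  | nil (v : Γ.V) : Path Γ v [] v
  | forward (e : Γ.E) {w : List (X × Bool)} {v : Γ.V} (h : Path Γ (Γ.t e) w v) :
      Path Γ (Γ.o e) ((Γ.lab e, true) :: w) v
  | backward (e : Γ.E) {w : List (X × Bool)} {v : Γ.V} (h : Path Γ (Γ.o e) w v) :
      Path Γ (Γ.t e) ((Γ.lab e, false) :: w) v

/-- The edge `e` is traversed by a closed path based at `v` along which one reads `w` (in an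
immersed graph there is at most one such path). -/
def OnClosedPath (Γ : LabelledGraph X) (v : Γ.V) (w : List (X × Bool)) (e : Γ.E) : Prop :=
  ∃ w₁ w₂ : List (X × Bool),
    (w = w₁ ++ (Γ.lab e, true) :: w₂ ∧ Γ.Path v w₁ (Γ.o e) ∧ Γ.Path (Γ.t e) w₂ v) ∨
    (w = w₁ ++ (Γ.lab e, false) :: w₂ ∧ Γ.Path v w₁ (Γ.t e) ∧ Γ.Path (Γ.o e) w₂ v)

/-- Two vertices have to be identified when all possible foldings are performed. -/
inductive FoldRel (Γ : LabelledGraph X) : Γ.V → Γ.V → Prop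
  | refl (v : Γ.V) : FoldRel Γ v v
  | symm {u v : Γ.V} (h : FoldRel Γ u v) : FoldRel Γ v u
  | trans {u v w : Γ.V} (h : FoldRel Γ u v) (h' : FoldRel Γ v w) : FoldRel Γ u w
  | fold_origin {e f : Γ.E} (hl : Γ.lab e = Γ.lab f) (h : FoldRel Γ (Γ.o e) (Γ.o f)) :
      FoldRel Γ (Γ.t e) (Γ.t f)
  | fold_terminus {e f : Γ.E} (hl : Γ.lab e = Γ.lab f) (h : FoldRel Γ (Γ.t e) (Γ.t f)) :
      FoldRel Γ (Γ.o e) (Γ.o f)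

def foldVertexSetoid (Γ : LabelledGraph X) : Setoid Γ.V where
  r := Γ.FoldRel
  iseqv := ⟨FoldRel.refl, FoldRel.symm, FoldRel.trans⟩

/-- Edges are identified if they have the same label and their origins (equivalently, their
termini) are identified. -/
def foldEdgeSetoid (Γ : LabelledGraph X) : Setoid Γ.E where
  r := fun e f => Γ.lab e = Γ.lab f ∧ Γ.FoldRel (Γ.o e) (Γ.o f)
  iseqv := ⟨fun _ => ⟨rfl, FoldRel.refl _⟩, fun h => ⟨h.1.symm, FoldRel.symm h.2⟩,
    fun h h' => ⟨h.1.trans h'.1, FoldRel.trans h.2 h'.2⟩⟩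

/-- The graph obtained by performing all possible foldings. -/
def fold (Γ : LabelledGraph X) : LabelledGraph X where
  V := Quotient Γ.foldVertexSetoid
  E := Quotient Γ.foldEdgeSetoid
  o := Quotient.map' (s₁ := Γ.foldEdgeSetoid) (s₂ := Γ.foldVertexSetoid) Γ.o (fun _ _ h => h.2)
  t := Quotient.map' (s₁ := Γ.foldEdgeSetoid) (s₂ := Γ.foldVertexSetoid) Γ.t
    (fun _ _ h => FoldRel.fold_origin h.1 h.2)
  lab := fun e => Quotient.liftOn' (s₁ := Γ.foldEdgeSetoid) e Γ.lab (fun _ _ h => h.1)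

/-- The vertices of the wedge of circles on which the words `w i` are read: the base vertex `none`
and the interior subdivision vertices of the circles. -/
abbrev WedgeVertex {ι : Type} (w : ι → List (X × Bool)) : Type :=
  Option (Σ i : ι, {k : ℕ // 0 < k ∧ k < (w i).length})

/-- The `k`-th vertex of the `i`-th circle; its first and its last vertex are the base vertex. -/
def wedgeVertex {ι : Type} (w : ι → List (X × Bool)) (i : ι) (k : ℕ) : WedgeVertex w :=
  if h : 0 < k ∧ k < (w i).length then some ⟨i, ⟨k, h⟩⟩ else none

/-- The wedge of subdivided circles on which the words `w i` are read from the base vertex. -/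
def wedge {ι : Type} (w : ι → List (X × Bool)) : LabelledGraph X where
  V := WedgeVertex w
  E := Σ i : ι, Fin (w i).length
  o := fun e => if ((w e.1).get e.2).2 then wedgeVertex w e.1 e.2 else wedgeVertex w e.1 (e.2 + 1)
  t := fun e => if ((w e.1).get e.2).2 then wedgeVertex w e.1 (e.2 + 1) else wedgeVertex w e.1 e.2
  lab := fun e => ((w e.1).get e.2).1

end LabelledGraph

universe u

/-- The reduced word of `g` with respect to the free basis `b`. -/
def basisWord {X : Type} [DecidableEq X] {F : Type u} [Group F] (b : FreeGroupBasis X F) (g : F) :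
    List (X × Bool) :=
  (b.repr g).toWord

/-- The element of the group that is spelled by a word in the free basis `b`. -/
def wordValue {X : Type} {F : Type u} [Group F] (b : FreeGroupBasis X F) (w : List (X × Bool)) :
    F :=
  b.repr.symm (FreeGroup.mk w)

/-- The letter `x` or its inverse occurs in the reduced word of `g`. -/
def ContainsLetter {X : Type} [DecidableEq X] {F : Type u} [Group F] (b : FreeGroupBasis X F)
    (g : F) (x : X) : Prop :=
  ∃ s : Bool, (x, s) ∈ basisWord b g

/-- The Stallings graph of a family of elements: the wedge of circles on which the reduced words of
its members are read, completely folded. -/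
def stallingsGraph {X : Type} [DecidableEq X] {F : Type u} [Group F] (b : FreeGroupBasis X F)
    {r : ℕ} (h : Fin r → F) : LabelledGraph X :=
  (LabelledGraph.wedge fun i => basisWord b (h i)).fold

/-- The base vertex of the Stallings graph. -/
def stallingsBase {X : Type} [DecidableEq X] {F : Type u} [Group F] (b : FreeGroupBasis X F)
    {r : ℕ} (h : Fin r → F) : (stallingsGraph b h).V :=
  Quotient.mk (LabelledGraph.wedge fun i => basisWord b (h i)).foldVertexSetoid none

/-- `(Γ, v)` represents the subgroup `H`: it is a finite connected immersed graph, and the image of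
its fundamental group at `v` in the free group is `H`. -/
def RepresentsSubgroup {X : Type} {F : Type u} [Group F] (b : FreeGroupBasis X F)
    (Γ : LabelledGraph X) (v : Γ.V) (H : Subgroup F) : Prop :=
  Finite Γ.V ∧ Finite Γ.E ∧ Γ.IsConnected ∧ Γ.IsImmersion ∧
  ∀ g : F, g ∈ H ↔ ∃ w : List (X × Bool), Γ.Path v w v ∧ wordValue b w = g

/-- `x i` is a letter of `y i` that does not occur in `y j` for `j < i`. -/
def IsNewLetterChoice {n m : ℕ} {F : Type u} [Group F] (b : FreeGroupBasis (Fin n) F)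
    (y : Fin m → F) (x : Fin m → Fin n) : Prop :=
  ∀ i : Fin m, ContainsLetter b (y i) (x i) ∧ ∀ j < i, ¬ ContainsLetter b (y j) (x i)

/-- `H` is in echelon form with respect to the free basis `b`. -/
def IsInEchelonForm {n : ℕ} {F : Type u} [Group F] (b : FreeGroupBasis (Fin n) F)
    (H : Subgroup F) : Prop :=
  ∃ (m : ℕ) (y : FreeGroupBasis (Fin m) H) (x : Fin m → Fin n),
    IsNewLetterChoice b (fun i => (y i : F)) x

/-- `H` is an echelon subgroup: it is in echelon form with respect to some free basis. -/
def IsEchelonSubgroup {F : Type u} [Group F] (H : Subgroup F) : Prop :=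
  ∃ (n : ℕ) (b : FreeGroupBasis (Fin n) F), IsInEchelonForm b H

/-- `H` is a generalized echelon subgroup with respect to the free basis `b`: it is finitely
generated, and its Stallings graph (built from any finite generating family) is generalized
echelon. -/
def IsGeneralizedEchelonSubgroup {n : ℕ} {F : Type u} [Group F] (b : FreeGroupBasis (Fin n) F)
    (H : Subgroup F) : Prop :=
  H.FG ∧ ∀ (r : ℕ) (h : Fin r → F), Subgroup.closure (Set.range h) = H →
    (stallingsGraph b h).IsGeneralizedEchelon

/-- The rank of a group: the least cardinality of a generating set. -/
def groupRank (G : Type u) [Group G] : Cardinal.{u} :=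
  sInf {c : Cardinal.{u} | ∃ S : Set G, Subgroup.closure S = ⊤ ∧ Cardinal.mk S = c}

/-- `H` is inert: `rank (H ∩ K) ≤ rank K` for every subgroup `K`. -/
def IsInertSubgroup {F : Type u} [Group F] (H : Subgroup F) : Prop :=
  ∀ K : Subgroup F, groupRank ↥(H ⊓ K) ≤ groupRank ↥K

/-- The index `i + 1` in `Fin m` of an index `i` in `Fin (m - 1)`. -/
def laterIndex {m : ℕ} (i : Fin (m - 1)) : Fin m :=
  ⟨i.1 + 1, by omega⟩

end

/-! Reduced rank is turned into a dimension. Give the edges distinct primes as weights and twist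
rational coefficients by them: `potentials` is the twisted degree-zero cohomology and `cycles` the
twisted first homology of a subgraph. The valuation of a potential at the prime of `e` jumps across
`e` and across no other edge, so wherever a potential is non-zero every edge is a bridge
(`IsPrimeWeight.eq_nil_of_closed`). Only tree components carry potentials, and by the Euler formula
`finrank_cycles_add` the dimension of `cycles` on an edge set is its reduced rank. Unlike the
numerical rank, these spaces are nested when the edge sets are, so equal dimensions give equal
spaces.

Generalized echelon: let `edgesBelow x k` be the edges without the letters `x l`, `k ≤ l`. The loops
reading the first `k` basis elements lie in it, so its dimension is at least `k - 1`; it is `m - 1`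
for `k = m`; and, for `1 ≤ k < m`, deleting one edge labelled `x k` on the loop of `y k` lowers the
dimension for `k + 1` by one. So all these inequalities are equalities, and deleting that one edge
has the same effect on cycles as deleting every edge with its label
(`finrank_cycles_edgesBelow_aux`, `cycles_avoiding`). Maximal essentiality follows by deleting all
chosen edges. For nesting, every edge of a core piece lies on a twisted cycle that avoids the other
chosen edges (`IsPrimeWeight.exists_cycle_of_core`), and such a cycle is supported away from all
later letters.

Inertness: pull the Cayley tree of the free group back to the graph; the components of this `cover`
are trees. A left order on the free group and an order on the letters order the edges of the cover.
An edge is essential if both subtrees of smaller edges at its ends are infinite. The others are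
matched injectively with vertices by an elder rule (`exists_matching`), so they carry no twisted
cycle, and discarding the essential edges creates no potential; the number of essential edges is
therefore the reduced rank (`IsPrimeWeight.ncard_essentialEdges`). Label-preserving maps from
immersed graphs preserve essential edges (`map_mem_essentialEdges`). If the essential edges of the
graph of `H` have distinct labels, an essential edge of the fibre product with the graph of `K` is
determined by its image in the latter, which bounds the reduced rank of the intersection.

The labels are distinct in echelon form: put the new letters last, in their order. Then `edgesBelow
x k` is closed under passing to smaller edges, hence contains exactly `k - 1` essential edges, which
leaves at most one for each label (`RepresentsSubgroup.injOn_essentialEdges`). -/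

namespace LabelledGraph

/-! ### Walks, reduction and reachability in labelled graphs -/

section Walks

variable {X : Type} (Γ : LabelledGraph X)

/-- The origin of an oriented edge. -/
def src (d : Γ.E × Bool) : Γ.V := if d.2 then Γ.o d.1 else Γ.t d.1

/-- The terminus of an oriented edge. -/
def tgt (d : Γ.E × Bool) : Γ.V := if d.2 then Γ.t d.1 else Γ.o d.1

/-- A list of oriented edges is a walk from `u` to `v`. -/
def IsWalk : Γ.V → List (Γ.E × Bool) → Γ.V → Prop
  | u, [], v => u = v
  | u, d :: l, v => Γ.src d = u ∧ IsWalk (Γ.tgt d) l v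

/-- The word read along a list of oriented edges. -/
def word (l : List (Γ.E × Bool)) : List (X × Bool) := l.map fun d => (Γ.lab d.1, d.2)

/-- `v` can be reached from `u` by a walk with all its edges in `S`. -/
def Reach (S : Set Γ.E) (u v : Γ.V) : Prop := ∃ l, Γ.IsWalk u l v ∧ ∀ d ∈ l, d.1 ∈ S

variable {Γ}

@[simp] lemma src_not (e : Γ.E) (s : Bool) : Γ.src (e, !s) = Γ.tgt (e, s) := by
  cases s <;> simp [src, tgt]

@[simp] lemma tgt_not (e : Γ.E) (s : Bool) : Γ.tgt (e, !s) = Γ.src (e, s) := by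
  cases s <;> simp [src, tgt]

@[simp] lemma src_true (e : Γ.E) : Γ.src (e, true) = Γ.o e := rfl
@[simp] lemma src_false (e : Γ.E) : Γ.src (e, false) = Γ.t e := rfl
@[simp] lemma tgt_true (e : Γ.E) : Γ.tgt (e, true) = Γ.t e := rfl
@[simp] lemma tgt_false (e : Γ.E) : Γ.tgt (e, false) = Γ.o e := rfl

@[simp] lemma isWalk_nil {u v : Γ.V} : Γ.IsWalk u [] v ↔ u = v := Iff.rfl

@[simp] lemma isWalk_cons {u v : Γ.V} {d : Γ.E × Bool} {l : List (Γ.E × Bool)} :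
    Γ.IsWalk u (d :: l) v ↔ Γ.src d = u ∧ Γ.IsWalk (Γ.tgt d) l v := Iff.rfl

lemma isWalk_append {u v : Γ.V} {l l' : List (Γ.E × Bool)} :
    Γ.IsWalk u (l ++ l') v ↔ ∃ w, Γ.IsWalk u l w ∧ Γ.IsWalk w l' v := by
  induction l generalizing u with
  | nil => simp
  | cons d l ih => simp [ih, and_assoc]

lemma IsWalk.append {u v w : Γ.V} {l l' : List (Γ.E × Bool)} (h : Γ.IsWalk u l w)
    (h' : Γ.IsWalk w l' v) : Γ.IsWalk u (l ++ l') v :=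
  isWalk_append.2 ⟨w, h, h'⟩

lemma IsWalk.reverse {u v : Γ.V} {l : List (Γ.E × Bool)} (h : Γ.IsWalk u l v) :
    Γ.IsWalk v (FreeGroup.invRev l) u := by
  induction l generalizing u with
  | nil => simpa using h.symm
  | cons d l ih =>
    rw [FreeGroup.invRev_cons]
    refine (ih h.2).append ?_
    obtain ⟨e, s⟩ := d
    simpa [FreeGroup.invRev] using h.1

lemma mem_invRev {α : Type*} {l : List (α × Bool)} {d : α × Bool} :
    d ∈ FreeGroup.invRev l ↔ (d.1, !d.2) ∈ l := by
  simp only [FreeGroup.invRev, List.mem_reverse, List.mem_map, Prod.exists]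
  constructor
  · rintro ⟨a, b, h, rfl⟩; simpa
  · intro h; exact ⟨d.1, !d.2, h, by simp⟩

lemma IsWalk.end_unique {u v v' : Γ.V} {l : List (Γ.E × Bool)} (h : Γ.IsWalk u l v)
    (h' : Γ.IsWalk u l v') : v = v' := by
  induction l generalizing u with
  | nil => exact h.symm.trans h'
  | cons d l ih => exact ih h.2 h'.2

lemma IsWalk.step {u v : Γ.V} {l l' : List (Γ.E × Bool)} (h : Γ.IsWalk u l v)
    (hr : FreeGroup.Red.Step l l') : Γ.IsWalk u l' v := by
  obtain @⟨L₁, L₂, e, s⟩ := hr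
  obtain ⟨w, h₁, h₂, h₃, h₄⟩ := isWalk_append.1 h
  rw [tgt_not, h₂] at h₄
  exact h₁.append h₄

lemma IsWalk.red {u v : Γ.V} {l l' : List (Γ.E × Bool)} (h : Γ.IsWalk u l v)
    (hr : FreeGroup.Red l l') : Γ.IsWalk u l' v := by
  induction hr with
  | refl => exact h
  | tail _ hs ih => exact ih.step hs

lemma exists_first_mem {α : Type*} {p : α → Prop} {l : List α} (h : ∃ x ∈ l, p x) :
    ∃ a x b, l = a ++ x :: b ∧ p x ∧ ∀ y ∈ a, ¬ p y := by
  induction l with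
  | nil => simp at h
  | cons x l ih =>
    by_cases hx : p x
    · exact ⟨[], x, l, rfl, hx, by simp⟩
    · obtain ⟨a, y, b, rfl, h1, h2⟩ := ih (by simpa [hx] using h)
      exact ⟨x :: a, y, b, rfl, h1, by simpa [hx] using h2⟩

lemma mem_of_red {α : Type*} {l l' : List (α × Bool)} (hr : FreeGroup.Red l l') {d : α × Bool}
    (hd : d ∈ l') : d ∈ l := by
  induction hr with
  | refl => exact hd
  | tail _ hs ih => exact ih (hs.sublist.subset hd)

@[simp] lemma word_nil : Γ.word [] = [] := rfl

@[simp] lemma word_cons (d : Γ.E × Bool) (l : List (Γ.E × Bool)) :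
    Γ.word (d :: l) = (Γ.lab d.1, d.2) :: Γ.word l := rfl

lemma word_append (l l' : List (Γ.E × Bool)) : Γ.word (l ++ l') = Γ.word l ++ Γ.word l' := by
  simp [word]

lemma mk_word (l : List (Γ.E × Bool)) :
    FreeGroup.mk (Γ.word l) = FreeGroup.map Γ.lab (FreeGroup.mk l) := by
  simp [word]

lemma word_invRev (l : List (Γ.E × Bool)) :
    Γ.word (FreeGroup.invRev l) = FreeGroup.invRev (Γ.word l) := by
  simp [word, FreeGroup.invRev, Function.comp_def]

lemma path_iff {u v : Γ.V} {w : List (X × Bool)} :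
    Γ.Path u w v ↔ ∃ l, Γ.IsWalk u l v ∧ Γ.word l = w := by
  constructor
  · intro h
    induction h with
    | nil v => exact ⟨[], rfl, rfl⟩
    | forward e _ ih =>
      obtain ⟨l, hl, rfl⟩ := ih
      exact ⟨(e, true) :: l, ⟨rfl, hl⟩, rfl⟩
    | backward e _ ih =>
      obtain ⟨l, hl, rfl⟩ := ih
      exact ⟨(e, false) :: l, ⟨rfl, hl⟩, rfl⟩
  · rintro ⟨l, hl, rfl⟩
    induction l generalizing u with
    | nil => obtain rfl : u = v := hl; exact Path.nil u
    | cons d l ih =>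
      obtain ⟨e, s⟩ := d
      obtain ⟨rfl, h⟩ := hl
      cases s
      · exact Path.backward e (ih h)
      · exact Path.forward e (ih h)

lemma onClosedPath_iff {v : Γ.V} {w : List (X × Bool)} {e : Γ.E} :
    Γ.OnClosedPath v w e ↔ ∃ l, Γ.IsWalk v l v ∧ Γ.word l = w ∧ ∃ d ∈ l, d.1 = e := by
  constructor
  · rintro ⟨w₁, w₂, ⟨rfl, h₁, h₂⟩ | ⟨rfl, h₁, h₂⟩⟩ <;>
    obtain ⟨l₁, k₁, rfl⟩ := path_iff.1 h₁ <;>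
    obtain ⟨l₂, k₂, rfl⟩ := path_iff.1 h₂
    · exact ⟨l₁ ++ (e, true) :: l₂, k₁.append ⟨rfl, k₂⟩, by simp [word_append],
        (e, true), by simp⟩
    · exact ⟨l₁ ++ (e, false) :: l₂, k₁.append ⟨rfl, k₂⟩, by simp [word_append],
        (e, false), by simp⟩
  · rintro ⟨l, hl, rfl, ⟨e, s⟩, hd, rfl⟩
    obtain ⟨l₁, l₂, rfl⟩ := List.append_of_mem hd
    obtain ⟨u, h₁, rfl, h₂⟩ := isWalk_append.1 hl
    refine ⟨Γ.word l₁, Γ.word l₂, ?_⟩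
    cases s
    · exact Or.inr ⟨by simp [word_append], path_iff.2 ⟨_, h₁, rfl⟩, path_iff.2 ⟨_, h₂, rfl⟩⟩
    · exact Or.inl ⟨by simp [word_append], path_iff.2 ⟨_, h₁, rfl⟩, path_iff.2 ⟨_, h₂, rfl⟩⟩

lemma IsImmersion.dart_eq (hΓ : Γ.IsImmersion) {d d' : Γ.E × Bool} (hs : Γ.src d = Γ.src d')
    (hl : Γ.lab d.1 = Γ.lab d'.1) (hb : d.2 = d'.2) : d = d' := by
  obtain ⟨e, s⟩ := d
  obtain ⟨e', s'⟩ := d'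
  obtain rfl : s = s' := hb
  cases s
  · rw [hΓ.2 e e' hl hs]
  · rw [hΓ.1 e e' hl hs]

lemma IsImmersion.eq_of_word_eq (hΓ : Γ.IsImmersion) {u v v' : Γ.V} {l l' : List (Γ.E × Bool)}
    (h : Γ.IsWalk u l v) (h' : Γ.IsWalk u l' v') (hw : Γ.word l = Γ.word l') : l = l' := by
  induction l generalizing u l' with
  | nil => cases l' with
    | nil => rfl
    | cons => simp at hw
  | cons d l ih => cases l' with
    | nil => simp at hw
    | cons d' l' =>
      simp only [word_cons, List.cons.injEq, Prod.mk.injEq] at hw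
      obtain rfl := hΓ.dart_eq (h.1.trans h'.1.symm) hw.1.1 hw.1.2
      rw [ih h.2 h'.2 hw.2]

lemma IsImmersion.isReduced_word (hΓ : Γ.IsImmersion) {u v : Γ.V} {l : List (Γ.E × Bool)}
    (h : Γ.IsWalk u l v) (hl : FreeGroup.IsReduced l) : FreeGroup.IsReduced (Γ.word l) := by
  induction l generalizing u with
  | nil => exact FreeGroup.IsReduced.nil
  | cons d l ih =>
    cases l with
    | nil => exact FreeGroup.IsReduced.singleton
    | cons d' l =>
      rw [FreeGroup.isReduced_cons_cons] at hl
      simp only [word_cons, FreeGroup.isReduced_cons_cons]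
      refine ⟨fun hlab => ?_, ih h.2 hl.2⟩
      by_contra hne
      obtain ⟨e, s⟩ := d
      have h1 : (e, !s) = d' := by
        refine hΓ.dart_eq ?_ hlab ?_
        · rw [src_not]; exact h.2.1.symm
        · revert hne; cases s <;> cases d'.2 <;> simp
      subst h1
      have := hl.1 rfl
      simp at this

/-- Every walk reduces to a reduced walk, which reads the reduced word. -/
lemma IsImmersion.exists_reduced (hΓ : Γ.IsImmersion) [DecidableEq X] {u v : Γ.V}
    {l : List (Γ.E × Bool)} (h : Γ.IsWalk u l v) :
    ∃ l', FreeGroup.Red l l' ∧ Γ.IsWalk u l' v ∧ FreeGroup.IsReduced l' ∧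
      Γ.word l' = (FreeGroup.mk (Γ.word l)).toWord := by
  classical
  have h1 : FreeGroup.IsReduced (FreeGroup.reduce l) :=
    FreeGroup.isReduced_iff_reduce_eq.2 FreeGroup.reduce.idem
  have h2 := (hΓ.isReduced_word (h.red FreeGroup.reduce.red) h1).reduce_eq
  refine ⟨_, FreeGroup.reduce.red, h.red FreeGroup.reduce.red, h1, ?_⟩
  rw [← h2, ← FreeGroup.toWord_mk, mk_word, FreeGroup.reduce.self, ← mk_word]

/-- In an immersed graph, walks from the same vertex with the same label in the free group agree
up to reduction. -/
lemma IsImmersion.exists_common_red (hΓ : Γ.IsImmersion) {u v v' : Γ.V}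
    {l l' : List (Γ.E × Bool)} (h : Γ.IsWalk u l v) (h' : Γ.IsWalk u l' v')
    (hw : FreeGroup.mk (Γ.word l) = FreeGroup.mk (Γ.word l')) :
    ∃ L, FreeGroup.IsReduced L ∧ FreeGroup.Red l L ∧ FreeGroup.Red l' L := by
  classical
  obtain ⟨L, hL, hLw, hLr, hw₁⟩ := hΓ.exists_reduced h
  obtain ⟨L', hL', hLw', -, hw₂⟩ := hΓ.exists_reduced h'
  obtain rfl := hΓ.eq_of_word_eq hLw hLw' (by rw [hw₁, hw₂, hw])
  exact ⟨L, hLr, hL, hL'⟩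

lemma IsImmersion.mk_eq (hΓ : Γ.IsImmersion) {u v v' : Γ.V} {l l' : List (Γ.E × Bool)}
    (h : Γ.IsWalk u l v) (h' : Γ.IsWalk u l' v')
    (hw : FreeGroup.mk (Γ.word l) = FreeGroup.mk (Γ.word l')) :
    FreeGroup.mk l = FreeGroup.mk l' := by
  obtain ⟨L, -, h₁, h₂⟩ := hΓ.exists_common_red h h' hw
  exact FreeGroup.Red.exact.2 ⟨L, h₁, h₂⟩

lemma IsImmersion.end_eq (hΓ : Γ.IsImmersion) {u v v' : Γ.V} {l l' : List (Γ.E × Bool)}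
    (h : Γ.IsWalk u l v) (h' : Γ.IsWalk u l' v')
    (hw : FreeGroup.mk (Γ.word l) = FreeGroup.mk (Γ.word l')) : v = v' := by
  obtain ⟨L, -, h₁, h₂⟩ := hΓ.exists_common_red h h' hw
  exact (h.red h₁).end_unique (h'.red h₂)

lemma Reach.refl (S : Set Γ.E) (u : Γ.V) : Γ.Reach S u u := ⟨[], rfl, by simp⟩

lemma Reach.trans {S : Set Γ.E} {u v w : Γ.V} (h : Γ.Reach S u v) (h' : Γ.Reach S v w) :
    Γ.Reach S u w := by
  obtain ⟨l, hl, hS⟩ := h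
  obtain ⟨l', hl', hS'⟩ := h'
  refine ⟨l ++ l', hl.append hl', fun d hd => ?_⟩
  rcases List.mem_append.1 hd with hd | hd
  exacts [hS d hd, hS' d hd]

lemma Reach.symm {S : Set Γ.E} {u v : Γ.V} (h : Γ.Reach S u v) : Γ.Reach S v u := by
  obtain ⟨l, hl, hS⟩ := h
  exact ⟨_, hl.reverse, fun d hd => hS (d.1, !d.2) (mem_invRev.1 hd)⟩

lemma Reach.edge {S : Set Γ.E} {e : Γ.E} (he : e ∈ S) : Γ.Reach S (Γ.o e) (Γ.t e) :=
  ⟨[(e, true)], ⟨rfl, rfl⟩, by simpa⟩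

lemma Reach.dart {S : Set Γ.E} {d : Γ.E × Bool} (he : d.1 ∈ S) : Γ.Reach S (Γ.src d) (Γ.tgt d) :=
  ⟨[d], ⟨rfl, rfl⟩, by simpa⟩

lemma Reach.mono {S S' : Set Γ.E} (hS : S ⊆ S') {u v : Γ.V} (h : Γ.Reach S u v) :
    Γ.Reach S' u v := by
  obtain ⟨l, hl, h⟩ := h
  exact ⟨l, hl, fun d hd => hS (h d hd)⟩

/-- Induction along a walk: a property that passes along the edges of `S` passes to every vertex
that can be reached. -/
lemma Reach.induction {S : Set Γ.E} {p : Γ.V → Prop} (hp : ∀ e ∈ S, p (Γ.o e) ↔ p (Γ.t e))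
    {u v : Γ.V} (h : Γ.Reach S u v) (hu : p u) : p v := by
  obtain ⟨l, hl, hS⟩ := h
  induction l generalizing u with
  | nil => obtain rfl : u = v := hl; exact hu
  | cons d l ih =>
    obtain ⟨e, s⟩ := d
    obtain ⟨rfl, hl⟩ := hl
    have he := hp e (hS (e, s) (by simp))
    refine ih ?_ hl fun d hd => hS d (by simp [hd])
    cases s
    · exact he.2 hu
    · exact he.1 hu

lemma component_eq_iff {u v : Γ.V} : Γ.component u = Γ.component v ↔ Γ.Reach Set.univ u v := by
  constructor
  · intro h
    have h' := Quot.eqvGen_exact h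
    clear h
    induction h' with
    | rel x y h => obtain ⟨e, rfl, rfl⟩ := h; exact Reach.edge trivial
    | refl x => exact Reach.refl _ _
    | symm x y _ ih => exact ih.symm
    | trans x y z _ _ ih ih' => exact ih.trans ih'
  · intro h
    refine h.induction (p := fun w => Γ.component u = Γ.component w) (fun e _ => ?_) rfl
    have : Γ.component (Γ.o e) = Γ.component (Γ.t e) := Quot.sound ⟨e, rfl, rfl⟩
    rw [this]

lemma isConnected_iff : Γ.IsConnected ↔ Nonempty Γ.V ∧ ∀ u v : Γ.V, Γ.Reach Set.univ u v := by
  refine and_congr_right fun _ => ⟨fun h u v => component_eq_iff.1 (Subsingleton.elim _ _),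
    fun h => ⟨fun a b => ?_⟩⟩
  induction a using Quot.inductionOn
  induction b using Quot.inductionOn
  exact component_eq_iff.2 (h _ _)

lemma deleteEdges_reach {D : Set Γ.E} {u v : Γ.V} :
    (Γ.deleteEdges D).Reach Set.univ u v ↔ Γ.Reach Dᶜ u v := by
  constructor
  · intro h
    refine Reach.induction (Γ := Γ.deleteEdges D) (p := fun w => Γ.Reach Dᶜ u w) (fun e _ => ?_) h
      (Reach.refl _ _)
    have h1 : Γ.Reach Dᶜ (Γ.o e.1) (Γ.t e.1) := Reach.edge e.2
    exact ⟨fun h => h.trans h1, fun h => h.trans h1.symm⟩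
  · intro h
    refine Reach.induction (Γ := Γ) (p := fun w : Γ.V => (Γ.deleteEdges D).Reach Set.univ u w)
      (fun e he => ?_) h (Reach.refl _ _)
    have h1 : (Γ.deleteEdges D).Reach Set.univ (Γ.o e) (Γ.t e) :=
      Reach.edge (Γ := Γ.deleteEdges D) (e := ⟨e, he⟩) trivial
    exact ⟨fun h => h.trans h1, fun h => h.trans h1.symm⟩

end Walks

/-! ### Homology with prime-weighted coefficients -/

section TwistedCycles

variable {X : Type} (Γ : LabelledGraph X)

/-- The coboundary with coefficients twisted by the weights `lam` of the edges. -/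
def coboundary (lam : Γ.E → ℚ) : (Γ.V → ℚ) →ₗ[ℚ] (Γ.E → ℚ) where
  toFun φ e := φ (Γ.o e) - lam e * φ (Γ.t e)
  map_add' φ ψ := by ext e; simp; ring
  map_smul' c φ := by ext e; simp; ring

/-- The twisted cocycles of degree zero on the subgraph with edge set `T`. -/
def potentials (lam : Γ.E → ℚ) (T : Set Γ.E) : Submodule ℚ (Γ.V → ℚ) where
  carrier := {φ | ∀ e ∈ T, φ (Γ.o e) = lam e * φ (Γ.t e)}
  add_mem' h h' e he := by simp [h e he, h' e he]; ring
  zero_mem' e _ := by simp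
  smul_mem' c φ h e he := by simp [h e he]; ring

/-- The twisted cycles supported on `T`. -/
def cycles [Fintype Γ.E] (lam : Γ.E → ℚ) (T : Set Γ.E) : Submodule ℚ (Γ.E → ℚ) where
  carrier := {z | (∀ e ∉ T, z e = 0) ∧ ∀ φ : Γ.V → ℚ, ∑ e, z e * Γ.coboundary lam φ e = 0}
  add_mem' h h' := ⟨fun e he => by simp [h.1 e he, h'.1 e he],
    fun φ => by simp [add_mul, Finset.sum_add_distrib, h.2 φ, h'.2 φ]⟩
  zero_mem' := by simp
  smul_mem' c z h := ⟨fun e he => by simp [h.1 e he],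
    fun φ => by simp [mul_assoc, ← Finset.mul_sum, h.2 φ]⟩

variable {Γ}

@[simp] lemma coboundary_apply (lam : Γ.E → ℚ) (φ : Γ.V → ℚ) (e : Γ.E) :
    Γ.coboundary lam φ e = φ (Γ.o e) - lam e * φ (Γ.t e) := rfl

lemma mem_potentials {lam : Γ.E → ℚ} {T : Set Γ.E} {φ : Γ.V → ℚ} :
    φ ∈ Γ.potentials lam T ↔ ∀ e ∈ T, φ (Γ.o e) = lam e * φ (Γ.t e) := Iff.rfl

lemma potentials_anti {lam : Γ.E → ℚ} {S T : Set Γ.E} (h : S ⊆ T) :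
    Γ.potentials lam T ≤ Γ.potentials lam S := fun _ hφ e he => hφ e (h he)

lemma cycles_mono [Fintype Γ.E] {lam : Γ.E → ℚ} {S T : Set Γ.E} (h : S ⊆ T) :
    Γ.cycles lam S ≤ Γ.cycles lam T := fun _ hz => ⟨fun e he => hz.1 e fun h' => he (h h'), hz.2⟩

lemma mem_cycles_of_support [Fintype Γ.E] {lam : Γ.E → ℚ} {S T : Set Γ.E} {z : Γ.E → ℚ}
    (hz : z ∈ Γ.cycles lam T) (h : ∀ e ∉ S, z e = 0) : z ∈ Γ.cycles lam S := ⟨h, hz.2⟩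

open Classical in
/-- The Euler characteristic formula for twisted coefficients. -/
theorem finrank_cycles_add [Fintype Γ.E] [Fintype Γ.V] (lam : Γ.E → ℚ) (T : Set Γ.E) :
    Module.finrank ℚ (Γ.cycles lam T) + Nat.card Γ.V =
      T.ncard + Module.finrank ℚ (Γ.potentials lam T) := by
  let R : (Γ.V → ℚ) →ₗ[ℚ] (T → ℚ) := (LinearMap.funLeft ℚ ℚ (Subtype.val : T → Γ.E)).comp
    (Γ.coboundary lam)
  have hR : ∀ φ (e : T), R φ e = Γ.coboundary lam φ e := fun φ e => rfl
  let M := LinearMap.toMatrix' R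
  let L : (T → ℚ) →ₗ[ℚ] (Γ.E → ℚ) := Function.ExtendByZero.linearMap ℚ (Subtype.val : T → Γ.E)
  have hL : ∀ (y : T → ℚ) (e : T), L y e = y e := fun y e =>
    Subtype.val_injective.extend_apply _ _ _
  have hL0 : ∀ (y : T → ℚ) (e : Γ.E), e ∉ T → L y e = 0 := fun y e he =>
    Function.extend_apply' _ _ _ (by rintro ⟨a, rfl⟩; exact he a.2)
  have hLinj : Function.Injective L := fun y y' h => by
    ext e; rw [← hL y, ← hL y', h]
  have hpair : ∀ (y : T → ℚ) (φ : Γ.V → ℚ),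
      ∑ e, L y e * Γ.coboundary lam φ e = (M.transpose.mulVec y) ⬝ᵥ φ := by
    intro y φ
    have h1 : M.mulVec φ = R φ := by
      rw [← Matrix.toLin'_apply, Matrix.toLin'_toMatrix']
    rw [Matrix.mulVec_transpose, ← Matrix.dotProduct_mulVec, h1, dotProduct]
    rw [← Finset.sum_subset (Finset.subset_univ (Finset.univ.filter (· ∈ T)))]
    · rw [Finset.sum_subtype (p := (· ∈ T)) _ (by simp)]
      exact Finset.sum_congr rfl fun e _ => by rw [hL, hR]
    · intro e _ he
      rw [hL0 y e (by simpa using he), zero_mul]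
  have hcyc : Γ.cycles lam T = (LinearMap.ker M.transpose.mulVecLin).map L := by
    ext z
    constructor
    · intro hz
      refine ⟨fun e => z e, ?_, ?_⟩
      · have h0 : L (fun e => z e) = z := by
          ext e
          by_cases he : e ∈ T
          · exact hL _ ⟨e, he⟩
          · rw [hL0 _ _ he, hz.1 e he]
        rw [SetLike.mem_coe, LinearMap.mem_ker, Matrix.mulVecLin_apply]
        refine dotProduct_eq_zero _ fun φ => ?_
        rw [← hpair, h0]
        exact hz.2 φ
      · ext e
        by_cases he : e ∈ T
        · exact hL _ ⟨e, he⟩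
        · rw [hL0 _ _ he, hz.1 e he]
    · rintro ⟨y, hy, rfl⟩
      refine ⟨hL0 y, fun φ => ?_⟩
      rw [hpair, ← Matrix.mulVecLin_apply, LinearMap.mem_ker.1 hy, zero_dotProduct]
  have hker : LinearMap.ker R = Γ.potentials lam T := by
    ext φ
    rw [LinearMap.mem_ker, mem_potentials]
    constructor
    · intro h e he
      have := congrFun h ⟨e, he⟩
      rw [hR] at this
      simpa [sub_eq_zero] using this
    · intro h
      ext e
      rw [hR, coboundary_apply, h e e.2, sub_self]
      rfl
  have h1 := LinearMap.finrank_range_add_finrank_ker M.transpose.mulVecLin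
  have h2 := LinearMap.finrank_range_add_finrank_ker R
  -- Cycles and potentials are the kernels of the transpose of `M` and of `M`. Since row rank equals
  -- column rank, subtracting the two rank-nullity formulas gives the claim.
  have h3 : Module.finrank ℚ (LinearMap.range M.transpose.mulVecLin) =
      Module.finrank ℚ (LinearMap.range R) := by
    have : M.transpose.rank = M.rank := Matrix.rank_transpose M
    rw [Matrix.rank, Matrix.rank, ← Matrix.toLin'_apply', ← Matrix.toLin'_apply',
      Matrix.toLin'_toMatrix'] at this
    rw [← this, Matrix.toLin'_apply']
  rw [hker] at h2
  rw [Module.finrank_fintype_fun_eq_card] at h1 h2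
  have h4 : Module.finrank ℚ (Γ.cycles lam T) =
      Module.finrank ℚ (LinearMap.ker M.transpose.mulVecLin) := by
    rw [hcyc]
    exact (LinearEquiv.finrank_eq (Submodule.equivMapOfInjective L hLinj _)).symm
  have h5 : Fintype.card T = T.ncard := by rw [← Nat.card_coe_set_eq, Nat.card_eq_fintype_card]
  rw [Nat.card_eq_fintype_card]
  omega

/-- Injective weights by prime numbers. -/
def IsPrimeWeight (lam : Γ.E → ℚ) : Prop :=
  ∃ p : Γ.E → ℕ, Function.Injective p ∧ (∀ e, (p e).Prime) ∧ ∀ e, lam e = p e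

lemma exists_isPrimeWeight (Γ : LabelledGraph X) [Finite Γ.E] :
    ∃ lam : Γ.E → ℚ, IsPrimeWeight lam := by
  obtain ⟨n, ⟨f⟩⟩ := Finite.exists_equiv_fin Γ.E
  exact ⟨fun e => (Nat.nth Nat.Prime (f e) : ℚ), fun e => Nat.nth Nat.Prime (f e),
    fun a b h => f.injective (Fin.ext (Nat.nth_injective Nat.infinite_setOfPred_prime h)),
    fun e => Nat.prime_nth_prime _, fun _ => rfl⟩

lemma IsPrimeWeight.ne_zero {lam : Γ.E → ℚ} (h : IsPrimeWeight lam) (e : Γ.E) : lam e ≠ 0 := by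
  obtain ⟨p, _, hp, hl⟩ := h
  rw [hl]
  exact_mod_cast (hp e).ne_zero

lemma IsPrimeWeight.potential_ne_zero_iff {lam : Γ.E → ℚ} (h : IsPrimeWeight lam) {T : Set Γ.E}
    {φ : Γ.V → ℚ} (hφ : φ ∈ Γ.potentials lam T) {e : Γ.E} (he : e ∈ T) :
    φ (Γ.o e) ≠ 0 ↔ φ (Γ.t e) ≠ 0 := by
  rw [hφ e he]
  simp [h.ne_zero e]

lemma IsPrimeWeight.potential_ne_zero_of_reach {lam : Γ.E → ℚ} (h : IsPrimeWeight lam)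
    {T : Set Γ.E} {φ : Γ.V → ℚ} (hφ : φ ∈ Γ.potentials lam T) {u v : Γ.V} (hr : Γ.Reach T u v)
    (hu : φ u ≠ 0) : φ v ≠ 0 :=
  hr.induction (p := fun w => φ w ≠ 0) (fun _ he => h.potential_ne_zero_iff hφ he) hu

/-- A non-vanishing potential separates the two ends of any edge by an integral function that is
constant along all other edges. -/
lemma IsPrimeWeight.exists_height {lam : Γ.E → ℚ} (h : IsPrimeWeight lam) {T : Set Γ.E}
    {φ : Γ.V → ℚ} (hφ : φ ∈ Γ.potentials lam T) (e : Γ.E) :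
    ∃ ψ : Γ.V → ℤ, ∀ f ∈ T, φ (Γ.o f) ≠ 0 →
      (f = e → ψ (Γ.o f) = ψ (Γ.t f) + 1) ∧ (f ≠ e → ψ (Γ.o f) = ψ (Γ.t f)) := by
  have hnz := fun f (hf : f ∈ T) => (h.potential_ne_zero_iff hφ hf)
  obtain ⟨p, hinj, hp, hl⟩ := h
  have := Fact.mk (hp e)
  -- Along `f` the potential is multiplied by the prime of `f`, whose valuation at the prime of `e`
  -- is one if `f = e` and zero otherwise.
  refine ⟨fun u => padicValRat (p e) (φ u), fun f hf hf0 => ?_⟩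
  have ht := (hnz f hf).1 hf0
  have hpf : (p f : ℚ) ≠ 0 := by exact_mod_cast (hp f).ne_zero
  have key : padicValRat (p e) (φ (Γ.o f)) =
      padicValRat (p e) (p f : ℚ) + padicValRat (p e) (φ (Γ.t f)) := by
    rw [hφ f hf, hl, padicValRat.mul hpf ht]
  constructor
  · rintro rfl
    change padicValRat (p f) (φ (Γ.o f)) = padicValRat (p f) (φ (Γ.t f)) + 1
    rw [key, padicValRat.self (hp f).one_lt, add_comm]
  · intro hne
    have : padicValRat (p e) (p f : ℚ) = 0 := by
      rw [padicValRat.of_nat, Nat.cast_eq_zero]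
      have := Fact.mk (hp f)
      exact padicValNat_primes fun h => hne (hinj h.symm)
    exact key.trans (by rw [this, zero_add])

/-- Twisted cycles vanish wherever a potential does not. -/
lemma IsPrimeWeight.cycle_eq_zero [Fintype Γ.E] {lam : Γ.E → ℚ} (h : IsPrimeWeight lam)
    {T : Set Γ.E} {φ : Γ.V → ℚ} (hφ : φ ∈ Γ.potentials lam T) {z : Γ.E → ℚ}
    (hz : z ∈ Γ.cycles lam T) {e : Γ.E} (he : φ (Γ.o e) ≠ 0) : z e = 0 := by
  by_cases heT : e ∈ T
  swap
  · exact hz.1 e heT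
  obtain ⟨ψ, hψ⟩ := h.exists_height hφ e
  -- Tested against `φ * ψ`, an edge `f` of `T` contributes `z f * φ (o f) * (ψ (o f) - ψ (t f))`,
  -- so only the term of `e` survives.
  have h1 := hz.2 fun u => φ u * ψ u
  rw [Finset.sum_eq_single e] at h1
  · have h2 := (hψ e heT he).1 rfl
    rw [coboundary_apply, ← mul_assoc, ← hφ e heT, h2] at h1
    push_cast at h1
    have h3 : z e * φ (Γ.o e) = 0 := by linear_combination h1
    exact (mul_eq_zero.1 h3).resolve_right he
  · intro f _ hf
    by_cases hfT : f ∈ T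
    · rw [coboundary_apply, ← mul_assoc, ← hφ f hfT]
      by_cases h0 : φ (Γ.o f) = 0
      · simp [h0]
      · rw [(hψ f hfT h0).2 hf]; ring
    · rw [hz.1 f hfT, zero_mul]
  · simp

lemma IsReduced.of_append_left {α : Type*} {l l' : List (α × Bool)}
    (h : FreeGroup.IsReduced (l ++ l')) : FreeGroup.IsReduced l :=
  h.infix (List.prefix_append l l').isInfix

lemma IsReduced.of_append_right {α : Type*} {l l' : List (α × Bool)}
    (h : FreeGroup.IsReduced (l ++ l')) : FreeGroup.IsReduced l' :=
  h.infix (List.suffix_append l l').isInfix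

/-- A vertex at which a potential does not vanish lies on no reduced closed walk. -/
theorem IsPrimeWeight.eq_nil_of_closed {lam : Γ.E → ℚ} (h : IsPrimeWeight lam) {T : Set Γ.E}
    {φ : Γ.V → ℚ} (hφ : φ ∈ Γ.potentials lam T) {u : Γ.V} {l : List (Γ.E × Bool)}
    (hl : Γ.IsWalk u l u) (hred : FreeGroup.IsReduced l) (hT : ∀ d ∈ l, d.1 ∈ T) (hu : φ u ≠ 0) :
    l = [] := by
  -- Crossing the first edge changes its height function `ψ`, which no other edge can undo. A closed
  -- walk must therefore recross that edge backwards, and the part in between is a shorter closed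
  -- reduced walk, hence empty: a backtrack.
  induction hn : l.length using Nat.strong_induction_on generalizing u l with
  | _ n ih =>
  cases l with
  | nil => rfl
  | cons d l =>
    exfalso
    obtain ⟨rfl, hl⟩ := hl
    have hd : d.1 ∈ T := hT d (by simp)
    have hd0 : φ (Γ.tgt d) ≠ 0 := h.potential_ne_zero_of_reach hφ (Reach.dart hd) hu
    obtain ⟨ψ, hψ⟩ := h.exists_height hφ d.1
    have hconst : ∀ (a : List (Γ.E × Bool)) (w w' : Γ.V), Γ.IsWalk w a w' →
        (∀ d' ∈ a, d'.1 ∈ T ∧ d'.1 ≠ d.1) → φ w ≠ 0 → ψ w = ψ w' := by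
      intro a w w' ha haT hw
      refine (Reach.induction (S := {f | f ∈ T ∧ f ≠ d.1})
        (p := fun w' => φ w' ≠ 0 ∧ ψ w = ψ w') (fun e he => ?_) ⟨a, ha, haT⟩ ⟨hw, rfl⟩).2
      have h1 := h.potential_ne_zero_iff hφ he.1
      constructor
      · rintro ⟨h2, h3⟩; exact ⟨h1.1 h2, h3.trans ((hψ e he.1 h2).2 he.2)⟩
      · rintro ⟨h2, h3⟩; exact ⟨h1.2 h2, h3.trans ((hψ e he.1 (h1.2 h2)).2 he.2).symm⟩
    have hne : ψ (Γ.src d) ≠ ψ (Γ.tgt d) := by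
      obtain ⟨e, s⟩ := d
      cases s
      · have := (hψ e hd (by simpa using hd0)).1 rfl
        simp only [src_false, tgt_false]; omega
      · have := (hψ e hd (by simpa using hu)).1 rfl
        simp only [src_true, tgt_true]; omega
    by_cases hex : ∃ d' ∈ l, d'.1 = d.1
    · obtain ⟨a, d', b, rfl, hd', ha⟩ := exists_first_mem hex
      obtain ⟨w, hw, hw', hw''⟩ := isWalk_append.1 hl
      have haT : ∀ x ∈ a, x.1 ∈ T := fun x hx => hT x (by simp [hx])
      have hc := hconst a _ _ hw (fun x hx => ⟨haT x hx, ha x hx⟩) hd0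
      by_cases hs : d'.2 = d.2
      · obtain rfl : d' = d := Prod.ext hd' hs
        rw [← hw'] at hc
        exact hne hc.symm
      · obtain ⟨e, s⟩ := d
        obtain ⟨e', s'⟩ := d'
        obtain rfl : e' = e := hd'
        obtain rfl : s' = !s := by revert hs; cases s <;> cases s' <;> simp
        rw [src_not] at hw'
        subst hw'
        have hared : FreeGroup.IsReduced ((e', s) :: (a ++ [(e', !s)])) := by
          refine hred.infix ⟨[], b, by simp⟩
        have := ih a.length (by simp at hn; omega) hw
          (IsReduced.of_append_left (IsReduced.of_append_right (l := [(e', s)]) hared)) haT hd0 rfl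
        subst this
        simp [FreeGroup.isReduced_cons_cons] at hared
    · push Not at hex
      exact hne (hconst l _ _ hl (fun x hx => ⟨hT x (by simp [hx]), hex x hx⟩) hd0).symm

/-- Evaluation of cycles on `S` has rank at most `|S|`, and its kernel consists of cycles supported
off `S`. -/
lemma finrank_cycles_le_add_ncard [Fintype Γ.E] (lam : Γ.E → ℚ) (T S : Set Γ.E) :
    Module.finrank ℚ (Γ.cycles lam T) ≤ Module.finrank ℚ (Γ.cycles lam (T \ S)) + S.ncard := by
  classical
  let ev : Γ.cycles lam T →ₗ[ℚ] (S → ℚ) :=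
    (LinearMap.funLeft ℚ ℚ Subtype.val).comp (Γ.cycles lam T).subtype
  have h1 := LinearMap.finrank_range_add_finrank_ker ev
  have h2 := Submodule.finrank_le (LinearMap.range ev)
  rw [Module.finrank_fintype_fun_eq_card, ← Nat.card_eq_fintype_card, Nat.card_coe_set_eq] at h2
  have h3 : Module.finrank ℚ (LinearMap.ker ev) ≤ Module.finrank ℚ (Γ.cycles lam (T \ S)) := by
    have : (LinearMap.ker ev).map (Γ.cycles lam T).subtype ≤ Γ.cycles lam (T \ S) := by
      rintro _ ⟨z, hz, rfl⟩
      refine mem_cycles_of_support z.2 fun e he => ?_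
      by_cases heS : e ∈ S
      · exact congrFun hz ⟨e, heS⟩
      · exact z.2.1 e fun heT => he ⟨heT, heS⟩
    exact (LinearEquiv.finrank_eq (Submodule.equivMapOfInjective _
      (Submodule.subtype_injective (Γ.cycles lam T)) (LinearMap.ker ev))).trans_le
      (Submodule.finrank_mono this)
  omega

lemma finrank_cycles_diff [Fintype Γ.E] {lam : Γ.E → ℚ} {T : Set Γ.E} {f : Γ.E}
    {z : Γ.E → ℚ} (hz : z ∈ Γ.cycles lam T) (hzf : z f ≠ 0) :
    Module.finrank ℚ (Γ.cycles lam T) = Module.finrank ℚ (Γ.cycles lam (T \ {f})) + 1 := by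
  refine le_antisymm (by simpa using finrank_cycles_le_add_ncard lam T {f}) ?_
  refine Submodule.finrank_lt_finrank_of_lt (lt_of_le_of_ne (cycles_mono Set.sdiff_subset) ?_)
  intro h
  rw [← h] at hz
  exact hzf (hz.1 f (by simp))

/-- An edge that lies on no twisted cycle is separated by a potential. -/
lemma exists_potential [Fintype Γ.E] [Fintype Γ.V] {lam : Γ.E → ℚ} {T : Set Γ.E} {f : Γ.E}
    (hf : f ∈ T) (h : ∀ z ∈ Γ.cycles lam T, z f = 0) :
    ∃ φ ∈ Γ.potentials lam (T \ {f}), φ (Γ.o f) ≠ lam f * φ (Γ.t f) := by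
  -- If all such potentials extended over `f`, deleting `f` would change neither cycles nor
  -- potentials, yet the Euler formula loses an edge.
  by_contra! hcon
  have h1 : Γ.potentials lam (T \ {f}) = Γ.potentials lam T := by
    refine le_antisymm (fun φ hφ e he => ?_) (potentials_anti Set.sdiff_subset)
    by_cases hef : e = f
    · subst hef; exact hcon φ hφ
    · exact hφ e ⟨he, hef⟩
  have h2 : Γ.cycles lam (T \ {f}) = Γ.cycles lam T := by
    refine le_antisymm (cycles_mono Set.sdiff_subset) fun z hz => ?_
    refine mem_cycles_of_support hz fun e he => ?_
    by_cases hef : e = f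
    · subst hef; exact h z hz
    · exact hz.1 e fun heT => he ⟨heT, hef⟩
  have h3 := finrank_cycles_add lam T
  have h4 := finrank_cycles_add lam (T \ {f})
  rw [h1, h2] at h4
  have h5 := Set.ncard_sdiff_singleton_add_one hf (Set.toFinite T)
  omega

/-- The number of edges of a subgraph is bounded by the number of its vertices and the number of
twisted cycles. -/
lemma ncard_le_add_finrank_cycles [Fintype Γ.E] [Fintype Γ.V] (lam : Γ.E → ℚ) {T : Set Γ.E}
    {U : Set Γ.V} (hU : ∀ e ∈ T, Γ.o e ∈ U ∧ Γ.t e ∈ U) :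
    T.ncard ≤ U.ncard + Module.finrank ℚ (Γ.cycles lam T) := by
  classical
  let L : (↥Uᶜ → ℚ) →ₗ[ℚ] (Γ.V → ℚ) :=
    Function.ExtendByZero.linearMap ℚ (Subtype.val : ↥Uᶜ → Γ.V)
  have hL : Function.Injective L := fun y y' h => by
    ext u
    have : ∀ y : ↥Uᶜ → ℚ, L y u = y u := fun y => Subtype.val_injective.extend_apply _ _ _
    rw [← this y, ← this y', h]
  have hL0 : ∀ y u, u ∈ U → L y u = 0 := fun y u hu =>
    Function.extend_apply' _ _ _ (by rintro ⟨a, rfl⟩; exact a.2 hu)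
  -- Functions vanishing on `U` satisfy every edge condition trivially, so the vertices outside `U`
  -- contribute fully to the potentials.
  have h1 : LinearMap.range L ≤ Γ.potentials lam T := by
    rintro _ ⟨y, rfl⟩ e he
    rw [hL0 y _ (hU e he).1, hL0 y _ (hU e he).2, mul_zero]
  have h2 := Submodule.finrank_mono h1
  rw [LinearMap.finrank_range_of_inj hL, Module.finrank_fintype_fun_eq_card,
    ← Nat.card_eq_fintype_card, Nat.card_coe_set_eq] at h2
  have h3 := finrank_cycles_add lam T
  have h4 := Set.ncard_add_ncard_compl U
  omega

end TwistedCycles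

/-! ### Edges that lie on a twisted cycle -/

section Essential

variable {X : Type} {Γ : LabelledGraph X}

/-- An edge of a reduced closed walk lies on a twisted cycle, provided that there is another
non-trivial reduced closed walk at the same vertex that avoids the edge. -/
theorem IsPrimeWeight.exists_cycle_of_closed [Fintype Γ.E] [Fintype Γ.V] {lam : Γ.E → ℚ}
    (h : IsPrimeWeight lam) {T : Set Γ.E} {v : Γ.V} {l₀ l : List (Γ.E × Bool)} {e : Γ.E}
    (hl₀ : Γ.IsWalk v l₀ v) (hr₀ : FreeGroup.IsReduced l₀) (hT₀ : ∀ d ∈ l₀, d.1 ∈ T \ {e})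
    (hne : l₀ ≠ []) (hl : Γ.IsWalk v l v) (hr : FreeGroup.IsReduced l) (hT : ∀ d ∈ l, d.1 ∈ T)
    (he : ∃ d ∈ l, d.1 = e) : ∃ z ∈ Γ.cycles lam T, z e ≠ 0 := by
  by_contra! hcon
  have heT : e ∈ T := by obtain ⟨d, hd, rfl⟩ := he; exact hT d hd
  obtain ⟨φ, hφ, hφe⟩ := exists_potential heT hcon
  -- The second loop `l₀` survives the deletion of `e`, so the component of `v` in `T \ {e}` is not
  -- a tree.
  have hv : φ v = 0 := by
    by_contra hv
    exact hne (h.eq_nil_of_closed hφ hl₀ hr₀ hT₀ hv)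
  obtain ⟨a, d, b, rfl, rfl, ha⟩ := exists_first_mem he
  obtain ⟨w, hw, rfl, hb⟩ := isWalk_append.1 hl
  have hsrc : φ (Γ.src d) = 0 := by
    by_contra h0
    refine h.potential_ne_zero_of_reach hφ (Reach.symm ⟨a, hw, fun x hx => ?_⟩) h0 hv
    exact ⟨hT x (by simp [hx]), ha x hx⟩
  have htgt : φ (Γ.tgt d) ≠ 0 := by
    intro h0
    apply hφe
    obtain ⟨e, s⟩ := d
    cases s <;> simp_all
  -- The walk has entered a region where `φ` is non-zero, that is, a tree attached only through `e`.
  -- It must leave through `e` again, and being reduced it cannot.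
  by_cases hex : ∃ x ∈ b, x.1 = d.1
  · obtain ⟨a', d', b', rfl, hd', ha'⟩ := exists_first_mem hex
    obtain ⟨w, hw', rfl, -⟩ := isWalk_append.1 hb
    have haT : ∀ x ∈ a', x.1 ∈ T \ {d.1} := fun x hx => ⟨hT x (by simp [hx]), ha' x hx⟩
    have hd0 := h.potential_ne_zero_of_reach hφ ⟨a', hw', haT⟩ htgt
    have hs : d'.2 ≠ d.2 := fun hs => by
      rw [show d' = d from Prod.ext hd' hs] at hd0
      exact hd0 hsrc
    obtain ⟨e, s⟩ := d
    obtain ⟨e', s'⟩ := d'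
    obtain rfl : e' = e := hd'
    obtain rfl : s' = !s := by revert hs; cases s <;> cases s' <;> simp
    rw [src_not] at hw'
    have hared : FreeGroup.IsReduced ((e', s) :: (a' ++ [(e', !s)])) :=
      hr.infix ⟨a, b', by simp⟩
    have := h.eq_nil_of_closed hφ hw'
      (IsReduced.of_append_left (IsReduced.of_append_right (l := [(e', s)]) hared)) haT htgt
    subst this
    simp [FreeGroup.isReduced_cons_cons] at hared
  · push Not at hex
    refine h.potential_ne_zero_of_reach hφ ⟨b, hb, fun x hx => ?_⟩ htgt hv
    exact ⟨hT x (by simp [hx]), hex x hx⟩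

/-- The degree counts the oriented edges starting at the vertex, a loop giving two; `x` is one of
them, so degree different from one yields another. -/
lemma exists_dart_of_degree_ne_one [Finite Γ.E] {T : Set Γ.E} {x : Γ.E × Bool} (hx : x.1 ∈ T)
    (h : Γ.degreeIn T (Γ.src x) ≠ 1) : ∃ y ≠ x, y.1 ∈ T ∧ Γ.src y = Γ.src x := by
  by_contra! hcon
  apply h
  obtain ⟨e, s⟩ := x
  cases s
  · have h1 : {f ∈ T | Γ.o f = Γ.t e} = ∅ := by
      ext f
      simp only [Set.mem_ofPred_eq, Set.mem_empty_iff_false, iff_false, not_and]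
      exact fun hf => hcon (f, true) (by simp) hf
    have h2 : {f ∈ T | Γ.t f = Γ.t e} = {e} := by
      ext f
      simp only [Set.mem_ofPred_eq, Set.mem_singleton_iff]
      refine ⟨fun hf => ?_, fun hf => by subst hf; exact ⟨hx, rfl⟩⟩
      by_contra hne
      exact hcon (f, false) (by simpa using hne) hf.1 hf.2
    rw [degreeIn, src_false, h1, h2]
    simp
  · have h1 : {f ∈ T | Γ.t f = Γ.o e} = ∅ := by
      ext f
      simp only [Set.mem_ofPred_eq, Set.mem_empty_iff_false, iff_false, not_and]
      exact fun hf => hcon (f, false) (by simp) hf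
    have h2 : {f ∈ T | Γ.o f = Γ.o e} = {e} := by
      ext f
      simp only [Set.mem_ofPred_eq, Set.mem_singleton_iff]
      refine ⟨fun hf => ?_, fun hf => by subst hf; exact ⟨hx, rfl⟩⟩
      by_contra hne
      exact hcon (f, true) (by simpa using hne) hf.1 hf.2
    rw [degreeIn, src_true, h1, h2]
    simp

/-- A long walk contains a closed walk. -/
lemma IsWalk.exists_closed [Fintype Γ.V] {u v : Γ.V} {l : List (Γ.E × Bool)}
    (h : Γ.IsWalk u l v) (hl : Fintype.card Γ.V ≤ l.length) :
    ∃ a b c w, l = a ++ b ++ c ∧ b ≠ [] ∧ Γ.IsWalk u a w ∧ Γ.IsWalk w b w := by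
  have h1 : ∀ i : Fin (l.length + 1), ∃ w, Γ.IsWalk u (l.take i) w := fun i => by
    rw [← List.take_append_drop i l] at h
    obtain ⟨w, hw, -⟩ := isWalk_append.1 h
    exact ⟨w, hw⟩
  choose w hw using h1
  obtain ⟨i, j, hij, hwij⟩ := Fintype.exists_ne_map_eq_of_card_lt w (by simp; omega)
  wlog hlt : i < j generalizing i j
  · exact this j i hij.symm hwij.symm (lt_of_le_of_ne (not_lt.1 hlt) hij.symm)
  have h2 : l.take j = l.take i ++ (l.take j).drop i := by
    conv_lhs => rw [← List.take_append_drop i (l.take j)]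
    rw [List.take_take, min_eq_left (by exact_mod_cast hlt.le)]
  have h3 := hw j
  rw [h2] at h3
  obtain ⟨w', hw', hw''⟩ := isWalk_append.1 h3
  obtain rfl := hw'.end_unique (hw i)
  refine ⟨l.take i, (l.take j).drop i, l.drop j, w i, ?_, ?_, hw i,
    by rw [← hwij] at hw''; exact hw''⟩
  · rw [← h2, List.take_append_drop]
  · intro h0
    have := congrArg List.length h0
    simp only [List.length_drop, List.length_take, List.length_nil] at this
    have := j.2
    have : (i : ℕ) < j := hlt
    omega

/-- Every edge of a core lies on a twisted cycle, provided that its component supports any twisted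
cycle at all. -/
theorem IsPrimeWeight.exists_cycle_of_core [Fintype Γ.E] [Fintype Γ.V] {lam : Γ.E → ℚ}
    (h : IsPrimeWeight lam) {A T : Set Γ.E} (hTA : T ⊆ A) (hdeg : ∀ u, Γ.degreeIn T u ≠ 1)
    {e f : Γ.E} (hf : f ∈ T) (hfe : Γ.Reach A (Γ.o f) (Γ.o e)) {z₀ : Γ.E → ℚ}
    (hz₀ : z₀ ∈ Γ.cycles lam A) (hz₀e : z₀ e ≠ 0) : ∃ z ∈ Γ.cycles lam A, z f ≠ 0 := by
  by_contra! hcon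
  obtain ⟨φ, hφ, hφf⟩ := exists_potential (hTA hf) hcon
  have hz₀' : z₀ ∈ Γ.cycles lam (A \ {f}) := mem_cycles_of_support hz₀ fun x hx => by
    by_cases hxf : x = f
    · subst hxf; exact hcon _ hz₀
    · exact hz₀.1 x fun hxA => hx ⟨hxA, hxf⟩
  have hφe : φ (Γ.o e) = 0 := by
    by_contra h0
    exact hz₀e (h.cycle_eq_zero hφ hz₀' h0)
  -- If `φ` were non-zero at both ends of `f`, the non-vanishing would spread through `A` as far as
  -- `e`, where the cycle `z₀` forces it to vanish.
  have hzero : φ (Γ.o f) = 0 ∨ φ (Γ.t f) = 0 := by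
    by_contra! h0
    refine hfe.induction (p := fun w => φ w ≠ 0) (fun x hx => ?_) h0.1 hφe
    by_cases hxf : x = f
    · subst hxf; simp [h0.1, h0.2]
    · exact h.potential_ne_zero_iff hφ ⟨hx, hxf⟩
  obtain ⟨d, rfl, hsrc, htgt⟩ : ∃ d : Γ.E × Bool, d.1 = f ∧ φ (Γ.src d) ≠ 0 ∧ φ (Γ.tgt d) = 0 := by
    by_cases h0 : φ (Γ.o f) = 0
    · refine ⟨(f, false), rfl, ?_, h0⟩
      intro h1
      apply hφf
      rw [src_false] at h1
      rw [h0, h1, mul_zero]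
    · exact ⟨(f, true), rfl, h0, hzero.resolve_left h0⟩
  -- Behind `d`, where `φ` is non-zero, the graph is a tree. As `T` has no leaves, reduced walks
  -- ending with `d` can be prolonged backwards inside `T` forever.
  have hlong : ∀ n : ℕ, ∃ (u : Γ.V) (l : List (Γ.E × Bool)), l.length = n ∧ Γ.IsWalk u l (Γ.src d) ∧
      FreeGroup.IsReduced (l ++ [d]) ∧ ∀ x ∈ l, x.1 ∈ T \ {d.1} := by
    intro n
    induction n with
    | zero => exact ⟨Γ.src d, [], rfl, rfl, FreeGroup.IsReduced.singleton, by simp⟩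
    | succ n ih =>
      obtain ⟨u, l, hn, hl, hred, hlT⟩ := ih
      obtain ⟨x, m, hxm, hxu, hxT⟩ : ∃ x m, l ++ [d] = x :: m ∧ Γ.src x = u ∧ x.1 ∈ T := by
        cases l with
        | nil => exact ⟨d, [], rfl, hl.symm, hf⟩
        | cons x l => exact ⟨x, l ++ [d], rfl, hl.1, (hlT x (by simp)).1⟩
      obtain ⟨y, hyx, hyT, hyu⟩ := exists_dart_of_degree_ne_one hxT (hdeg _)
      rw [hxu] at hyu
      have hlA : ∀ x ∈ l, x.1 ∈ A \ {d.1} := fun x hx => ⟨hTA (hlT x hx).1, (hlT x hx).2⟩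
      have hu : φ u ≠ 0 := h.potential_ne_zero_of_reach hφ (Reach.symm ⟨l, hl, hlA⟩) hsrc
      -- Meeting the edge of `d` again would either close up a reduced walk inside the tree or reach
      -- the end of `d` where `φ` vanishes.
      have hyf : y.1 ≠ d.1 := by
        intro hyd
        by_cases hs : y.2 = d.2
        · obtain rfl : y = d := Prod.ext hyd hs
          subst hyu
          have := h.eq_nil_of_closed hφ hl (IsReduced.of_append_left hred) hlA hsrc
          subst this
          simp only [List.nil_append, List.cons.injEq] at hxm
          exact hyx hxm.1
        · obtain ⟨e', s⟩ := d
          obtain ⟨e'', s'⟩ := y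
          obtain rfl : e'' = e' := hyd
          obtain rfl : s' = !s := by revert hs; cases s <;> cases s' <;> simp
          rw [src_not] at hyu
          exact hu (hyu ▸ htgt)
      refine ⟨Γ.tgt y, (y.1, !y.2) :: l, by simp [hn], ⟨by simp, by simpa [hyu] using hl⟩, ?_, ?_⟩
      · rw [List.cons_append, hxm, FreeGroup.isReduced_cons_cons, ← hxm]
        refine ⟨fun h1 => ?_, hred⟩
        by_contra h2
        exact hyx (Prod.ext h1 (by revert h2; cases y.2 <;> cases x.2 <;> simp))
      · intro x hx
        rcases List.mem_cons.1 hx with rfl | hx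
        exacts [⟨hyT, hyf⟩, hlT x hx]
  obtain ⟨u, l, hn, hl, hred, hlT⟩ := hlong (Fintype.card Γ.V)
  have hlA : ∀ x ∈ l, x.1 ∈ A \ {d.1} := fun x hx => ⟨hTA (hlT x hx).1, (hlT x hx).2⟩
  have hu : φ u ≠ 0 := h.potential_ne_zero_of_reach hφ (Reach.symm ⟨l, hl, hlA⟩) hsrc
  -- A walk as long as the number of vertices revisits one of them, which is impossible in the tree.
  obtain ⟨a, b, c, w, rfl, hb, ha, hw⟩ := hl.exists_closed hn.ge
  refine hb (h.eq_nil_of_closed hφ hw ?_ (fun x hx => hlA x (by simp [hx]))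
    (h.potential_ne_zero_of_reach hφ ⟨a, ha, fun x hx => hlA x (by simp [hx])⟩ hu))
  exact (IsReduced.of_append_left hred).infix ⟨a, c, rfl⟩

end Essential

/-! ### Untwisted homology and its comparison with the twisted one -/

section EdgeCount

variable {X : Type} {Γ : LabelledGraph X}

open Classical in
/-- The signed number of traversals of each edge. -/
noncomputable def edgeCount (E : Type) : FreeGroup E →* Multiplicative (E → ℚ) :=
  FreeGroup.lift fun e => Multiplicative.ofAdd (Pi.single e 1)

/-- The signed sum of a function on the edges. -/
noncomputable def edgeSum {E : Type} [Fintype E] (f : E → ℚ) (g : FreeGroup E) : ℚ :=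
  f ⬝ᵥ (edgeCount E g).toAdd

lemma edgeSum_mul {E : Type} [Fintype E] (f : E → ℚ) (g h : FreeGroup E) :
    edgeSum f (g * h) = edgeSum f g + edgeSum f h := by
  simp [edgeSum, dotProduct_add]

@[simp] lemma edgeSum_one {E : Type} [Fintype E] (f : E → ℚ) : edgeSum f 1 = 0 := by
  simp [edgeSum]

lemma edgeSum_inv {E : Type} [Fintype E] (f : E → ℚ) (g : FreeGroup E) :
    edgeSum f g⁻¹ = - edgeSum f g := by
  simp [edgeSum]

lemma edgeSum_of {E : Type} [Fintype E] (f : E → ℚ) (e : E) :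
    edgeSum f (FreeGroup.of e) = f e := by
  classical
  simp [edgeSum, edgeCount]

lemma mk_cons {α : Type*} (d : α × Bool) (l : List (α × Bool)) :
    FreeGroup.mk (d :: l) =
      (if d.2 then FreeGroup.of d.1 else (FreeGroup.of d.1)⁻¹) * FreeGroup.mk l := by
  obtain ⟨e, s⟩ := d
  cases s <;> simp [FreeGroup.of, FreeGroup.mul_mk, FreeGroup.inv_mk, FreeGroup.invRev]

lemma edgeSum_coboundary [Fintype Γ.E] (φ : Γ.V → ℚ) {u v : Γ.V} {l : List (Γ.E × Bool)}
    (h : Γ.IsWalk u l v) : edgeSum (Γ.coboundary 1 φ) (FreeGroup.mk l) = φ u - φ v := by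
  induction l generalizing u with
  | nil => obtain rfl : u = v := h; simp [← FreeGroup.one_eq_mk]
  | cons d l ih =>
    obtain ⟨rfl, h⟩ := h
    rw [mk_cons, edgeSum_mul, ih h]
    obtain ⟨e, s⟩ := d
    cases s <;> simp [edgeSum_of, edgeSum_inv]

lemma edgeCount_eq_zero {E : Type} {l : List (E × Bool)} {e : E} (h : ∀ d ∈ l, d.1 ≠ e) :
    (edgeCount E (FreeGroup.mk l)).toAdd e = 0 := by
  classical
  induction l with
  | nil => simp [← FreeGroup.one_eq_mk]
  | cons d l ih =>
    obtain ⟨e', s⟩ := d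
    have hne : e ≠ e' := fun h0 => h (e', s) (by simp) h0.symm
    rw [mk_cons, map_mul, toAdd_mul, Pi.add_apply, ih fun d hd => h d (by simp [hd])]
    cases s <;> simp [edgeCount, hne]

lemma edgeCount_mem_cycles [Fintype Γ.E] {T : Set Γ.E} {v : Γ.V} {l : List (Γ.E × Bool)}
    (h : Γ.IsWalk v l v) (hT : ∀ d ∈ l, d.1 ∈ T) :
    (edgeCount Γ.E (FreeGroup.mk l)).toAdd ∈ Γ.cycles 1 T := by
  refine ⟨fun e he => edgeCount_eq_zero fun d hd h0 => he (h0 ▸ hT d hd), fun φ => ?_⟩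
  have := edgeSum_coboundary φ h
  rw [sub_self, edgeSum, dotProduct] at this
  rw [← this]
  exact Finset.sum_congr rfl fun e _ => mul_comm _ _

lemma potential_eq_zero_of_reach {lam : Γ.E → ℚ} (hlam : ∀ e, lam e ≠ 0) {T : Set Γ.E}
    {φ : Γ.V → ℚ} (hφ : φ ∈ Γ.potentials lam T) {u v : Γ.V} (hr : Γ.Reach T u v)
    (hu : φ u = 0) : φ v = 0 :=
  hr.induction (p := fun w => φ w = 0) (fun e he => by rw [hφ e he]; simp [hlam e]) hu

/-- Passing to the potentials that vanish at a vertex drops the dimension by at most one. -/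
lemma finrank_potentials_le_add_one [Fintype Γ.V] {lam : Γ.E → ℚ} {T : Set Γ.E} (v : Γ.V)
    (P : Submodule ℚ (Γ.V → ℚ)) (h : ∀ φ ∈ Γ.potentials lam T, φ v = 0 → φ ∈ P) :
    Module.finrank ℚ (Γ.potentials lam T) ≤ Module.finrank ℚ P + 1 := by
  let ev : Γ.potentials lam T →ₗ[ℚ] ℚ := (LinearMap.proj v).comp (Γ.potentials lam T).subtype
  have h1 := LinearMap.finrank_range_add_finrank_ker ev
  have h2 : Module.finrank ℚ (LinearMap.range ev) ≤ 1 := by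
    simpa using Submodule.finrank_le (LinearMap.range ev)
  have h3 : Module.finrank ℚ (LinearMap.ker ev) ≤ Module.finrank ℚ P := by
    have : (LinearMap.ker ev).map (Γ.potentials lam T).subtype ≤ P := by
      rintro _ ⟨φ, hφ, rfl⟩
      exact h φ φ.2 hφ
    exact (LinearEquiv.finrank_eq (Submodule.equivMapOfInjective _
      (Submodule.subtype_injective (Γ.potentials lam T)) (LinearMap.ker ev))).trans_le
      (Submodule.finrank_mono this)
  omega

lemma finrank_potentials_le_one [Fintype Γ.V] {lam : Γ.E → ℚ} (hlam : ∀ e, lam e ≠ 0)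
    (hc : Γ.IsConnected) : Module.finrank ℚ (Γ.potentials lam Set.univ) ≤ 1 := by
  obtain ⟨⟨v⟩, hc⟩ := isConnected_iff.1 hc
  have := finrank_potentials_le_add_one (T := Set.univ) (lam := lam) v ⊥ fun φ hφ h0 => by
    rw [Submodule.mem_bot]
    ext u
    exact potential_eq_zero_of_reach hlam hφ (hc v u) h0
  simpa using this

/-- The edges of `T` in the component of `v`. -/
def edgesAt (Γ : LabelledGraph X) (T : Set Γ.E) (v : Γ.V) : Set Γ.E :=
  {e ∈ T | Γ.Reach T v (Γ.o e)}

lemma mem_edgesAt_of_walk {T : Set Γ.E} {v w : Γ.V} {l : List (Γ.E × Bool)}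
    (h : Γ.IsWalk v l w) (hT : ∀ d ∈ l, d.1 ∈ T) : ∀ d ∈ l, d.1 ∈ Γ.edgesAt T v := by
  intro d hd
  refine ⟨hT d hd, ?_⟩
  obtain ⟨a, b, rfl⟩ := List.append_of_mem hd
  obtain ⟨u, ha, rfl, -⟩ := isWalk_append.1 h
  have h1 : Γ.Reach T v (Γ.src d) := ⟨a, ha, fun x hx => hT x (by simp [hx])⟩
  obtain ⟨e, s⟩ := d
  cases s
  · exact h1.trans (Reach.edge (hT _ hd)).symm
  · exact h1

lemma Reach.edgesAt {T : Set Γ.E} {v w : Γ.V} (h : Γ.Reach T v w) :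
    Γ.Reach (Γ.edgesAt T v) v w := by
  obtain ⟨l, hl, hT⟩ := h
  exact ⟨l, hl, mem_edgesAt_of_walk hl hT⟩

/-- An untwisted potential vanishing at `v` vanishes on the whole component, hence is also a twisted
potential for these edges. Twisting thus loses at most one dimension of potentials, and by the Euler
formula at most one of cycles. -/
lemma finrank_cycles_one_le [Fintype Γ.E] [Fintype Γ.V] (lam : Γ.E → ℚ) (T : Set Γ.E) (v : Γ.V) :
    Module.finrank ℚ (Γ.cycles 1 (Γ.edgesAt T v)) ≤ Module.finrank ℚ (Γ.cycles lam T) + 1 := by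
  have h1 := finrank_cycles_add (Γ := Γ) 1 (Γ.edgesAt T v)
  have h2 := finrank_cycles_add lam (Γ.edgesAt T v)
  have h3 : Module.finrank ℚ (Γ.cycles lam (Γ.edgesAt T v)) ≤ Module.finrank ℚ (Γ.cycles lam T) :=
    Submodule.finrank_mono (cycles_mono fun e he => he.1)
  have h4 := finrank_potentials_le_add_one (T := Γ.edgesAt T v) (lam := 1) v
    (Γ.potentials lam (Γ.edgesAt T v)) fun φ hφ h0 e he => by
      have ho : φ (Γ.o e) = 0 :=
        potential_eq_zero_of_reach (fun _ => one_ne_zero) hφ he.2.edgesAt h0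
      have ht := hφ e he
      rw [ho, Pi.one_apply, one_mul] at ht
      rw [ho, ← ht, mul_zero]
  omega

end EdgeCount

/-! ### The rank of a represented subgroup -/

section Rank

variable {X : Type} {F : Type*} [Group F] {b : FreeGroupBasis X F} {Γ : LabelledGraph X}
  {v : Γ.V} {H : Subgroup F}

/-- The element of the group that is read along a walk. -/
noncomputable def walkValue (b : FreeGroupBasis X F) (Γ : LabelledGraph X)
    (l : List (Γ.E × Bool)) : F :=
  wordValue b (Γ.word l)

lemma wordValue_append (w w' : List (X × Bool)) :
    wordValue b (w ++ w') = wordValue b w * wordValue b w' := by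
  simp [wordValue, ← FreeGroup.mul_mk]

lemma wordValue_invRev (w : List (X × Bool)) :
    wordValue b (FreeGroup.invRev w) = (wordValue b w)⁻¹ := by
  simp [wordValue, ← FreeGroup.inv_mk]

lemma wordValue_inj {w w' : List (X × Bool)} :
    wordValue b w = wordValue b w' ↔ FreeGroup.mk w = FreeGroup.mk w' := by
  simp [wordValue]

@[simp] lemma wordValue_nil : wordValue b [] = 1 := by
  simp [wordValue, ← FreeGroup.one_eq_mk]

lemma walkValue_append (l l' : List (Γ.E × Bool)) :
    walkValue b Γ (l ++ l') = walkValue b Γ l * walkValue b Γ l' := by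
  rw [walkValue, word_append, wordValue_append]; rfl

lemma walkValue_invRev (l : List (Γ.E × Bool)) :
    walkValue b Γ (FreeGroup.invRev l) = (walkValue b Γ l)⁻¹ := by
  rw [walkValue, word_invRev, wordValue_invRev]; rfl

lemma _root_.RepresentsSubgroup.mem_iff (h : RepresentsSubgroup b Γ v H) {g : F} :
    g ∈ H ↔ ∃ l, Γ.IsWalk v l v ∧ walkValue b Γ l = g := by
  rw [h.2.2.2.2 g]
  constructor
  · rintro ⟨w, hw, rfl⟩
    obtain ⟨l, hl, rfl⟩ := path_iff.1 hw
    exact ⟨l, hl, rfl⟩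
  · rintro ⟨l, hl, rfl⟩
    exact ⟨_, path_iff.2 ⟨l, hl, rfl⟩, rfl⟩

/-- The embedding of the subgroup represented by an immersed graph into the free group on the
edges of the graph. -/
noncomputable def _root_.RepresentsSubgroup.lift (h : RepresentsSubgroup b Γ v H) :
    H →* FreeGroup Γ.E :=
  MonoidHom.mk' (fun g => FreeGroup.mk (h.mem_iff.1 g.2).choose) fun g g' => by
    rw [FreeGroup.mul_mk]
    have hg := (h.mem_iff.1 g.2).choose_spec
    have hg' := (h.mem_iff.1 g'.2).choose_spec
    have hgg' := (h.mem_iff.1 (g * g').2).choose_spec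
    -- Immersion makes the class independent of the chosen walk: based walks with equal values agree
    -- up to reduction.
    refine h.2.2.2.1.mk_eq hgg'.1 (hg.1.append hg'.1) (wordValue_inj (b := b).1 ?_)
    exact hgg'.2.trans ((congrArg₂ (· * ·) hg.2 hg'.2).symm.trans (walkValue_append _ _).symm)

lemma _root_.RepresentsSubgroup.lift_eq (h : RepresentsSubgroup b Γ v H) {l : List (Γ.E × Bool)}
    (hl : Γ.IsWalk v l v) {g : H} (hg : walkValue b Γ l = g) : h.lift g = FreeGroup.mk l := by
  have hg' := (h.mem_iff.1 g.2).choose_spec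
  exact h.2.2.2.1.mk_eq hg'.1 hl (wordValue_inj (b := b).1 (hg'.2.trans hg.symm))

lemma _root_.RepresentsSubgroup.exists_walk (h : RepresentsSubgroup b Γ v H) (u : Γ.V) :
    ∃ l, Γ.IsWalk v l u := by
  obtain ⟨l, hl, -⟩ := (isConnected_iff.1 h.2.2.1).2 v u
  exact ⟨l, hl⟩

/-- Every homomorphism from the subgroup to the rationals is given by a function on the edges. -/
lemma _root_.RepresentsSubgroup.exists_edgeSum_eq [Fintype Γ.E] (h : RepresentsSubgroup b Γ v H)
    (χ : H →* Multiplicative ℚ) : ∃ f : Γ.E → ℚ, ∀ g, edgeSum f (h.lift g) = (χ g).toAdd := by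
  classical
  choose p hp using h.exists_walk
  let g : Γ.V → F := fun u => walkValue b Γ (p u)
  have hmem : ∀ {u u' : Γ.V} {l : List (Γ.E × Bool)}, Γ.IsWalk u l u' →
      g u * walkValue b Γ l * (g u')⁻¹ ∈ H := by
    intro u u' l hl
    refine h.mem_iff.2 ⟨_, ((hp u).append hl).append (hp u').reverse, ?_⟩
    rw [walkValue_append, walkValue_append, walkValue_invRev]
  let ξ : F → ℚ := fun a => if ha : a ∈ H then (χ ⟨a, ha⟩).toAdd else 0
  have hξ : ∀ a : H, ξ a = (χ a).toAdd := fun a => by simp [ξ]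
  have hξ1 : ξ 1 = 0 := by simpa using hξ 1
  have hmul : ∀ {a c : F}, a ∈ H → c ∈ H → ξ (a * c) = ξ a + ξ c := by
    intro a c ha hc
    simpa using (hξ (⟨a, ha⟩ * ⟨c, hc⟩)).trans (by rw [map_mul, toAdd_mul, ← hξ, ← hξ])
  have hinv : ∀ {a : F}, a ∈ H → ξ a⁻¹ = - ξ a := by
    intro a ha
    have := hmul ha (H.inv_mem ha)
    rw [mul_inv_cancel, hξ1] at this
    linarith
  -- The value of the character on the loop that goes to `o e` along the chosen path, crosses `e`
  -- and returns from `t e`.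
  let f : Γ.E → ℚ := fun e =>
    ξ (g (Γ.o e) * walkValue b Γ [(e, true)] * (g (Γ.t e))⁻¹)
  have hwalk : ∀ {u u' : Γ.V} {l : List (Γ.E × Bool)}, Γ.IsWalk u l u' →
      ξ (g u * walkValue b Γ l * (g u')⁻¹) = edgeSum f (FreeGroup.mk l) := by
    intro u u' l hl
    induction l generalizing u with
    | nil =>
      obtain rfl : u = u' := hl
      simp [walkValue, ← FreeGroup.one_eq_mk, hξ1]
    | cons d l ih =>
      obtain ⟨rfl, hl⟩ := hl
      have hd : Γ.IsWalk (Γ.src d) [d] (Γ.tgt d) := ⟨rfl, rfl⟩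
      have hsplit : g (Γ.src d) * walkValue b Γ (d :: l) * (g u')⁻¹ =
          (g (Γ.src d) * walkValue b Γ [d] * (g (Γ.tgt d))⁻¹) *
            (g (Γ.tgt d) * walkValue b Γ l * (g u')⁻¹) := by
        rw [show d :: l = [d] ++ l from rfl, walkValue_append]
        group
      rw [hsplit, hmul (hmem hd) (hmem hl), ih hl, mk_cons, edgeSum_mul]
      congr 1
      obtain ⟨e, s⟩ := d
      cases s
      · have h1 : Γ.IsWalk (Γ.o e) [(e, true)] (Γ.t e) := ⟨rfl, rfl⟩
        have h2 : walkValue b Γ [(e, false)] = (walkValue b Γ [(e, true)])⁻¹ :=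
          walkValue_invRev [(e, true)]
        simp only [src_false, tgt_false, Bool.false_eq_true, if_false, edgeSum_inv, edgeSum_of, f]
        rw [← hinv (hmem h1), h2]
        congr 1
        group
      · simp [edgeSum_of, f]
  refine ⟨f, fun a => ?_⟩
  obtain ⟨l, hl, hla⟩ := h.mem_iff.1 a.2
  rw [h.lift_eq hl hla, ← hwalk hl, hla, ← hξ]
  -- The chosen path from `v` to itself need not be trivial; conjugation by its value disappears in
  -- the commutative target.
  have hgv : g v ∈ H := h.mem_iff.2 ⟨p v, hp v, rfl⟩
  rw [hmul (H.mul_mem hgv a.2) (H.inv_mem hgv), hmul hgv a.2, hinv hgv]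
  ring

/-- The homology classes of a free basis are linearly independent. -/
theorem _root_.RepresentsSubgroup.linearIndependent [Finite Γ.E] {ι : Type*}
    (h : RepresentsSubgroup b Γ v H) (y : FreeGroupBasis ι H) :
    LinearIndependent ℚ fun i => (edgeCount Γ.E (h.lift (y i))).toAdd := by
  classical
  have := Fintype.ofFinite Γ.E
  rw [linearIndependent_iff']
  intro s r hr i hi
  -- The character dual to `y i` reads off the coefficient `r i` from a linear relation.
  obtain ⟨f, hf⟩ := h.exists_edgeSum_eq
    (y.lift fun j => Multiplicative.ofAdd (if j = i then 1 else 0))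
  have h1 : ∀ j, edgeSum f (h.lift (y j)) = if j = i then 1 else 0 := fun j => by
    rw [hf]
    change Multiplicative.toAdd (FreeGroup.lift _ (y.repr (y j))) = _
    simp
  have h2 := congrArg (fun z => f ⬝ᵥ z) hr
  simp only [dotProduct_sum, dotProduct_smul, dotProduct_zero] at h2
  change ∑ j ∈ s, r j • edgeSum f (h.lift (y j)) = 0 at h2
  simpa [h1, hi] using h2

/-- The number of edges is bounded in terms of any generating family. -/
theorem _root_.RepresentsSubgroup.card_edges_le (h : RepresentsSubgroup b Γ v H) {r : ℕ}
    {g : Fin r → F}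
    (hg : Subgroup.closure (Set.range g) = H) : Nat.card Γ.E + 1 ≤ r + Nat.card Γ.V := by
  have := h.1
  have := h.2.1
  have := Fintype.ofFinite Γ.E
  have := Fintype.ofFinite Γ.V
  have hgm : ∀ i, g i ∈ H := fun i => hg ▸ Subgroup.subset_closure ⟨i, rfl⟩
  let ev : (Γ.E → ℚ) →ₗ[ℚ] (Fin r → ℚ) :=
    { toFun := fun f i => edgeSum f (h.lift ⟨g i, hgm i⟩)
      map_add' := fun f f' => by ext i; simp [edgeSum, add_dotProduct]
      map_smul' := fun c f => by ext i; simp [edgeSum, smul_dotProduct] }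
  -- An edge function with sum zero over the generators has sum zero over every closed walk at `v`,
  -- so it integrates along paths to a function on the vertices.
  have hker : LinearMap.ker ev ≤ LinearMap.range (Γ.coboundary 1) := by
    intro f hf
    have h0 : ∀ a (ha : a ∈ H), edgeSum f (h.lift ⟨a, ha⟩) = 0 := by
      intro a ha
      have ha' : a ∈ Subgroup.closure (Set.range g) := hg ▸ ha
      induction ha' using Subgroup.closure_induction with
      | mem x hx => obtain ⟨i, rfl⟩ := hx; exact congrFun hf i
      | one =>
        have : (⟨1, ha⟩ : H) = 1 := rfl
        rw [this, map_one, edgeSum_one]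
      | mul x x' hx hx' ih ih' =>
        have h1 : x ∈ H := hg ▸ hx
        have h2 : x' ∈ H := hg ▸ hx'
        have : (⟨x * x', ha⟩ : H) = ⟨x, h1⟩ * ⟨x', h2⟩ := rfl
        rw [this, map_mul, edgeSum_mul, ih h1, ih' h2, add_zero]
      | inv x hx ih =>
        have h1 : x ∈ H := hg ▸ hx
        have : (⟨x⁻¹, ha⟩ : H) = ⟨x, h1⟩⁻¹ := rfl
        rw [this, map_inv, edgeSum_inv, ih h1, neg_zero]
    choose p hp using h.exists_walk
    refine ⟨fun u => - edgeSum f (FreeGroup.mk (p u)), ?_⟩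
    ext e
    have hcl := (((hp (Γ.o e)).append (l' := [(e, true)]) ⟨rfl, rfl⟩).append (hp (Γ.t e)).reverse)
    have h1 := h0 _ (h.mem_iff.2 ⟨_, hcl, rfl⟩)
    rw [h.lift_eq hcl rfl, ← FreeGroup.mul_mk, ← FreeGroup.mul_mk, ← FreeGroup.inv_mk, edgeSum_mul,
      edgeSum_mul, edgeSum_inv] at h1
    have h2 : edgeSum f (FreeGroup.mk [(e, true)]) = f e := edgeSum_of f e
    rw [coboundary_apply, Pi.one_apply]
    linarith
  have h1 := LinearMap.finrank_range_add_finrank_ker ev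
  have h2 := LinearMap.finrank_range_add_finrank_ker (Γ.coboundary 1)
  have h3 := Submodule.finrank_mono hker
  have h4 := Submodule.finrank_le (LinearMap.range ev)
  -- The constants lie in the kernel, which accounts for the `+ 1` in the bound.
  have h5 : 0 < Module.finrank ℚ (LinearMap.ker (Γ.coboundary 1)) := by
    refine Module.finrank_pos_iff_exists_ne_zero.2 ⟨⟨fun _ => 1, ?_⟩, ?_⟩
    · rw [LinearMap.mem_ker]; ext e; simp
    · intro h0
      have := congrFun (congrArg Subtype.val h0) v
      simp at this
  simp only [Module.finrank_fintype_fun_eq_card, Fintype.card_fin] at h1 h2 h4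
  rw [Nat.card_eq_fintype_card, Nat.card_eq_fintype_card]
  omega

lemma closure_range_basis_top {G ι : Type*} [Group G] (y : FreeGroupBasis ι G) :
    Subgroup.closure (Set.range y) = ⊤ := by
  have : Set.range y = y.repr.symm.toMonoidHom '' Set.range FreeGroup.of := by
    rw [← Set.range_comp]; rfl
  rw [this, ← MonoidHom.map_closure, FreeGroup.closure_range_of, Subgroup.map_top_of_surjective]
  exact y.repr.symm.surjective

lemma closure_range_basis {ι : Type*} (y : FreeGroupBasis ι H) :
    Subgroup.closure (Set.range fun i => (y i : F)) = H := by
  have h2 : (Set.range fun i => (y i : F)) = H.subtype '' Set.range y := by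
    ext; simp
  rw [h2, ← MonoidHom.map_closure, closure_range_basis_top, ← MonoidHom.range_eq_map,
    Subgroup.range_subtype]

/-- The rank of the subgroup represented by a graph. -/
theorem _root_.RepresentsSubgroup.card_basis {ι : Type*} (h : RepresentsSubgroup b Γ v H)
    (y : FreeGroupBasis ι H) : Finite ι ∧ Nat.card Γ.E + 1 = Nat.card ι + Nat.card Γ.V := by
  have := h.1
  have := h.2.1
  have := Fintype.ofFinite Γ.E
  have := Fintype.ofFinite Γ.V
  have hli := h.linearIndependent y
  have hfin : Finite ι := hli.finite
  have := Fintype.ofFinite ι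
  refine ⟨hfin, le_antisymm ?_ ?_⟩
  · let e := Fintype.equivFin ι
    have h1 : Subgroup.closure (Set.range fun i => ((y (e.symm i) : H) : F)) = H := by
      refine Eq.trans (congrArg _ ?_) (closure_range_basis y)
      exact e.symm.surjective.range_comp fun i => ((y i : H) : F)
    have h2 := h.card_edges_le h1
    rwa [← Nat.card_eq_fintype_card] at h2
  · have h1 : ∀ i, (edgeCount Γ.E (h.lift (y i))).toAdd ∈ Γ.cycles 1 Set.univ := by
      intro i
      obtain ⟨l, hl, hla⟩ := h.mem_iff.1 (y i).2
      rw [h.lift_eq hl hla]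
      exact edgeCount_mem_cycles hl fun _ _ => trivial
    have h2 : LinearIndependent ℚ fun i => (⟨_, h1 i⟩ : Γ.cycles 1 Set.univ) :=
      LinearIndependent.of_comp (Γ.cycles 1 Set.univ).subtype hli
    have h3 := h2.fintype_card_le_finrank
    have h4 := finrank_cycles_add (Γ := Γ) 1 Set.univ
    have h5 := finrank_potentials_le_one (Γ := Γ) (lam := 1) (fun _ => one_ne_zero) h.2.2.1
    rw [Set.ncard_univ] at h4
    rw [← Nat.card_eq_fintype_card] at h3
    omega

end Rank

/-! ### Reduced rank and twisted cycles -/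

section ReducedRank

variable {X : Type} {Γ : LabelledGraph X}

lemma reducedRank_of_isConnected (hc : Γ.IsConnected) :
    Γ.reducedRank = max 0 ((Nat.card Γ.E : ℤ) - Nat.card Γ.V) := by
  obtain ⟨⟨v⟩, hs⟩ := hc
  rw [reducedRank, finsum_eq_single _ (Γ.component v) fun c hc => absurd (Subsingleton.elim _ _) hc]
  have h1 : Nat.card {u : Γ.V // Γ.component u = Γ.component v} = Nat.card Γ.V :=
    Nat.card_congr (Equiv.subtypeUnivEquiv fun u => Subsingleton.elim _ _)
  have h2 : Nat.card {e : Γ.E // Γ.component (Γ.o e) = Γ.component v} = Nat.card Γ.E :=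
    Nat.card_congr (Equiv.subtypeUnivEquiv fun u => Subsingleton.elim _ _)
  rw [eulerChar, h1, h2, neg_sub]

/-- Without twisted cycles, `ncard_le_add_finrank_cycles` gives each component at most as many edges
as vertices. -/
lemma reducedRank_deleteEdges_eq_zero [Fintype Γ.E] [Fintype Γ.V] (lam : Γ.E → ℚ) {D : Set Γ.E}
    (h : Module.finrank ℚ (Γ.cycles lam Dᶜ) = 0) : (Γ.deleteEdges D).reducedRank = 0 := by
  rw [reducedRank]
  refine finsum_eq_zero_of_forall_eq_zero fun c => max_eq_left ?_
  let U : Set Γ.V := {u | (Γ.deleteEdges D).component u = c}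
  let T : Set Γ.E := {e | e ∈ Dᶜ ∧ (Γ.deleteEdges D).component (Γ.o e) = c}
  have h1 := ncard_le_add_finrank_cycles (Γ := Γ) lam (T := T) (U := U) fun e he => by
    refine ⟨he.2, Eq.trans ?_ he.2⟩
    exact (Quot.sound ⟨⟨e, he.1⟩, rfl, rfl⟩ :
      (Γ.deleteEdges D).component (Γ.o e) = (Γ.deleteEdges D).component (Γ.t e)).symm
  have h2 : Module.finrank ℚ (Γ.cycles lam T) = 0 := by
    have := Submodule.finrank_mono (cycles_mono (Γ := Γ) (lam := lam) (S := T) (T := Dᶜ)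
      fun e he => he.1)
    omega
  have h3 : Nat.card {e : (Γ.deleteEdges D).E //
      (Γ.deleteEdges D).component ((Γ.deleteEdges D).o e) = c} = T.ncard := by
    rw [← Nat.card_coe_set_eq]
    exact Nat.card_congr (Equiv.subtypeSubtypeEquivSubtypeInter (fun e : Γ.E => e ∉ D)
      (fun e : Γ.E => (Γ.deleteEdges D).component (Γ.o e) = c))
  have h4 : Nat.card {u : (Γ.deleteEdges D).V // (Γ.deleteEdges D).component u = c} = U.ncard :=
    Nat.card_coe_set_eq _
  rw [eulerChar, h3, h4]
  omega

end ReducedRank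

/-! ### Echelon bases give echelon systems -/

section Echelon

variable {n m : ℕ} {F : Type*} [Group F] {b : FreeGroupBasis (Fin n) F} {H : Subgroup F}
  {y : FreeGroupBasis (Fin m) H} {x : Fin m → Fin n} {Γ : LabelledGraph (Fin n)} {v : Γ.V}

lemma _root_.IsNewLetterChoice.injective {y : Fin m → F} (hx : IsNewLetterChoice b y x) :
    Function.Injective x := by
  intro i j hij
  by_contra hne
  rcases lt_or_gt_of_ne hne with h | h
  · exact (hx j).2 i h (hij ▸ (hx i).1)
  · exact (hx i).2 j h (hij ▸ (hx j).1)

lemma _root_.RepresentsSubgroup.exists_reduced_walk (h : RepresentsSubgroup b Γ v H) {g : F}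
    (hg : g ∈ H) : ∃ l, Γ.IsWalk v l v ∧ FreeGroup.IsReduced l ∧ Γ.word l = basisWord b g ∧
      walkValue b Γ l = g := by
  obtain ⟨l, hl, rfl⟩ := h.mem_iff.1 hg
  obtain ⟨l', -, hw, hr, hword⟩ := h.2.2.2.1.exists_reduced hl
  have h1 : Γ.word l' = basisWord b (walkValue b Γ l) := by
    rw [hword, basisWord, walkValue, wordValue, MulEquiv.apply_symm_apply]
  refine ⟨l', hw, hr, h1, ?_⟩
  rw [walkValue, wordValue, h1, basisWord, FreeGroup.mk_toWord, MulEquiv.symm_apply_apply]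

lemma OnClosedPath.exists_reduced {g : F} {e : Γ.E} (h : Γ.OnClosedPath v (basisWord b g) e) :
    ∃ l, Γ.IsWalk v l v ∧ FreeGroup.IsReduced l ∧ Γ.word l = basisWord b g ∧ ∃ d ∈ l, d.1 = e := by
  obtain ⟨l, hl, hw, hd⟩ := onClosedPath_iff.1 h
  refine ⟨l, hl, ?_, hw, hd⟩
  have h1 : FreeGroup.IsReduced (Γ.word l) := hw ▸ FreeGroup.isReduced_toWord
  refine ((List.isChain_map _).1 h1).imp fun d d' hdd hlab => ?_
  exact hdd (by rw [hlab])

lemma _root_.RepresentsSubgroup.exists_edge (h : RepresentsSubgroup b Γ v H) {g : F}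
    (hg : g ∈ H) {a : Fin n} (ha : ContainsLetter b g a) :
    ∃ e : Γ.E, Γ.OnClosedPath v (basisWord b g) e ∧ Γ.lab e = a := by
  obtain ⟨l, hl, -, hw, -⟩ := h.exists_reduced_walk hg
  obtain ⟨s, hs⟩ := ha
  rw [← hw, word, List.mem_map] at hs
  obtain ⟨d, hd, hda⟩ := hs
  exact ⟨d.1, onClosedPath_iff.2 ⟨l, hl, hw, d, hd, rfl⟩, congrArg Prod.fst hda⟩

/-- The edges whose label is not a new letter `x l` with `k ≤ l`. -/
def edgesBelow (Γ : LabelledGraph (Fin n)) (x : Fin m → Fin n) (k : ℕ) : Set Γ.E :=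
  {e | ∀ l : Fin m, k ≤ l → Γ.lab e ≠ x l}

lemma edgesBelow_mono {k k' : ℕ} (h : k ≤ k') : Γ.edgesBelow x k ⊆ Γ.edgesBelow x k' :=
  fun _ he l hl => he l (h.trans hl)

lemma mem_edgesBelow_of_word (hx : IsNewLetterChoice b (fun i => (y i : F)) x) {i : Fin m}
    {l : List (Γ.E × Bool)} (hl : Γ.word l = basisWord b (y i : F)) {k : ℕ} (hk : (i : ℕ) < k) :
    ∀ d ∈ l, d.1 ∈ Γ.edgesBelow x k := by
  intro d hd j hj hlab
  refine (hx j).2 i (Fin.lt_def.2 (by omega)) ⟨d.2, ?_⟩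
  rw [← hlab, ← hl]
  exact List.mem_map_of_mem hd

/-- The loops of the first `k` basis elements use only these edges, lie in the component of `v` and
have independent homology classes; passing to twisted cycles costs at most one dimension. -/
lemma le_finrank_cycles_edgesBelow [Fintype Γ.E] [Fintype Γ.V] (h : RepresentsSubgroup b Γ v H)
    (hx : IsNewLetterChoice b (fun i => (y i : F)) x) (lam : Γ.E → ℚ) {k : ℕ} (hk : k ≤ m) :
    k ≤ Module.finrank ℚ (Γ.cycles lam (Γ.edgesBelow x k)) + 1 := by
  refine le_trans ?_ (finrank_cycles_one_le lam _ v)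
  have h1 : ∀ i : Fin k, (edgeCount Γ.E (h.lift (y (Fin.castLE hk i)))).toAdd ∈
      Γ.cycles 1 (Γ.edgesAt (Γ.edgesBelow x k) v) := by
    intro i
    obtain ⟨l, hl, -, hw, hval⟩ := h.exists_reduced_walk (y (Fin.castLE hk i)).2
    rw [h.lift_eq hl hval]
    exact edgeCount_mem_cycles hl
      (mem_edgesAt_of_walk hl (mem_edgesBelow_of_word hx hw (by simp)))
  have h2 : LinearIndependent ℚ fun i =>
      (⟨_, h1 i⟩ : Γ.cycles 1 (Γ.edgesAt (Γ.edgesBelow x k) v)) :=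
    LinearIndependent.of_comp (Γ.cycles 1 (Γ.edgesAt (Γ.edgesBelow x k) v)).subtype
      ((h.linearIndependent y).comp _ (Fin.castLE_injective hk))
  simpa using h2.fintype_card_le_finrank

lemma ne_nil_of_word (hx : IsNewLetterChoice b (fun i => (y i : F)) x) {i : Fin m}
    {l : List (Γ.E × Bool)} (hl : Γ.word l = basisWord b (y i : F)) : l ≠ [] := by
  rintro rfl
  obtain ⟨s, hs⟩ := (hx i).1
  rw [← hl] at hs
  simp at hs

/-- For `m > 0` the loop of `y 0` is a non-trivial reduced closed walk, which kills all potentials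
on the connected graph; for `m = 0` there is at most one dimension of potentials and `m - 1` is
truncated to zero. -/
lemma finrank_cycles_univ [Fintype Γ.E] [Fintype Γ.V] (h : RepresentsSubgroup b Γ v H)
    (hx : IsNewLetterChoice b (fun i => (y i : F)) x) {lam : Γ.E → ℚ} (hlam : IsPrimeWeight lam) :
    Module.finrank ℚ (Γ.cycles lam Set.univ) = m - 1 := by
  have h1 := finrank_cycles_add lam (Set.univ : Set Γ.E)
  have h2 := (h.card_basis y).2
  rw [Set.ncard_univ] at h1
  rw [Nat.card_fin] at h2
  have h3 := finrank_potentials_le_one hlam.ne_zero h.2.2.1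
  rcases Nat.eq_zero_or_pos m with rfl | hm
  · omega
  have h4 : Module.finrank ℚ (Γ.potentials lam Set.univ) = 0 := by
    rw [Submodule.finrank_eq_zero, Submodule.eq_bot_iff]
    intro φ hφ
    obtain ⟨l, hl, hr, hw, -⟩ := h.exists_reduced_walk (y ⟨0, hm⟩).2
    have hv : φ v = 0 := by
      by_contra h0
      exact ne_nil_of_word hx hw (hlam.eq_nil_of_closed hφ hl hr (fun _ _ => trivial) h0)
    ext u
    exact potential_eq_zero_of_reach hlam.ne_zero hφ ((isConnected_iff.1 h.2.2.1).2 v u) hv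
  omega

lemma edgesBelow_top : Γ.edgesBelow x m = Set.univ := by
  ext e
  simp only [edgesBelow, Set.mem_univ, iff_true]
  intro l hl
  exact absurd l.2 (not_lt.2 hl)

/-- Removing an edge with a new letter has the same effect on twisted cycles as removing all edges
with this letter. -/
theorem finrank_cycles_edgesBelow_aux [Fintype Γ.E] [Fintype Γ.V] (h : RepresentsSubgroup b Γ v H)
    (hx : IsNewLetterChoice b (fun i => (y i : F)) x) {lam : Γ.E → ℚ} (hlam : IsPrimeWeight lam)
    {k : ℕ} (hk : 1 ≤ k) (hkm : k < m)
    (hrank : Module.finrank ℚ (Γ.cycles lam (Γ.edgesBelow x (k + 1))) = k) {e : Γ.E}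
    (he : Γ.OnClosedPath v (basisWord b (y ⟨k, hkm⟩ : F)) e) (hlab : Γ.lab e = x ⟨k, hkm⟩) :
    Γ.cycles lam (Γ.edgesBelow x (k + 1) \ {e}) = Γ.cycles lam (Γ.edgesBelow x k) ∧
      Module.finrank ℚ (Γ.cycles lam (Γ.edgesBelow x k)) = k - 1 := by
  have hnot : e ∉ Γ.edgesBelow x k := fun h0 => h0 ⟨k, hkm⟩ le_rfl hlab
  obtain ⟨l, hl, hr, hw, hel⟩ := he.exists_reduced
  -- As `1 ≤ k`, the loop of `y 0` avoids the letter `x k` and serves as the second loop required by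
  -- `exists_cycle_of_closed`.
  obtain ⟨l₀, hl₀, hr₀, hw₀, -⟩ := h.exists_reduced_walk (y ⟨0, by omega⟩).2
  obtain ⟨z, hz, hze⟩ := hlam.exists_cycle_of_closed (T := Γ.edgesBelow x (k + 1)) (e := e) hl₀ hr₀
    (fun d hd => by
      have h0 := mem_edgesBelow_of_word hx hw₀ (k := k) hk d hd
      exact ⟨edgesBelow_mono (Nat.le_succ k) h0, fun h1 => hnot (h1 ▸ h0)⟩)
    (ne_nil_of_word hx hw₀) hl hr (mem_edgesBelow_of_word hx hw (Nat.lt_succ_self k)) hel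
  have h1 := finrank_cycles_diff hz hze
  have h2 := le_finrank_cycles_edgesBelow h hx lam hkm.le
  -- After deleting `e` the dimension is `k - 1`, which is also the lower bound for the smaller set
  -- `edgesBelow x k`; the nested spaces coincide.
  have hsub : Γ.edgesBelow x k ⊆ Γ.edgesBelow x (k + 1) \ {e} := fun f hf =>
    ⟨edgesBelow_mono (Nat.le_succ k) hf, fun h1 => hnot (h1 ▸ hf)⟩
  have h3 := Submodule.finrank_mono (cycles_mono (lam := lam) hsub)
  exact ⟨(Submodule.eq_of_le_of_finrank_eq (cycles_mono hsub) (by omega)).symm, by omega⟩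

theorem finrank_cycles_edgesBelow [Fintype Γ.E] [Fintype Γ.V] (h : RepresentsSubgroup b Γ v H)
    (hx : IsNewLetterChoice b (fun i => (y i : F)) x) {lam : Γ.E → ℚ} (hlam : IsPrimeWeight lam)
    {k : ℕ} (hkm : k ≤ m) :
    Module.finrank ℚ (Γ.cycles lam (Γ.edgesBelow x k)) = k - 1 := by
  -- The descent from `m` stops at `k = 1`, where the dimension is already zero; `k = 0` follows by
  -- monotonicity.
  rcases Nat.eq_zero_or_pos k with rfl | hk
  · rcases Nat.eq_zero_or_pos m with rfl | hm
    · rw [edgesBelow_top]; exact finrank_cycles_univ h hx hlam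
    · have h1 := finrank_cycles_edgesBelow h hx hlam (k := 1) hm
      have h2 := Submodule.finrank_mono (cycles_mono (lam := lam)
        (edgesBelow_mono (Γ := Γ) (x := x) (Nat.zero_le 1)))
      omega
  induction hj : m - k generalizing k with
  | zero =>
    obtain rfl : k = m := by omega
    rw [edgesBelow_top]; exact finrank_cycles_univ h hx hlam
  | succ j ih =>
    have hlt : k < m := by omega
    obtain ⟨e, he, hlab⟩ := h.exists_edge (y ⟨k, hlt⟩).2 (hx ⟨k, hlt⟩).1
    exact (finrank_cycles_edgesBelow_aux h hx hlam hk hlt (ih hlt (by omega) (by omega)) he hlab).2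
termination_by 1 - k

/-- Removing one edge for each of the later letters has the same effect on twisted cycles as
removing all edges with these letters. -/
theorem cycles_avoiding [Fintype Γ.E] [Fintype Γ.V] (h : RepresentsSubgroup b Γ v H)
    (hx : IsNewLetterChoice b (fun i => (y i : F)) x) {lam : Γ.E → ℚ} (hlam : IsPrimeWeight lam)
    {e : Fin (m - 1) → Γ.E} (he : ∀ i, Γ.OnClosedPath v (basisWord b (y (laterIndex i) : F)) (e i) ∧
      Γ.lab (e i) = x (laterIndex i)) {k : ℕ} (hk : 1 ≤ k) (hkm : k ≤ m) :
    Γ.cycles lam {f | ∀ l : Fin (m - 1), k ≤ l + 1 → f ≠ e l} =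
      Γ.cycles lam (Γ.edgesBelow x k) := by
  refine le_antisymm ?_ (cycles_mono fun f hf l hl hfl =>
    hf (laterIndex l) hl (by rw [hfl, (he l).2]))
  induction hj : m - k generalizing k with
  | zero =>
    obtain rfl : k = m := by omega
    rw [edgesBelow_top]
    exact cycles_mono fun _ _ => trivial
  | succ j ih =>
    have hlt : k < m := by omega
    intro z hz
    have h1 := ih (k := k + 1) (by omega) hlt (by omega)
      (cycles_mono (S := {f | ∀ l : Fin (m - 1), k ≤ l + 1 → f ≠ e l})
        (T := {f | ∀ l : Fin (m - 1), k + 1 ≤ l + 1 → f ≠ e l})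
        (fun f hf l hl => hf l (by omega)) hz)
    -- `laterIndex` shifts by one, so the chosen edge with label `x k` has index `k - 1`.
    let i : Fin (m - 1) := ⟨k - 1, by omega⟩
    have hi : laterIndex i = ⟨k, hlt⟩ := by
      simp only [laterIndex, i, Fin.mk.injEq]; omega
    have hei := he i
    rw [hi] at hei
    rw [← (finrank_cycles_edgesBelow_aux h hx hlam hk hlt
      (finrank_cycles_edgesBelow h hx hlam hlt) hei.1 hei.2).1]
    refine mem_cycles_of_support h1 fun f hf => ?_
    by_cases hfe : f = e i
    · refine hz.1 f fun h0 => h0 i ?_ hfe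
      simp only [i]; omega
    · exact h1.1 f fun h0 => hf ⟨h0, hfe⟩

/-- Edges with the later letters on the closed paths of the basis form an echelon system. -/
theorem _root_.RepresentsSubgroup.isEchelonSystem (h : RepresentsSubgroup b Γ v H)
    (hx : IsNewLetterChoice b (fun i => (y i : F)) x)
    {e : Fin (m - 1) → Γ.E} (he : ∀ i, Γ.OnClosedPath v (basisWord b (y (laterIndex i) : F)) (e i) ∧
      Γ.lab (e i) = x (laterIndex i)) : Γ.IsEchelonSystem e := by
  have := h.1
  have := h.2.1
  have := Fintype.ofFinite Γ.E
  have := Fintype.ofFinite Γ.V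
  obtain ⟨lam, hlam⟩ := exists_isPrimeWeight Γ
  have hinj : Function.Injective fun i => Γ.lab (e i) := by
    intro i j hij
    simp only [(he _).2] at hij
    have := congrArg Fin.val (hx.injective hij)
    exact Fin.ext (by simpa [laterIndex] using this)
  have hncard : (Set.range e).ncard = m - 1 := by
    rw [Set.ncard_range_of_injective hinj.of_comp, Nat.card_fin]
  -- For `m = 0` the graph is a tree, and the maximum with zero matches the truncated `m - 1`.
  have hrank : Γ.reducedRank = ((m - 1 : ℕ) : ℤ) := by
    rw [reducedRank_of_isConnected h.2.2.1]
    have h2 := (h.card_basis y).2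
    rw [Nat.card_fin] at h2
    omega
  have hzero : Module.finrank ℚ (Γ.cycles lam (Set.range e)ᶜ) = 0 := by
    rcases Nat.eq_zero_or_pos m with rfl | hm
    · have h1 := finrank_cycles_univ h hx hlam
      have h2 := Submodule.finrank_mono (cycles_mono (lam := lam)
        (Set.subset_univ (Set.range e)ᶜ))
      omega
    · have h1 : (Set.range e)ᶜ = {f | ∀ l : Fin (m - 1), 1 ≤ (l : ℕ) + 1 → f ≠ e l} := by
        ext f; simp [eq_comm]
      rw [h1, cycles_avoiding h hx hlam he le_rfl hm]
      exact finrank_cycles_edgesBelow h hx hlam hm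
  refine ⟨⟨?_, ?_⟩, hinj, ?_⟩
  · rw [IsEssential, reducedRank_deleteEdges_eq_zero lam hzero, hrank, hncard, sub_self]
  · rw [hrank, hncard]
  · intro i
    rw [Set.eq_empty_iff_forall_notMem]
    rintro _ ⟨⟨f, hf, rfl⟩, _, ⟨l, hl, rfl⟩, hlab⟩
    simp only [filtrationEdges, Set.mem_iUnion] at hf
    obtain ⟨j, hj, T, hT, hfT, hdeg⟩ := hf
    have hji : j ≤ i := hj
    have hil : i < l := hl
    let A : Set Γ.E := {g | ∀ l : Fin (m - 1), l ≠ j → g ≠ e l}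
    -- Each arc contains its chosen edge, so it is harmless to remove only the edges `e l` instead
    -- of their arcs.
    have hDA : (⋃ l ∈ {l : Fin (m - 1) | l ≠ j}, Γ.arc (e l))ᶜ ⊆ A := by
      rintro g hg l hlj rfl
      exact hg (Set.mem_biUnion (show l ∈ {l : Fin (m - 1) | l ≠ j} from hlj)
        Relation.ReflTransGen.refl)
    have hTA : T ⊆ A := fun g hg => hDA (hT hg).1
    have hreach : Γ.Reach A (Γ.o f) (Γ.o (e j)) :=
      (deleteEdges_reach.1 (component_eq_iff.1 (hT hfT).2)).mono hDA
    have hA : Set.univ \ (e '' {j}ᶜ) ⊆ A := by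
      rintro g ⟨-, hg⟩ l hlj rfl
      exact hg ⟨l, hlj, rfl⟩
    -- Otherwise removing the `m - 2` edges other than `e j` would already kill the `m - 1`
    -- dimensions of twisted cycles.
    obtain ⟨z₀, hz₀, hz₀e⟩ : ∃ z₀ ∈ Γ.cycles lam A, z₀ (e j) ≠ 0 := by
      by_contra! hcon
      have h1 : Γ.cycles lam A ≤ Γ.cycles lam (Set.range e)ᶜ := fun z hz =>
        mem_cycles_of_support hz fun g hg => by
          by_cases hgj : g = e j
          · rw [hgj]; exact hcon z hz
          · refine hz.1 g fun hgA => ?_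
            obtain ⟨l, rfl⟩ := not_not.1 hg
            exact hgA l (fun h0 => hgj (h0 ▸ rfl)) rfl
      have h2 := Submodule.finrank_mono h1
      have h3 := Submodule.finrank_mono (cycles_mono (lam := lam) hA)
      have h4 := finrank_cycles_le_add_ncard lam Set.univ (e '' {j}ᶜ)
      have h5 := Set.ncard_image_le (f := e) (Set.toFinite {j}ᶜ)
      have h6 := Set.ncard_add_ncard_compl {j}
      rw [Set.ncard_singleton, Nat.card_fin] at h6
      have h7 := finrank_cycles_univ h hx hlam
      omega
    obtain ⟨z, hz, hzf⟩ := hlam.exists_cycle_of_core hTA hdeg hfT hreach hz₀ hz₀e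
    -- `e j` carries the letter `x (j + 1)`, and `z` avoids all later chosen edges, so no letter
    -- from `x (j + 2)` on occurs on its support.
    have hz' : z ∈ Γ.cycles lam (Γ.edgesBelow x (j + 2)) := by
      have := j.2
      have := l.2
      have : (j : ℕ) ≤ i := hji
      have : (i : ℕ) < l := hil
      rw [← cycles_avoiding h hx hlam he (by omega) (by omega)]
      refine cycles_mono (S := A) (T := {f | ∀ l : Fin (m - 1), (j : ℕ) + 2 ≤ l + 1 → f ≠ e l})
        (fun g hg l' hl' => hg l' ?_) hz
      rintro rfl
      omega
    refine hzf (hz'.1 f fun hfb => hfb (laterIndex l) ?_ ?_)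
    · have : (j : ℕ) ≤ i := hji
      have : (i : ℕ) < l := hil
      simp only [laterIndex]; omega
    · rw [← hlab, (he l).2]

theorem _root_.RepresentsSubgroup.isGeneralizedEchelon (h : RepresentsSubgroup b Γ v H)
    (hx : IsNewLetterChoice b (fun i => (y i : F)) x) : Γ.IsGeneralizedEchelon := by
  choose e he using fun i : Fin (m - 1) =>
    h.exists_edge (y (laterIndex i)).2 (hx (laterIndex i)).1
  exact ⟨h.1, h.2.1, h.2.2.2.1, m - 1, e, h.isEchelonSystem hx he⟩

end Echelon

/-! ### Folding does not change the subgroup -/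

section Folding

variable {X : Type} {Γ : LabelledGraph X}

/-- The image of an oriented edge in the folded graph. -/
def foldDart (Γ : LabelledGraph X) (d : Γ.E × Bool) : Γ.fold.E × Bool :=
  (Quotient.mk Γ.foldEdgeSetoid d.1, d.2)

lemma fold_src (d : Γ.E × Bool) :
    Γ.fold.src (Γ.foldDart d) = Quotient.mk Γ.foldVertexSetoid (Γ.src d) := by
  obtain ⟨e, s⟩ := d
  cases s <;> rfl

lemma fold_tgt (d : Γ.E × Bool) :
    Γ.fold.tgt (Γ.foldDart d) = Quotient.mk Γ.foldVertexSetoid (Γ.tgt d) := by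
  obtain ⟨e, s⟩ := d
  cases s <;> rfl

lemma fold_isImmersion (Γ : LabelledGraph X) : Γ.fold.IsImmersion := by
  constructor
  · intro e f hl ho
    induction e using Quotient.inductionOn
    induction f using Quotient.inductionOn
    exact Quotient.sound ⟨hl, Quotient.exact ho⟩
  · intro e f hl ht
    induction e using Quotient.inductionOn
    induction f using Quotient.inductionOn
    exact Quotient.sound ⟨hl, FoldRel.fold_terminus hl (Quotient.exact ht)⟩

lemma IsWalk.fold {u v : Γ.V} {l : List (Γ.E × Bool)} (h : Γ.IsWalk u l v) :
    Γ.fold.IsWalk (Quotient.mk Γ.foldVertexSetoid u) (l.map Γ.foldDart)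
      (Quotient.mk Γ.foldVertexSetoid v) := by
  induction l generalizing u with
  | nil => exact congrArg _ h
  | cons d l ih =>
    obtain ⟨rfl, h⟩ := h
    exact ⟨fold_src d, by rw [fold_tgt]; exact ih h⟩

lemma word_fold (l : List (Γ.E × Bool)) : Γ.fold.word (l.map Γ.foldDart) = Γ.word l := by
  simp only [word, List.map_map]
  exact List.map_congr_left fun d _ => rfl

/-- A fold surrounds a walk of trivial value by two edges with the same label in opposite
directions, and these cancel. -/
lemma FoldRel.exists_walk {u v : Γ.V} (h : Γ.FoldRel u v) :
    ∃ l, Γ.IsWalk u l v ∧ FreeGroup.mk (Γ.word l) = 1 := by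
  have hcancel : ∀ (e f : Γ.E) (s : Bool) (l : List (Γ.E × Bool)), Γ.lab e = Γ.lab f →
      FreeGroup.mk (Γ.word l) = 1 → FreeGroup.mk (Γ.word ((e, s) :: (l ++ [(f, !s)]))) = 1 := by
    intro e f s l hl h1
    rw [show (e, s) :: (l ++ [(f, !s)]) = [(e, s)] ++ l ++ [(f, !s)] from rfl, word_append,
      word_append, ← FreeGroup.mul_mk, ← FreeGroup.mul_mk, h1, mul_one, FreeGroup.mul_mk]
    rw [word_cons, word_cons, hl]
    cases s
    · exact FreeGroup.Red.exact.2 ⟨[], Relation.ReflTransGen.single FreeGroup.Red.Step.cons_not,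
        FreeGroup.Red.refl⟩
    · exact FreeGroup.Red.exact.2 ⟨[], Relation.ReflTransGen.single FreeGroup.Red.Step.cons_not,
        FreeGroup.Red.refl⟩
  induction h with
  | refl v => exact ⟨[], rfl, rfl⟩
  | symm _ ih =>
    obtain ⟨l, hl, h1⟩ := ih
    exact ⟨_, hl.reverse, by rw [word_invRev, ← FreeGroup.inv_mk, h1, inv_one]⟩
  | trans _ _ ih ih' =>
    obtain ⟨l, hl, h1⟩ := ih
    obtain ⟨l', hl', h1'⟩ := ih'
    exact ⟨_, hl.append hl', by rw [word_append, ← FreeGroup.mul_mk, h1, h1', one_mul]⟩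
  | @fold_origin e f hlab _ ih =>
    obtain ⟨l, hl, h1⟩ := ih
    exact ⟨(e, false) :: (l ++ [(f, true)]), ⟨rfl, hl.append ⟨rfl, rfl⟩⟩,
      hcancel e f false l hlab h1⟩
  | @fold_terminus e f hlab _ ih =>
    obtain ⟨l, hl, h1⟩ := ih
    exact ⟨(e, true) :: (l ++ [(f, false)]), ⟨rfl, hl.append ⟨rfl, rfl⟩⟩,
      hcancel e f true l hlab h1⟩

/-- Representatives of consecutive edges need not be adjacent before folding; the gaps are bridged
by walks of trivial value. -/
lemma exists_walk_of_fold {u v : Γ.V} {l : List (Γ.fold.E × Bool)}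
    (h : Γ.fold.IsWalk (Quotient.mk Γ.foldVertexSetoid u) l (Quotient.mk Γ.foldVertexSetoid v)) :
    ∃ l', Γ.IsWalk u l' v ∧ FreeGroup.mk (Γ.word l') = FreeGroup.mk (Γ.fold.word l) := by
  induction l generalizing u with
  | nil =>
    obtain ⟨l', hl', h1⟩ := FoldRel.exists_walk (Quotient.exact h)
    exact ⟨l', hl', h1⟩
  | cons d l ih =>
    obtain ⟨e, s⟩ := d
    induction e using Quotient.inductionOn with
    | h e =>
    obtain ⟨hu, h⟩ := h
    change Γ.fold.src (Γ.foldDart (e, s)) = _ at hu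
    change Γ.fold.IsWalk (Γ.fold.tgt (Γ.foldDart (e, s))) l _ at h
    rw [fold_src] at hu
    rw [fold_tgt] at h
    obtain ⟨l₁, hl₁, h₁⟩ := FoldRel.exists_walk (Quotient.exact hu.symm)
    obtain ⟨l₂, hl₂, h₂⟩ := ih h
    refine ⟨l₁ ++ (e, s) :: l₂, hl₁.append ⟨rfl, hl₂⟩, ?_⟩
    rw [word_append, ← FreeGroup.mul_mk, h₁, one_mul, word_cons, word_cons, ← List.singleton_append,
      ← FreeGroup.mul_mk, h₂, FreeGroup.mul_mk]
    rfl

end Folding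

/-! ### Wedges of circles and Stallings graphs -/

section Wedge

variable {X : Type} {F : Type*} [Group F] {b : FreeGroupBasis X F} {r : ℕ}
  {w : Fin r → List (X × Bool)}

/-- The `j`-th oriented edge of the `i`-th circle. -/
def wedgeDart (w : Fin r → List (X × Bool)) (i : Fin r) (j : Fin (w i).length) :
    (wedge w).E × Bool := (⟨i, j⟩, ((w i).get j).2)

lemma wedge_src (i : Fin r) (j : Fin (w i).length) :
    (wedge w).src (wedgeDart w i j) = wedgeVertex w i j := by
  cases hs : ((w i).get j).2 <;> simp_all [wedgeDart, src, wedge]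

lemma wedge_tgt (i : Fin r) (j : Fin (w i).length) :
    (wedge w).tgt (wedgeDart w i j) = wedgeVertex w i (j + 1) := by
  cases hs : ((w i).get j).2 <;> simp_all [wedgeDart, tgt, wedge]

lemma wedge_exists_walk (i : Fin r) (k : ℕ) (hk : k ≤ (w i).length) :
    ∃ l, (wedge w).IsWalk none l (wedgeVertex w i k) ∧ (wedge w).word l = (w i).take k := by
  induction k with
  | zero => exact ⟨[], by simp only [wedgeVertex, lt_irrefl, false_and, dite_false]; rfl, rfl⟩
  | succ k ih =>
    obtain ⟨l, hl, hw⟩ := ih (by omega)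
    refine ⟨l ++ [wedgeDart w i ⟨k, hk⟩], hl.append ⟨wedge_src _ _, wedge_tgt _ _⟩, ?_⟩
    rw [word_append, hw, List.take_succ_eq_append_getElem hk]
    rfl

lemma wedgeVertex_eq (i : Fin r) (k : {k : ℕ // 0 < k ∧ k < (w i).length}) :
    wedgeVertex w i k = some ⟨i, k⟩ := by
  simp [wedgeVertex, k.2]

/-- The word read from the base vertex to a vertex of the wedge. -/
def wedgeLabel (w : Fin r → List (X × Bool)) : WedgeVertex w → List (X × Bool)
  | none => []
  | some ⟨i, k⟩ => (w i).take k

/-- The expression telescopes along the walk. An edge strictly inside a circle contributes the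
identity; only the return to the base vertex contributes a generator, because there the label is
reset to the empty word. -/
lemma wedge_mem_closure {u v : (wedge w).V} {l : List ((wedge w).E × Bool)}
    (h : (wedge w).IsWalk u l v) :
    wordValue b (wedgeLabel w u) * walkValue b (wedge w) l * (wordValue b (wedgeLabel w v))⁻¹ ∈
      Subgroup.closure (Set.range fun i => wordValue b (w i)) := by
  set K := Subgroup.closure (Set.range fun i => wordValue b (w i)) with hK
  have hvert : ∀ i k, k ≤ (w i).length →
      wordValue b ((w i).take k) * (wordValue b (wedgeLabel w (wedgeVertex w i k)))⁻¹ ∈ K := by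
    intro i k hk
    by_cases h0 : 0 < k ∧ k < (w i).length
    · rw [wedgeVertex, dif_pos h0, wedgeLabel, mul_inv_cancel]; exact K.one_mem
    · rw [wedgeVertex, dif_neg h0, wedgeLabel, wordValue_nil, inv_one, mul_one]
      rcases Nat.eq_zero_or_pos k with rfl | hpos
      · simp
      · obtain rfl : k = (w i).length := by omega
        rw [List.take_length]
        exact Subgroup.subset_closure ⟨i, rfl⟩
  have hdart : ∀ i j, wordValue b (wedgeLabel w ((wedge w).src (wedgeDart w i j))) *
      walkValue b (wedge w) [wedgeDart w i j] *
      (wordValue b (wedgeLabel w ((wedge w).tgt (wedgeDart w i j))))⁻¹ ∈ K := by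
    intro i j
    rw [wedge_src, wedge_tgt]
    have h1 := K.inv_mem (hvert i j j.2.le)
    have h2 := hvert i (j + 1) j.2
    have h3 := K.mul_mem h1 h2
    rw [List.take_succ_eq_append_getElem j.2, wordValue_append] at h3
    convert h3 using 1
    rw [show walkValue b (wedge w) [wedgeDart w i j] = wordValue b [(w i)[(j : ℕ)]] from rfl]
    group
  induction l generalizing u with
  | nil =>
    obtain rfl : u = v := h
    simp [walkValue]
  | cons d l ih =>
    obtain ⟨rfl, h⟩ := h
    have hd : wordValue b (wedgeLabel w ((wedge w).src d)) * walkValue b (wedge w) [d] *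
        (wordValue b (wedgeLabel w ((wedge w).tgt d)))⁻¹ ∈ K := by
      obtain ⟨⟨i, j⟩, s⟩ := d
      by_cases hs : s = ((w i).get j).2
      · subst hs; exact hdart i j
      · obtain rfl : s = !((w i).get j).2 := by
          revert hs; cases s <;> cases ((w i).get j).2 <;> simp
        have h1 := K.inv_mem (hdart i j)
        rw [show (wedge w).src (⟨i, j⟩, !((w i).get j).2) = (wedge w).tgt (wedgeDart w i j) from
          src_not _ _, show (wedge w).tgt (⟨i, j⟩, !((w i).get j).2) =
          (wedge w).src (wedgeDart w i j) from tgt_not _ _]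
        have h2 : walkValue b (wedge w) [(⟨i, j⟩, !((w i).get j).2)] =
            (walkValue b (wedge w) [wedgeDart w i j])⁻¹ := walkValue_invRev [wedgeDart w i j]
        rw [h2]
        convert h1 using 1
        simp only [wedgeDart]
        group
    have h3 := K.mul_mem hd (ih h)
    rw [show d :: l = [d] ++ l from rfl, walkValue_append]
    convert h3 using 1
    group

lemma wedge_finite (w : Fin r → List (X × Bool)) : Finite (wedge w).V ∧ Finite (wedge w).E := by
  have : ∀ i, Finite {k : ℕ // 0 < k ∧ k < (w i).length} := fun i =>
    Finite.of_injective (fun k => (⟨k.1, k.2.2⟩ : Fin (w i).length)) fun k k' h =>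
      Subtype.ext (by simpa using h)
  exact ⟨inferInstanceAs (Finite (WedgeVertex w)),
    inferInstanceAs (Finite (Σ i : Fin r, Fin (w i).length))⟩

/-- The Stallings graph represents the subgroup generated by the given elements. -/
theorem stallingsGraph_represents [DecidableEq X] (b : FreeGroupBasis X F) (h : Fin r → F) :
    RepresentsSubgroup b (stallingsGraph b h) (stallingsBase b h)
      (Subgroup.closure (Set.range h)) := by
  obtain ⟨h1, h2⟩ := wedge_finite fun i => basisWord b (h i)
  have hval : ∀ g, wordValue b (basisWord b g) = g := fun g => by
    rw [wordValue, basisWord, FreeGroup.mk_toWord, MulEquiv.symm_apply_apply]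
  have hwalk : ∀ u : (wedge fun i => basisWord b (h i)).V,
      ∃ l, (wedge fun i => basisWord b (h i)).IsWalk none l u := by
    rintro (_ | ⟨i, k⟩)
    · exact ⟨[], rfl⟩
    · obtain ⟨l, hl, -⟩ := wedge_exists_walk (w := fun i => basisWord b (h i)) i k k.2.2.le
      rw [wedgeVertex_eq] at hl
      exact ⟨l, hl⟩
  refine ⟨inferInstanceAs (Finite (Quotient _)), inferInstanceAs (Finite (Quotient _)), ?_,
    fold_isImmersion _, fun g => ?_⟩
  · rw [isConnected_iff]
    refine ⟨⟨stallingsBase b h⟩, ?_⟩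
    have hbase : ∀ u, (stallingsGraph b h).Reach Set.univ (stallingsBase b h) u := by
      intro u
      induction u using Quotient.inductionOn with
      | h u =>
        obtain ⟨l, hl⟩ := hwalk u
        exact ⟨_, hl.fold, fun _ _ => trivial⟩
    exact fun u v => (hbase u).symm.trans (hbase v)
  · constructor
    · intro hg
      induction hg using Subgroup.closure_induction with
      | mem x hx =>
        obtain ⟨i, rfl⟩ := hx
        obtain ⟨l, hl, hw⟩ := wedge_exists_walk (w := fun i => basisWord b (h i)) i _ le_rfl
        rw [List.take_length] at hw
        simp only [wedgeVertex, lt_irrefl, and_false, dif_neg, not_false_eq_true] at hl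
        exact ⟨basisWord b (h i), path_iff.2 ⟨_, hl.fold, (word_fold l).trans hw⟩, hval _⟩
      | one => exact ⟨[], Path.nil _, wordValue_nil⟩
      | mul x x' _ _ ih ih' =>
        obtain ⟨w, hw, rfl⟩ := ih
        obtain ⟨w', hw', rfl⟩ := ih'
        obtain ⟨l, hl, rfl⟩ := path_iff.1 hw
        obtain ⟨l', hl', rfl⟩ := path_iff.1 hw'
        exact ⟨_, path_iff.2 ⟨_, hl.append hl', rfl⟩, walkValue_append l l'⟩
      | inv x _ ih =>
        obtain ⟨w, hw, rfl⟩ := ih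
        obtain ⟨l, hl, rfl⟩ := path_iff.1 hw
        exact ⟨_, path_iff.2 ⟨_, hl.reverse, rfl⟩, walkValue_invRev l⟩
    · rintro ⟨w, hw, rfl⟩
      obtain ⟨l, hl, rfl⟩ := path_iff.1 hw
      obtain ⟨l', hl', hmk⟩ := exists_walk_of_fold hl
      have h3 := wedge_mem_closure (b := b) hl'
      simp only [wedgeLabel, wordValue_nil, one_mul, inv_one, mul_one, hval] at h3
      have h4 : wordValue b ((stallingsGraph b h).word l) =
          walkValue b (wedge fun i => basisWord b (h i)) l' := wordValue_inj.2 hmk.symm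
      rw [h4]
      exact h3

end Wedge

end LabelledGraph

/-! ### A left order on free groups -/

section LeftOrder

variable {X : Type*} (ρ : X × Bool → ℕ)

/-- The sign of a turn between two letters. -/
def turnSign (a b : X × Bool) : ℤ := if ρ a < ρ b then 1 else if ρ b < ρ a then -1 else 0

/-- The sign of a letter. -/
def letterSign (a : X × Bool) : ℤ := if a.2 then 1 else -1

/-- The sign of the turn at the point where two words are joined. -/
def junctionSign (L L' : List (X × Bool)) : ℤ :=
  match L.getLast?, L'.head? with
  | some a, some b => turnSign ρ (a.1, !a.2) b
  | _, _ => 0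

/-- The signed count of the letters and turns of a word. -/
def wordSign : List (X × Bool) → ℤ
  | [] => 0
  | a :: L => letterSign a + junctionSign ρ [a] L + wordSign L

variable {ρ}

lemma turnSign_swap (a b : X × Bool) : turnSign ρ b a = -turnSign ρ a b := by
  unfold turnSign; split_ifs <;> omega

lemma letterSign_not (x : X) (s : Bool) : letterSign (x, !s) = -letterSign (x, s) := by
  cases s <;> rfl

@[simp] lemma junctionSign_nil_left (L : List (X × Bool)) : junctionSign ρ [] L = 0 := rfl

@[simp] lemma junctionSign_nil_right (L : List (X × Bool)) : junctionSign ρ L [] = 0 := by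
  unfold junctionSign; split <;> simp_all

lemma junctionSign_eq (L L' : List (X × Bool)) (a b : X × Bool) :
    junctionSign ρ (L ++ [a]) (b :: L') = turnSign ρ (a.1, !a.2) b := by
  simp [junctionSign]

lemma wordSign_append (L L' : List (X × Bool)) :
    wordSign ρ (L ++ L') = wordSign ρ L + junctionSign ρ L L' + wordSign ρ L' := by
  induction L with
  | nil => simp [wordSign]
  | cons a L ih =>
    rw [List.cons_append, wordSign, ih, wordSign]
    cases L with
    | nil => simp [wordSign]
    | cons c L =>
      have h1 : junctionSign ρ [a] (c :: L ++ L') = junctionSign ρ [a] (c :: L) := rfl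
      have h2 : junctionSign ρ (a :: c :: L) L' = junctionSign ρ (c :: L) L' := by
        simp [junctionSign, List.getLast?_cons_cons]
      rw [h1, h2]; ring

lemma wordSign_invRev (L : List (X × Bool)) :
    wordSign ρ (FreeGroup.invRev L) = -wordSign ρ L := by
  induction L with
  | nil => rfl
  | cons a L ih =>
    rw [FreeGroup.invRev_cons, wordSign_append, ih, wordSign]
    have h1 : wordSign ρ (FreeGroup.invRev [a]) = -letterSign a := by
      simp [FreeGroup.invRev, wordSign, letterSign_not]
    have h2 : junctionSign ρ (FreeGroup.invRev L) (FreeGroup.invRev [a]) =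
        -junctionSign ρ [a] L := by
      cases L with
      | nil => simp
      | cons c L =>
        rw [FreeGroup.invRev_cons]
        simp only [FreeGroup.invRev, List.map_cons, List.map_nil, List.reverse_cons,
          List.reverse_nil, List.nil_append]
        rw [junctionSign_eq, turnSign_swap]
        simp [junctionSign]
    rw [h1, h2]; ring

/-- A reduced word of length `k` has `k` letters and `k - 1` turns, each of sign `1` or `-1`. -/
lemma wordSign_odd (hρ : Function.Injective ρ) {L : List (X × Bool)} (hL : FreeGroup.IsReduced L)
    (hne : L ≠ []) : Odd (wordSign ρ L) := by
  induction L with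
  | nil => exact absurd rfl hne
  | cons a L ih =>
    have ha : letterSign a = 1 ∨ letterSign a = -1 := by unfold letterSign; split_ifs <;> simp
    cases L with
    | nil =>
      simp only [wordSign, junctionSign_nil_right, add_zero]
      rcases ha with h | h <;> rw [h] <;> decide
    | cons c L =>
      rw [FreeGroup.isReduced_cons_cons] at hL
      have h1 := ih hL.2 (by simp)
      have h2 : junctionSign ρ [a] (c :: L) = 1 ∨ junctionSign ρ [a] (c :: L) = -1 := by
        have h3 : ρ (a.1, !a.2) ≠ ρ c := fun h => by
          have h4 := hρ h
          have h5 := hL.1 (by rw [← h4])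
          rw [← h4] at h5
          simp at h5
        simp only [junctionSign, List.getLast?_singleton, List.head?_cons, turnSign]
        rcases lt_or_gt_of_ne h3 with h | h
        · simp [h]
        · simp [h, h.not_gt]
      rw [wordSign]
      rw [Int.odd_iff] at h1 ⊢
      omega

lemma exists_cancellation (L L' : List (X × Bool)) (hL : FreeGroup.IsReduced L)
    (hL' : FreeGroup.IsReduced L') :
    ∃ u w v, L = u ++ w ∧ L' = FreeGroup.invRev w ++ v ∧ FreeGroup.IsReduced (u ++ v) := by
  induction L using List.reverseRecOn generalizing L' with
  | nil => exact ⟨[], [], L', rfl, rfl, hL'⟩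
  | append_singleton L a ih =>
    cases L' with
    | nil => exact ⟨_, [], [], (List.append_nil _).symm, rfl, by simpa using hL⟩
    | cons c L' =>
      by_cases hac : c = (a.1, !a.2)
      · obtain ⟨u, w, v, rfl, rfl, h⟩ :=
          ih L' (LabelledGraph.IsReduced.of_append_left hL)
            (LabelledGraph.IsReduced.of_append_right (l := [c]) hL')
        refine ⟨u, w ++ [a], v, by simp, ?_, h⟩
        rw [hac]
        simp [FreeGroup.invRev]
      · refine ⟨_, [], _, (List.append_nil _).symm, rfl, ?_⟩
        unfold FreeGroup.IsReduced at hL hL' ⊢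
        refine List.isChain_append.2 ⟨hL, hL', fun x hx y hy hxy => ?_⟩
        simp only [List.getLast?_append, List.getLast?_singleton, Option.mem_def, Option.some_or,
          Option.some.injEq, List.head?_cons] at hx hy
        subst hx hy
        by_contra hne
        refine hac (Prod.ext hxy.symm ?_)
        revert hne
        cases a.2 <;> cases c.2 <;> simp

/-- The cancelled part is counted with opposite signs, so only the turns at the branch point matter.
As signs of non-trivial elements are odd, a defect of one keeps the positive elements closed under
multiplication. -/
lemma wordSign_toWord_mul [DecidableEq X] (g h : FreeGroup X) :
    wordSign ρ g.toWord + wordSign ρ h.toWord ≤ wordSign ρ (g * h).toWord + 1 := by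
  obtain ⟨u, w, v, h1, h2, h3⟩ := exists_cancellation g.toWord h.toWord FreeGroup.isReduced_toWord
    FreeGroup.isReduced_toWord
  have h4 : (g * h).toWord = u ++ v := by
    rw [← h3.reduce_eq, ← FreeGroup.toWord_mk]
    congr 1
    rw [← FreeGroup.mk_toWord (x := g), ← FreeGroup.mk_toWord (x := h), h1, h2]
    rw [← FreeGroup.mul_mk, ← FreeGroup.mul_mk, ← FreeGroup.mul_mk, ← FreeGroup.inv_mk]
    group
  rw [h1, h2, h4]
  simp only [wordSign_append, wordSign_invRev]
  have hle : ∀ a b : X × Bool, |turnSign ρ a b| ≤ 1 := fun a b => by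
    unfold turnSign; split_ifs <;> simp
  have hj : ∀ L L' : List (X × Bool), |junctionSign ρ L L'| ≤ 1 := fun L L' => by
    unfold junctionSign; split <;> simp [hle]
  suffices junctionSign ρ u w + junctionSign ρ (FreeGroup.invRev w) v ≤ junctionSign ρ u v + 1 by
    linarith
  have h5 := abs_le.1 (hj u w)
  have h6 := abs_le.1 (hj (FreeGroup.invRev w) v)
  have h7 := abs_le.1 (hj u v)
  rcases w with _ | ⟨c, w⟩
  · simp; omega
  rcases v with _ | ⟨d, v⟩
  · simp; omega
  rcases List.eq_nil_or_concat u with rfl | ⟨u, a, rfl⟩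
  · simp; omega
  -- Now three directions leave the branch point, and the inequality compares their three pairwise
  -- turns by the order of their `ρ`-values.
  rw [FreeGroup.invRev_cons]
  simp only [FreeGroup.invRev, List.map_cons, List.map_nil, List.reverse_cons,
    List.reverse_nil, List.nil_append, List.concat_eq_append, junctionSign_eq, Bool.not_not,
    Prod.mk.eta]
  clear h5 h6 h7
  unfold turnSign
  split_ifs <;> omega

/-- Free groups are left-orderable. -/
theorem FreeGroup.exists_linearOrder (X : Type*) [Countable X] :
    ∃ _ : LinearOrder (FreeGroup X), ∀ a b c : FreeGroup X, b < c → a * b < a * c := by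
  classical
  obtain ⟨ρ, hρ⟩ := exists_injective_nat (X × Bool)
  have hirr : ∀ a : FreeGroup X, ¬ 0 < wordSign ρ (a⁻¹ * a).toWord := fun a => by
    simp [wordSign]
  have htrans : ∀ a b c : FreeGroup X, 0 < wordSign ρ (a⁻¹ * b).toWord →
      0 < wordSign ρ (b⁻¹ * c).toWord → 0 < wordSign ρ (a⁻¹ * c).toWord := fun a b c h h' => by
    have := wordSign_toWord_mul (ρ := ρ) (a⁻¹ * b) (b⁻¹ * c)
    rw [show a⁻¹ * b * (b⁻¹ * c) = a⁻¹ * c by group] at this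
    omega
  have htri : ∀ a b : FreeGroup X, ¬ 0 < wordSign ρ (a⁻¹ * b).toWord →
      ¬ 0 < wordSign ρ (b⁻¹ * a).toWord → a = b := fun a b h h' => by
    by_contra hab
    have h1 : wordSign ρ (b⁻¹ * a).toWord = -wordSign ρ (a⁻¹ * b).toWord := by
      rw [← wordSign_invRev, ← FreeGroup.toWord_inv]
      congr 2
      group
    have h2 : Odd (wordSign ρ (a⁻¹ * b).toWord) := by
      refine wordSign_odd hρ FreeGroup.isReduced_toWord fun h => hab ?_
      rw [FreeGroup.toWord_eq_nil_iff, inv_mul_eq_one] at h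
      exact h
    obtain ⟨k, hk⟩ := h2
    omega
  let r : FreeGroup X → FreeGroup X → Prop := fun a b => 0 < wordSign ρ (a⁻¹ * b).toWord
  have : IsStrictTotalOrder (FreeGroup X) r :=
    { irrefl := hirr, trans := htrans, trichotomous := htri }
  refine ⟨linearOrderOfSTO r, fun a b c h => ?_⟩
  have h : 0 < wordSign ρ (b⁻¹ * c).toWord := h
  change 0 < wordSign ρ ((a * b)⁻¹ * (a * c)).toWord
  rwa [show (a * b)⁻¹ * (a * c) = b⁻¹ * c by group]

end LeftOrder

namespace LabelledGraph

/-! ### The pullback of the Cayley tree -/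

section Cover

variable {X : Type} {Γ : LabelledGraph X}

/-- The pullback of the Cayley tree of the free group to `Γ`. -/
abbrev cover (Γ : LabelledGraph X) : LabelledGraph X where
  V := Γ.V × FreeGroup X
  E := Γ.E × FreeGroup X
  o := fun ε => (Γ.o ε.1, ε.2)
  t := fun ε => (Γ.t ε.1, ε.2 * FreeGroup.of (Γ.lab ε.1))
  lab := fun ε => Γ.lab ε.1

lemma cover_isImmersion (hΓ : Γ.IsImmersion) : Γ.cover.IsImmersion := by
  constructor
  · rintro ⟨e, g⟩ ⟨e', g'⟩ hl h
    obtain ⟨h1, rfl⟩ := Prod.ext_iff.1 h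
    exact Prod.ext (hΓ.1 e e' hl h1) rfl
  · rintro ⟨e, g⟩ ⟨e', g'⟩ hl h
    obtain ⟨h1, h2⟩ := Prod.ext_iff.1 h
    obtain rfl := hΓ.2 e e' hl h1
    exact Prod.ext rfl (mul_right_cancel h2)

lemma cover_word_eq {p q : Γ.cover.V} {l : List (Γ.cover.E × Bool)} (h : Γ.cover.IsWalk p l q) :
    q.2 = p.2 * FreeGroup.mk (Γ.cover.word l) := by
  induction l generalizing p with
  | nil => obtain rfl : p = q := h; exact (mul_one _).symm
  | cons d l ih =>
    obtain ⟨⟨e, g⟩, s⟩ := d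
    obtain ⟨rfl, h⟩ := h
    rw [ih h, word_cons, mk_cons]
    cases s
    · change g * _ = (g * FreeGroup.of (Γ.lab e)) * _
      simp [mul_assoc, cover]
    · change (g * FreeGroup.of (Γ.lab e)) * _ = g * _
      simp [mul_assoc, cover]

/-- In a component of the cover, a vertex is determined by its position in the free group. -/
lemma cover_vertex_eq (hΓ : Γ.IsImmersion) {S : Set Γ.cover.E} {p q : Γ.cover.V}
    (h : Γ.cover.Reach S p q) (hpq : p.2 = q.2) : p = q := by
  obtain ⟨l, hl, -⟩ := h
  -- A walk that returns to its position reads the trivial element, so by immersion it ends where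
  -- the empty walk does.
  refine (cover_isImmersion hΓ).end_eq (l := []) rfl hl ?_
  have := cover_word_eq hl
  rw [← hpq, eq_comm, mul_eq_left] at this
  exact this.symm

/-- The translate of a vertex or an edge of the cover. -/
def shift {α : Type} (h : FreeGroup X) (p : α × FreeGroup X) : α × FreeGroup X := (p.1, h * p.2)

lemma shift_injective {α : Type} (h : FreeGroup X) :
    Function.Injective (shift h : α × FreeGroup X → α × FreeGroup X) := by
  rintro ⟨a, g⟩ ⟨a', g'⟩ hp
  simp only [shift, Prod.mk.injEq, mul_right_inj] at hp
  rw [hp.1, hp.2]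

lemma shift_o (h : FreeGroup X) (ε : Γ.cover.E) :
    Γ.cover.o (shift h ε) = shift h (Γ.cover.o ε) := rfl

lemma shift_t (h : FreeGroup X) (ε : Γ.cover.E) :
    Γ.cover.t (shift h ε) = shift h (Γ.cover.t ε) :=
  Prod.ext rfl (mul_assoc _ _ _)

lemma Reach.shift {S S' : Set Γ.cover.E} {h : FreeGroup X} (hS : ∀ ε ∈ S, shift h ε ∈ S')
    {p q : Γ.cover.V} (hpq : Γ.cover.Reach S p q) :
    Γ.cover.Reach S' (LabelledGraph.shift h p) (LabelledGraph.shift h q) := by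
  refine hpq.induction (p := fun q => Γ.cover.Reach S' (LabelledGraph.shift h p)
    (LabelledGraph.shift h q)) (fun ε hε => ?_) (Reach.refl _ _)
  have h1 := Reach.edge (hS ε hε)
  rw [shift_o, shift_t] at h1
  exact ⟨fun h => h.trans h1, fun h => h.trans h1.symm⟩

lemma Reach.uncover {S : Set Γ.cover.E} {S' : Set Γ.E} (hS : ∀ ε ∈ S, ε.1 ∈ S')
    {p q : Γ.cover.V} (h : Γ.cover.Reach S p q) : Γ.Reach S' p.1 q.1 := by
  refine h.induction (p := fun q : Γ.cover.V => Γ.Reach S' p.1 q.1) (fun ε hε => ?_)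
    (Reach.refl _ _)
  have h1 : Γ.Reach S' (Γ.o ε.1) (Γ.t ε.1) := Reach.edge (hS ε hε)
  exact ⟨fun h => h.trans h1, fun h => h.trans h1.symm⟩

/-- A walk in the cover projects to a walk that reads the same word. -/
lemma IsWalk.uncover {p q : Γ.cover.V} {l : List (Γ.cover.E × Bool)} (h : Γ.cover.IsWalk p l q) :
    Γ.IsWalk p.1 (l.map fun d => (d.1.1, d.2)) q.1 := by
  induction l generalizing p with
  | nil => exact congrArg Prod.fst h
  | cons d l ih =>
    obtain ⟨⟨e, g⟩, s⟩ := d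
    obtain ⟨rfl, h⟩ := h
    have := ih h
    cases s <;> exact ⟨rfl, this⟩

end Cover

/-! ### Essential edges and the elder rule -/

section Essential

variable {X : Type} {Γ : LabelledGraph X} [LinearOrder (FreeGroup X)]
  {κ : X → ℕ} {T : Set Γ.E}

/-- The edges of the cover are ordered by the height of their labels, and those with the same label
by their position. -/
def key (κ : X → ℕ) (ε : Γ.cover.E) : ℕ ×ₗ FreeGroup X := toLex (κ (Γ.lab ε.1), ε.2)

/-- The lifts of the edges in `T` that are smaller than `ε`. -/
def below (κ : X → ℕ) (T : Set Γ.E) (ε : Γ.cover.E) : Set Γ.cover.E :=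
  {ε' | ε'.1 ∈ T ∧ key κ ε' < key κ ε}

/-- The vertices that can be reached from `p` along edges smaller than `ε`. -/
def side (κ : X → ℕ) (T : Set Γ.E) (ε : Γ.cover.E) (p : Γ.cover.V) : Set Γ.cover.V :=
  {q | Γ.cover.Reach (below κ T ε) p q}

/-- The edges of `T` whose lifts separate two infinite subtrees formed by smaller edges. -/
def essentialEdges (κ : X → ℕ) (T : Set Γ.E) : Set Γ.E :=
  {e | e ∈ T ∧ ∀ d : Γ.cover.E × Bool, d.1.1 = e → (side κ T d.1 (Γ.cover.src d)).Infinite}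

lemma mem_side_self (ε : Γ.cover.E) (p : Γ.cover.V) : p ∈ side κ T ε p := Reach.refl _ _

lemma below_subset {ε ε' : Γ.cover.E} (h : key κ ε ≤ key κ ε') : below κ T ε ⊆ below κ T ε' :=
  fun _ hδ => ⟨hδ.1, hδ.2.trans_le h⟩

lemma side_subset {ε ε' : Γ.cover.E} {p q : Γ.cover.V} (h : key κ ε ≤ key κ ε')
    (hq : q ∈ side κ T ε' p) : side κ T ε q ⊆ side κ T ε' p :=
  fun _ hx => Reach.trans hq (Reach.mono (below_subset h) hx)

lemma key_shift_lt [MulLeftStrictMono (FreeGroup X)] {h : FreeGroup X} {ε ε' : Γ.cover.E}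
    (hk : key κ ε < key κ ε') :
    key κ (shift h ε) < key κ (shift h ε') := by
  simp only [key, Prod.Lex.toLex_lt_toLex] at hk ⊢
  exact hk.imp id fun hk => ⟨hk.1, mul_lt_mul_right hk.2 h⟩

lemma side_shift [MulLeftStrictMono (FreeGroup X)] (h : FreeGroup X) (ε : Γ.cover.E)
    (p : Γ.cover.V) :
    side κ T (shift h ε) (shift h p) = shift h '' side κ T ε p := by
  have key_aux : ∀ (h : FreeGroup X) (ε : Γ.cover.E) (p q : Γ.cover.V),
      q ∈ side κ T ε p → shift h q ∈ side κ T (shift h ε) (shift h p) := fun h ε p q hq =>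
    Reach.shift (S := below κ T ε) (S' := below κ T (shift h ε))
      (fun δ hδ => ⟨hδ.1, key_shift_lt hδ.2⟩) hq
  have hinv : ∀ {α : Type} (h : FreeGroup X) (a : α × FreeGroup X),
      shift h⁻¹ (shift h a) = a ∧ shift h (shift h⁻¹ a) = a := fun h a => by simp [shift]
  ext q
  constructor
  · intro hq
    refine ⟨shift h⁻¹ q, ?_, (hinv h q).2⟩
    have := key_aux h⁻¹ _ _ _ hq
    rwa [(hinv h ε).1, (hinv h p).1] at this
  · rintro ⟨q, hq, rfl⟩
    exact key_aux h ε p q hq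

/-- The two sides of an edge are disjoint. -/
lemma side_disjoint (hΓ : Γ.IsImmersion) {d : Γ.cover.E × Bool} {x : Γ.cover.V}
    (hp : x ∈ side κ T d.1 (Γ.cover.src d)) (hq : x ∈ side κ T d.1 (Γ.cover.tgt d)) : False := by
  obtain ⟨l, hl, hS⟩ : Γ.cover.Reach (below κ T d.1) (Γ.cover.src d) (Γ.cover.tgt d) :=
    hp.trans (Reach.symm hq)
  have hd : Γ.cover.IsWalk (Γ.cover.src d) [d] (Γ.cover.tgt d) := ⟨rfl, rfl⟩
  -- A detour around `d` would reduce to `d` itself; reduction introduces no new edges, but the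
  -- detour uses only edges smaller than `d`.
  obtain ⟨L, -, h1, h2⟩ := (cover_isImmersion hΓ).exists_common_red hl hd (by
    have h1 := cover_word_eq hl
    rw [cover_word_eq hd] at h1
    exact (mul_left_cancel h1).symm)
  obtain rfl := FreeGroup.Red.singleton_iff.1 h2
  exact lt_irrefl _ (hS d (mem_of_red h1 (by simp))).2

/-- The edge `ε` kills the vertex `x`: it is the smallest vertex of a finite side of `ε`, and the
other side is infinite or has a smaller vertex. -/
def Kills (κ : X → ℕ) (T : Set Γ.E) (ε : Γ.cover.E) (x : Γ.cover.V) : Prop :=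
  ∃ s : Bool, (side κ T ε (Γ.cover.src (ε, s))).Finite ∧ x ∈ side κ T ε (Γ.cover.src (ε, s)) ∧
    (∀ y ∈ side κ T ε (Γ.cover.src (ε, s)), x.2 ≤ y.2) ∧
    ((side κ T ε (Γ.cover.tgt (ε, s))).Finite → ∃ y ∈ side κ T ε (Γ.cover.tgt (ε, s)), y.2 < x.2)

/-- When an edge joins two subtrees, the younger finite one, whose smallest vertex is larger, dies.
Two finite sides cannot tie: they are disjoint, and within a component positions determine vertices.
-/
lemma exists_kills (hΓ : Γ.IsImmersion) {d : Γ.cover.E × Bool}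
    (hd : (side κ T d.1 (Γ.cover.src d)).Finite) : ∃ x, Kills κ T d.1 x := by
  obtain ⟨ε, s⟩ := d
  obtain ⟨x, hx, hmin⟩ := Set.exists_min_image _ Prod.snd hd ⟨_, mem_side_self _ _⟩
  by_cases hfin : (side κ T ε (Γ.cover.tgt (ε, s))).Finite
  · obtain ⟨y, hy, hmin'⟩ := Set.exists_min_image _ Prod.snd hfin ⟨_, mem_side_self _ _⟩
    rcases lt_trichotomy x.2 y.2 with h | h | h
    · refine ⟨y, !s, ?_⟩
      rw [src_not, tgt_not]
      exact ⟨hfin, hy, hmin', fun _ => ⟨x, hx, h⟩⟩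
    · have hxy : x = y := by
        refine cover_vertex_eq hΓ (S := Set.univ) ?_ h
        have h1 : Γ.cover.Reach Set.univ (Γ.cover.src (ε, s)) (Γ.cover.tgt (ε, s)) :=
          Reach.dart trivial
        exact ((Reach.mono (Set.subset_univ _) hx).symm.trans h1).trans
          (Reach.mono (Set.subset_univ _) hy)
      subst hxy
      exact (side_disjoint hΓ (d := (ε, s)) hx hy).elim
    · exact ⟨x, s, hd, hx, hmin, fun _ => ⟨y, hy, h⟩⟩
  · exact ⟨x, s, hd, hx, hmin, fun h => (hfin h).elim⟩

lemma Kills.shift [MulLeftStrictMono (FreeGroup X)] {ε : Γ.cover.E} {x : Γ.cover.V}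
    (hk : Kills κ T ε x) (h : FreeGroup X) :
    Kills κ T (shift h ε) (LabelledGraph.shift h x) := by
  obtain ⟨s, h1, h2, h3, h4⟩ := hk
  have hsrc : Γ.cover.src (LabelledGraph.shift h ε, s) =
      LabelledGraph.shift h (Γ.cover.src (ε, s)) := by
    cases s
    exacts [shift_t h ε, rfl]
  have htgt : Γ.cover.tgt (LabelledGraph.shift h ε, s) =
      LabelledGraph.shift h (Γ.cover.tgt (ε, s)) := by
    cases s
    exacts [rfl, shift_t h ε]
  refine ⟨s, ?_⟩
  rw [hsrc, htgt, side_shift, side_shift]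
  refine ⟨h1.image _, ⟨x, h2, rfl⟩, ?_, fun hf => ?_⟩
  · rintro _ ⟨y, hy, rfl⟩
    rcases (h3 y hy).lt_or_eq with hlt | heq
    · exact (mul_lt_mul_right hlt h).le
    · exact (congrArg (h * ·) heq).le
  · obtain ⟨y, hy, hlt⟩ := h4 ((Set.finite_image_iff (shift_injective h).injOn).1 hf)
    exact ⟨_, ⟨y, hy, rfl⟩, mul_lt_mul_right hlt h⟩

/-- Once `ε` is added, `x` is joined to the other side of `ε`. If a later `ε'` killed `x`, that side
would be finite and so contain a vertex smaller than `x`, which then is not the oldest on its side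
of `ε'`. -/
lemma Kills.key_not_lt {ε ε' : Γ.cover.E} {x : Γ.cover.V} (hε : ε.1 ∈ T) (hk : Kills κ T ε x)
    (hk' : Kills κ T ε' x) : ¬ key κ ε < key κ ε' := by
  intro hlt
  obtain ⟨s, h1, h2, h3, h4⟩ := hk
  obtain ⟨s', h1', h2', h3', -⟩ := hk'
  have hp : Γ.cover.src (ε, s) ∈ side κ T ε' (Γ.cover.src (ε', s')) :=
    Reach.trans h2' (Reach.mono (below_subset hlt.le) (Reach.symm h2))
  have hq : Γ.cover.tgt (ε, s) ∈ side κ T ε' (Γ.cover.src (ε', s')) :=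
    Reach.trans hp (Reach.dart (d := (ε, s)) ⟨hε, hlt⟩)
  have hsub := side_subset hlt.le hq
  obtain ⟨y, hy, hyx⟩ := h4 (h1'.subset hsub)
  exact (h3' y (hsub hy)).not_gt hyx

lemma Kills.reach {ε : Γ.cover.E} {x : Γ.cover.V} (hk : Kills κ T ε x) :
    Γ.cover.Reach Set.univ (Γ.cover.o ε) x := by
  obtain ⟨s, -, h2, -⟩ := hk
  cases s
  · exact (Reach.edge (Set.mem_univ ε)).trans (Reach.mono (Set.subset_univ _) h2)
  · exact Reach.mono (Set.subset_univ _) h2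

lemma Kills.eq (hΓ : Γ.IsImmersion) (hκ : Function.Injective κ) {ε ε' : Γ.cover.E}
    {x : Γ.cover.V} (hε : ε.1 ∈ T) (hε' : ε'.1 ∈ T) (hk : Kills κ T ε x) (hk' : Kills κ T ε' x) :
    ε = ε' := by
  have h1 : key κ ε = key κ ε' :=
    le_antisymm (not_lt.1 (hk'.key_not_lt hε' hk)) (not_lt.1 (hk.key_not_lt hε hk'))
  have h2 := Prod.ext_iff.1 (toLex.injective h1)
  exact (cover_isImmersion hΓ).1 ε ε' (hκ h2.1)
    (cover_vertex_eq hΓ (hk.reach.trans hk'.reach.symm) h2.2)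

/-- A finite side of an edge contains no lifts of essential edges. -/
lemma Reach.sdiff_essentialEdges {ε : Γ.cover.E} {p x : Γ.cover.V} (hp : (side κ T ε p).Finite)
    (hx : x ∈ side κ T ε p) : Γ.Reach (T \ essentialEdges κ T) p.1 x.1 := by
  -- A smaller edge inside a finite side has a side contained in it, hence finite.
  have h1 : ∀ δ ∈ below κ T ε, Γ.cover.o δ ∈ side κ T ε p → δ.1 ∈ T \ essentialEdges κ T :=
    fun δ hδ ho => ⟨hδ.1, fun hess => hess.2 (δ, true) rfl
      (hp.subset (side_subset hδ.2.le ho))⟩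
  refine (Reach.induction
    (p := fun q => q ∈ side κ T ε p ∧ Γ.Reach (T \ essentialEdges κ T) p.1 q.1)
    (fun δ hδ => ?_) hx ⟨mem_side_self _ _, Reach.refl _ _⟩).2
  have h2 : Γ.cover.Reach (below κ T ε) (Γ.cover.o δ) (Γ.cover.t δ) := Reach.edge hδ
  constructor
  · rintro ⟨h3, h4⟩
    exact ⟨Reach.trans h3 h2, h4.trans (Reach.edge (h1 δ hδ h3))⟩
  · rintro ⟨h3, h4⟩
    have h5 : Γ.cover.o δ ∈ side κ T ε p := Reach.trans h3 h2.symm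
    exact ⟨h5, h4.trans (Reach.edge (h1 δ hδ h5)).symm⟩

/-- The edges that are not essential can be matched with vertices in their components. -/
lemma exists_matching [MulLeftStrictMono (FreeGroup X)] (hΓ : Γ.IsImmersion)
    (hκ : Function.Injective κ) :
    ∃ f : Γ.E → Γ.V, Set.InjOn f (T \ essentialEdges κ T) ∧
      ∀ e ∈ T \ essentialEdges κ T, Γ.Reach (T \ essentialEdges κ T) (Γ.o e) (f e) := by
  have h1 : ∀ e : Γ.E, ∃ x : Γ.cover.V, e ∈ T \ essentialEdges κ T → Kills κ T (e, 1) x := by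
    intro e
    by_cases he : e ∈ T \ essentialEdges κ T
    · have h2 : ∃ d : Γ.cover.E × Bool, d.1.1 = e ∧ (side κ T d.1 (Γ.cover.src d)).Finite := by
        by_contra! hcon
        exact he.2 ⟨he.1, hcon⟩
      obtain ⟨⟨⟨e, g⟩, s⟩, rfl, hfin⟩ := h2
      obtain ⟨x, hx⟩ := exists_kills hΓ hfin
      have h3 := hx.shift g⁻¹
      exact ⟨_, fun _ => by simpa [LabelledGraph.shift] using h3⟩
    · exact ⟨(Γ.o e, 1), fun h => (he h).elim⟩
  choose f hf using h1
  refine ⟨fun e => (f e).1, fun e he e' he' heq => ?_, fun e he => ?_⟩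
  -- If both vertices lie over the same vertex of `Γ`, a translation makes them equal; left
  -- invariance carries `Kills` along, and `Kills.eq` applies.
  · have h2 := (hf e' he').shift ((f e).2 * (f e').2⁻¹)
    rw [show LabelledGraph.shift ((f e).2 * (f e').2⁻¹) (f e') = f e from
      Prod.ext heq.symm (by simp [LabelledGraph.shift])] at h2
    exact (Prod.ext_iff.1 ((hf e he).eq hΓ hκ he.1 he'.1 h2)).1
  · obtain ⟨s, h2, h3, -⟩ := hf e he
    have h4 := Reach.sdiff_essentialEdges h2 h3
    cases s
    · exact (Reach.edge he).trans h4
    · exact h4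

end Essential

/-! ### Counting essential edges -/

section Count

variable {X : Type} {Γ : LabelledGraph X}

/-- If the edges of a set can be matched with vertices in their components, then there are no
twisted cycles. -/
theorem IsPrimeWeight.cycles_eq_bot [Fintype Γ.E] [Fintype Γ.V] {lam : Γ.E → ℚ}
    (hlam : IsPrimeWeight lam) {N : Set Γ.E} {f : Γ.E → Γ.V} (hf : Set.InjOn f N)
    (hr : ∀ e ∈ N, Γ.Reach N (Γ.o e) (f e)) : Γ.cycles lam N = ⊥ := by
  classical
  -- Cycles live on the edges `M` over `U`. The matching gives `|M| ≤ |U|`, while potentials on `M`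
  -- are determined off `U`; the Euler formula leaves no cycles.
  set U : Set Γ.V := {u | ∀ φ ∈ Γ.potentials lam N, φ u = 0} with hU
  have hUr : ∀ {u v}, Γ.Reach N u v → u ∈ U → v ∈ U := fun hr hu φ hφ =>
    potential_eq_zero_of_reach hlam.ne_zero hφ hr (hu φ hφ)
  set M : Set Γ.E := {e | e ∈ N ∧ Γ.o e ∈ U} with hM
  have h1 : Γ.cycles lam N ≤ Γ.cycles lam M := fun z hz => mem_cycles_of_support hz fun e he => by
    by_contra hne
    refine he ⟨by_contra fun heN => hne (hz.1 e heN), fun φ hφ => by_contra fun h => ?_⟩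
    exact hne (hlam.cycle_eq_zero hφ hz h)
  have h2 : M.ncard ≤ U.ncard :=
    Set.ncard_le_ncard_of_injOn f (fun e he => hUr (hr e he.1) he.2)
      (hf.mono fun e he => he.1) U.toFinite
  have h3 : Module.finrank ℚ (Γ.potentials lam M) + U.ncard ≤ Nat.card Γ.V := by
    let R : Γ.potentials lam M →ₗ[ℚ] ((Uᶜ : Set Γ.V) → ℚ) :=
      (LinearMap.funLeft ℚ ℚ Subtype.val).comp (Γ.potentials lam M).subtype
    have hR : Function.Injective R := by
      rw [injective_iff_map_eq_zero]
      intro φ hφ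
      refine Subtype.ext (funext fun u => ?_)
      by_cases hu : u ∈ U
      · have hψ : (fun v => if v ∈ U then φ.1 v else 0) ∈ Γ.potentials lam N := by
          intro e he
          have hiff : Γ.o e ∈ U ↔ Γ.t e ∈ U :=
            ⟨hUr (Reach.edge he), hUr (Reach.edge he).symm⟩
          by_cases ho : Γ.o e ∈ U
          · simp only [ho, hiff.1 ho, if_true]
            exact φ.2 e ⟨he, ho⟩
          · simp [ho, mt hiff.2 ho]
        simpa [hu] using hu _ hψ
      · exact congrFun hφ ⟨u, hu⟩
    have h4 := LinearMap.finrank_le_finrank_of_injective hR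
    rw [Module.finrank_fintype_fun_eq_card, ← Nat.card_eq_fintype_card, Nat.card_coe_set_eq] at h4
    have h5 := Set.ncard_add_ncard_compl U
    omega
  have h6 := finrank_cycles_add lam M
  have h7 : Module.finrank ℚ (Γ.cycles lam M) = 0 := by omega
  rw [Submodule.finrank_eq_zero] at h7
  exact le_bot_iff.1 (h1.trans h7.le)

/-- The component of the cover at a vertex where a potential does not vanish is finite. -/
lemma IsPrimeWeight.finite_reach [Finite Γ.V] (hΓ : Γ.IsImmersion) {lam : Γ.E → ℚ}
    (hlam : IsPrimeWeight lam) {N : Set Γ.E} {φ : Γ.V → ℚ} (hφ : φ ∈ Γ.potentials lam N)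
    {p : Γ.cover.V} (hp : φ p.1 ≠ 0) :
    {q | Γ.cover.Reach {ε | ε.1 ∈ N} p q}.Finite := by
  refine Set.Finite.of_finite_image (f := Prod.fst) (Set.toFinite _) ?_
  intro q hq q' hq' heq
  obtain ⟨l, hl, hlS⟩ := Reach.trans (Reach.symm hq) hq'
  have h1 := hl.uncover
  rw [← heq] at h1
  classical
  obtain ⟨L, hL, hLw, hLr, -⟩ := hΓ.exists_reduced h1
  have hq0 : φ q.1 ≠ 0 := by
    refine hlam.potential_ne_zero_of_reach hφ (Reach.uncover (fun ε hε => ?_) hq) hp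
    exact hε
  have h2 := hlam.eq_nil_of_closed hφ hLw hLr (fun d hd => by
    obtain ⟨d', hd', rfl⟩ := List.mem_map.1 (mem_of_red hL hd)
    exact hlS d' hd') hq0
  subst h2
  have h3 := cover_word_eq hl
  have h4 : Γ.cover.word l = Γ.word (l.map fun d => (d.1.1, d.2)) := by
    simp [word, Function.comp_def]
  have h5 : FreeGroup.mk (Γ.word (l.map fun d => (d.1.1, d.2))) = 1 := by
    rw [mk_word, FreeGroup.Red.exact.2 ⟨[], hL, FreeGroup.Red.refl⟩]
    exact map_one _
  rw [h4, h5, mul_one] at h3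
  exact Prod.ext heq h3.symm

variable [LinearOrder (FreeGroup X)] {κ : X → ℕ} {T : Set Γ.E}

/-- A potential that is non-zero at an end of an essential edge would give a finite component of
non-essential edges in the cover. The smallest essential edge leaving this component has a side
contained in it, which contradicts infinitude. -/
theorem IsPrimeWeight.potentials_sdiff_essentialEdges [MulLeftStrictMono (FreeGroup X)]
    [Finite Γ.E] [Finite Γ.V] (hΓ : Γ.IsImmersion) {lam : Γ.E → ℚ} (hlam : IsPrimeWeight lam) :
    Γ.potentials lam (T \ essentialEdges κ T) = Γ.potentials lam T := by
  refine le_antisymm (fun φ hφ => ?_) (potentials_anti Set.sdiff_subset)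
  have h0 : ∀ d : Γ.E × Bool, d.1 ∈ essentialEdges κ T → φ (Γ.src d) = 0 := by
    intro d hd
    by_contra hne
    obtain ⟨e, s⟩ := d
    set N := T \ essentialEdges κ T
    set p : Γ.cover.V := Γ.cover.src ((e, 1), s)
    have hp : φ p.1 ≠ 0 := by cases s <;> exact hne
    set Y := {q | Γ.cover.Reach {ε | ε.1 ∈ N} p q}
    have hY : Y.Finite := hlam.finite_reach hΓ hφ hp
    set D : Set (Γ.cover.E × Bool) := {d | d.1.1 ∈ essentialEdges κ T ∧ Γ.cover.src d ∈ Y}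
    have hD : D.Finite := by
      refine Set.Finite.of_finite_image (f := fun d => (d.1.1, d.2, Γ.cover.src d))
        ((Set.finite_univ.prod (Set.finite_univ.prod hY)).subset ?_) ?_
      · rintro _ ⟨d, hd, rfl⟩
        exact ⟨trivial, trivial, hd.2⟩
      · intro d _ d' _ heq
        simp only [Prod.mk.injEq] at heq
        exact (cover_isImmersion hΓ).dart_eq heq.2.2 (congrArg Γ.lab heq.1) heq.2.1
    -- By minimality no smaller essential edge touches `Y`, so edges smaller than `d` never lead out
    -- of `Y`.
    obtain ⟨d, hd, hmin⟩ := Set.exists_min_image D (fun d => key κ d.1) hD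
      ⟨((e, 1), s), hd, Reach.refl _ _⟩
    refine hd.1.2 d rfl (hY.subset fun q hq => ?_)
    refine Reach.induction (p := fun q => q ∈ Y) (fun δ hδ => ?_) hq hd.2
    by_cases hess : δ.1 ∈ essentialEdges κ T
    · refine iff_of_false (fun h => ?_) (fun h => ?_)
      · exact (hmin (δ, true) ⟨hess, h⟩).not_gt hδ.2
      · exact (hmin (δ, false) ⟨hess, h⟩).not_gt hδ.2
    · have h1 : Γ.cover.Reach {ε | ε.1 ∈ N} (Γ.cover.o δ) (Γ.cover.t δ) := Reach.edge ⟨hδ.1, hess⟩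
      exact ⟨fun h => Reach.trans h h1, fun h => Reach.trans h h1.symm⟩
  intro e he
  by_cases hess : e ∈ essentialEdges κ T
  · have h1 : φ (Γ.o e) = 0 := h0 (e, true) hess
    have h2 : φ (Γ.t e) = 0 := h0 (e, false) hess
    rw [h1, h2, mul_zero]
  · exact hφ e ⟨he, hess⟩

/-- The number of essential edges is the dimension of the space of twisted cycles. -/
theorem IsPrimeWeight.ncard_essentialEdges [MulLeftStrictMono (FreeGroup X)]
    [Fintype Γ.E] [Fintype Γ.V] (hΓ : Γ.IsImmersion) (hκ : Function.Injective κ) {lam : Γ.E → ℚ}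
    (hlam : IsPrimeWeight lam) :
    (essentialEdges κ T).ncard = Module.finrank ℚ (Γ.cycles lam T) := by
  obtain ⟨f, hf, hr⟩ := exists_matching (T := T) hΓ hκ
  have h1 := finrank_cycles_add lam T
  have h2 := finrank_cycles_add lam (T \ essentialEdges κ T)
  rw [hlam.cycles_eq_bot hf hr, hlam.potentials_sdiff_essentialEdges hΓ, finrank_bot] at h2
  have h3 := Set.ncard_sdiff_add_ncard_of_subset (s := essentialEdges κ T) (t := T)
    (fun e he => he.1) T.toFinite
  omega

end Count

/-! ### Essential edges under morphisms and restriction -/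

section Morphism

variable {X : Type} {Γ Δ : LabelledGraph X} [LinearOrder (FreeGroup X)] {κ : X → ℕ}

/-- Morphisms of labelled graphs map essential edges to essential edges. -/
theorem map_mem_essentialEdges (hΓ : Γ.IsImmersion) (f : Γ.V → Δ.V) (g : Γ.E → Δ.E)
    (ho : ∀ e, Δ.o (g e) = f (Γ.o e)) (ht : ∀ e, Δ.t (g e) = f (Γ.t e))
    (hl : ∀ e, Δ.lab (g e) = Γ.lab e) [MulLeftStrictMono (FreeGroup X)]
    {e : Γ.E} (he : e ∈ essentialEdges κ (Set.univ : Set Γ.E)) :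
    g e ∈ essentialEdges κ (Set.univ : Set Δ.E) := by
  refine ⟨trivial, ?_⟩
  rintro ⟨⟨_, h⟩, s⟩ rfl
  let F : Γ.cover.V → Δ.cover.V := fun p => (f p.1, p.2)
  let G : Γ.cover.E → Δ.cover.E := fun p => (g p.1, p.2)
  have hFo : ∀ ε, Δ.cover.o (G ε) = F (Γ.cover.o ε) := fun ε => Prod.ext (ho _) rfl
  have hFt : ∀ ε, Δ.cover.t (G ε) = F (Γ.cover.t ε) := fun ε => Prod.ext (ht _) (by
    change ε.2 * FreeGroup.of (Δ.lab (g ε.1)) = _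
    rw [hl])
  have hkey : ∀ ε, key κ (G ε) = key κ ε := fun ε => by
    change toLex (κ (Δ.lab (g ε.1)), ε.2) = _
    rw [hl]; rfl
  have hsrc : Δ.cover.src ((g e, h), s) = F (Γ.cover.src ((e, h), s)) := by
    cases s
    exacts [hFt (e, h), hFo (e, h)]
  have h1 := he.2 ((e, h), s) rfl
  -- `F` keeps positions, which distinguish the vertices of one component of the cover; infinite
  -- sides thus have infinite images.
  have hinj : Set.InjOn F (side κ Set.univ (e, h) (Γ.cover.src ((e, h), s))) :=
    fun q hq q' hq' heq =>
      cover_vertex_eq hΓ (Reach.trans (Reach.symm hq) hq') (Prod.ext_iff.1 heq).2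
  refine ((Set.infinite_image_iff hinj).2 h1).mono ?_
  rintro _ ⟨q, hq, rfl⟩
  rw [hsrc]
  refine Reach.induction (p := fun q => F q ∈ side κ Set.univ (g e, h)
    (F (Γ.cover.src ((e, h), s)))) (fun δ hδ => ?_) hq (mem_side_self _ _)
  have h2 : Δ.cover.Reach (below κ Set.univ (g e, h)) (F (Γ.cover.o δ)) (F (Γ.cover.t δ)) := by
    rw [← hFo, ← hFt]
    refine Reach.edge ⟨trivial, ?_⟩
    rw [show ((g e, h) : Δ.cover.E) = G (e, h) from rfl, hkey, hkey]
    exact hδ.2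
  exact ⟨fun h => Reach.trans h h2, fun h => Reach.trans h h2.symm⟩

/-- Whether an edge is essential depends only on the edges whose labels are at most as high. -/
lemma mem_essentialEdges_iff {T : Set Γ.E} {e : Γ.E} (heT : e ∈ T)
    (hT : ∀ e', κ (Γ.lab e') ≤ κ (Γ.lab e) → e' ∈ T) :
    e ∈ essentialEdges κ T ↔ e ∈ essentialEdges κ (Set.univ : Set Γ.E) := by
  have h1 : ∀ d : Γ.cover.E × Bool, d.1.1 = e → below κ T d.1 = below κ Set.univ d.1 := by
    rintro ⟨ε, s⟩ rfl
    ext δ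
    refine ⟨fun h => ⟨trivial, h.2⟩, fun h => ⟨hT _ ?_, h.2⟩⟩
    have h2 := h.2
    simp only [key, Prod.Lex.toLex_lt_toLex] at h2
    rcases h2 with h2 | h2
    exacts [h2.le, h2.1.le]
  have h2 : ∀ d : Γ.cover.E × Bool, d.1.1 = e → ∀ p, side κ T d.1 p = side κ Set.univ d.1 p :=
    fun d hd p => by rw [side, side, h1 d hd]
  constructor
  · exact fun h => ⟨trivial, fun d hd => h2 d hd _ ▸ h.2 d hd⟩
  · exact fun h => ⟨heT, fun d hd => (h2 d hd _).symm ▸ h.2 d hd⟩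

end Morphism

/-! ### Fibre products and components -/

section Pullback

variable {X : Type} {Γ Δ : LabelledGraph X}

lemma Path.map {f : Γ.V → Δ.V} {g : Γ.E → Δ.E} (ho : ∀ e, Δ.o (g e) = f (Γ.o e))
    (ht : ∀ e, Δ.t (g e) = f (Γ.t e)) (hl : ∀ e, Δ.lab (g e) = Γ.lab e) {u v : Γ.V}
    {w : List (X × Bool)} (h : Γ.Path u w v) : Δ.Path (f u) w (f v) := by
  induction h with
  | nil v => exact Path.nil _
  | forward e _ ih =>
    rw [← ht] at ih
    have := Path.forward (g e) ih
    rwa [ho, hl] at this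
  | backward e _ ih =>
    rw [← ho] at ih
    have := Path.backward (g e) ih
    rwa [ht, hl] at this

/-- The fibre product of two graphs over the bouquet of circles. -/
def pullback (Γ Δ : LabelledGraph X) : LabelledGraph X where
  V := Γ.V × Δ.V
  E := {p : Γ.E × Δ.E // Γ.lab p.1 = Δ.lab p.2}
  o := fun p => (Γ.o p.1.1, Δ.o p.1.2)
  t := fun p => (Γ.t p.1.1, Δ.t p.1.2)
  lab := fun p => Γ.lab p.1.1

/-- The connected component of a vertex, as a graph. -/
def componentGraph (Γ : LabelledGraph X) (v : Γ.V) : LabelledGraph X where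
  V := {u : Γ.V // Γ.Reach Set.univ v u}
  E := {e : Γ.E // Γ.Reach Set.univ v (Γ.o e)}
  o := fun e => ⟨Γ.o e.1, e.2⟩
  t := fun e => ⟨Γ.t e.1, e.2.trans (Reach.edge trivial)⟩
  lab := fun e => Γ.lab e.1

lemma pullback_isImmersion (hΓ : Γ.IsImmersion) (hΔ : Δ.IsImmersion) :
    (Γ.pullback Δ).IsImmersion := by
  have hl : ∀ p q : (Γ.pullback Δ).E, Γ.lab p.1.1 = Γ.lab q.1.1 → Δ.lab p.1.2 = Δ.lab q.1.2 :=
    fun p q h => by rw [← p.2, ← q.2, h]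
  constructor <;> intro p q h ho <;> obtain ⟨h1, h2⟩ := Prod.ext_iff.1 ho
  · exact Subtype.ext (Prod.ext (hΓ.1 _ _ h h1) (hΔ.1 _ _ (hl p q h) h2))
  · exact Subtype.ext (Prod.ext (hΓ.2 _ _ h h1) (hΔ.2 _ _ (hl p q h) h2))

lemma componentGraph_isImmersion (hΓ : Γ.IsImmersion) (v : Γ.V) :
    (Γ.componentGraph v).IsImmersion :=
  ⟨fun _ _ h ho => Subtype.ext (hΓ.1 _ _ h (congrArg Subtype.val ho)),
    fun _ _ h ho => Subtype.ext (hΓ.2 _ _ h (congrArg Subtype.val ho))⟩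

lemma Path.pullback {u v : Γ.V} {w : List (X × Bool)} (h : Γ.Path u w v) {u' v' : Δ.V}
    (h' : Δ.Path u' w v') : (Γ.pullback Δ).Path (u, u') w (v, v') := by
  induction h generalizing u' with
  | nil v => cases h'; exact Path.nil _
  | @forward e w v _ ih =>
    generalize hw : (Γ.lab e, true) :: w = w' at h'
    cases h' with
    | nil => simp at hw
    | forward e' h' =>
      simp only [List.cons.injEq, Prod.mk.injEq, and_true] at hw
      obtain ⟨hl, rfl⟩ := hw
      rw [← hl]
      exact Path.forward (Γ := Γ.pullback Δ) ⟨(e, e'), hl⟩ (ih h')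
    | backward e' h' => simp at hw
  | @backward e w v _ ih =>
    generalize hw : (Γ.lab e, false) :: w = w' at h'
    cases h' with
    | nil => simp at hw
    | forward e' h' => simp at hw
    | backward e' h' =>
      simp only [List.cons.injEq, Prod.mk.injEq, and_true] at hw
      obtain ⟨hl, rfl⟩ := hw
      rw [← hl]
      exact Path.backward (Γ := Γ.pullback Δ) ⟨(e, e'), hl⟩ (ih h')

lemma Path.componentGraph {v u u' : Γ.V} {w : List (X × Bool)} (h : Γ.Path u w u')
    (hu : Γ.Reach Set.univ v u) (hu' : Γ.Reach Set.univ v u') :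
    (Γ.componentGraph v).Path ⟨u, hu⟩ w ⟨u', hu'⟩ := by
  induction h with
  | nil v => exact Path.nil _
  | forward e _ ih =>
    exact Path.forward (Γ := Γ.componentGraph v) ⟨e, hu⟩ (ih (hu.trans (Reach.edge trivial)) hu')
  | backward e _ ih =>
    have ho := hu.trans (Reach.edge (Set.mem_univ e)).symm
    exact Path.backward (Γ := Γ.componentGraph v) ⟨e, ho⟩ (ih ho hu')

lemma componentGraph_isConnected (v : Γ.V) : (Γ.componentGraph v).IsConnected := by
  have h1 : ∀ u : (Γ.componentGraph v).V,
      (Γ.componentGraph v).Reach Set.univ ⟨v, Reach.refl _ _⟩ u := by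
    rintro ⟨u, hu⟩
    obtain ⟨l, hl, -⟩ := id hu
    obtain ⟨l', hl', -⟩ := path_iff.1
      (Path.componentGraph (path_iff.2 ⟨l, hl, rfl⟩) (Reach.refl Set.univ v) hu)
    exact ⟨l', hl', fun _ _ => trivial⟩
  exact isConnected_iff.2 ⟨⟨⟨v, Reach.refl _ _⟩⟩, fun u u' => (h1 u).symm.trans (h1 u')⟩

end Pullback

/-! ### Intersections of subgroups -/

section Intersection

variable {n : ℕ} {F : Type*} [Group F] {b : FreeGroupBasis (Fin n) F} {H K : Subgroup F}
  {Γ Δ : LabelledGraph (Fin n)} {v : Γ.V} {w : Δ.V}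

/-- The graph that represents the intersection of two subgroups. -/
def intersectionGraph (Γ Δ : LabelledGraph (Fin n)) (v : Γ.V) (w : Δ.V) : LabelledGraph (Fin n) :=
  (Γ.pullback Δ).componentGraph (v, w)

lemma _root_.RepresentsSubgroup.inf (h : RepresentsSubgroup b Γ v H)
    (h' : RepresentsSubgroup b Δ w K) :
    RepresentsSubgroup b (intersectionGraph Γ Δ v w) ⟨(v, w), Reach.refl _ _⟩ (H ⊓ K) := by
  have := h.1
  have := h.2.1
  have := h'.1
  have := h'.2.1
  have hV : Finite (Γ.pullback Δ).V := inferInstanceAs (Finite (Γ.V × Δ.V))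
  have hE : Finite (Γ.pullback Δ).E :=
    inferInstanceAs (Finite {p : Γ.E × Δ.E // Γ.lab p.1 = Δ.lab p.2})
  refine ⟨inferInstanceAs (Finite {u : (Γ.pullback Δ).V // _}),
    inferInstanceAs (Finite {e : (Γ.pullback Δ).E // _}), componentGraph_isConnected _,
    componentGraph_isImmersion (pullback_isImmersion h.2.2.2.1 h'.2.2.2.1) _, fun g => ?_⟩
  constructor
  · rintro ⟨hg, hg'⟩
    -- Arbitrary walks for `g` in the two graphs may read different words; the reduced word is read
    -- in both.
    obtain ⟨l, hl, -, hw, hval⟩ := h.exists_reduced_walk hg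
    obtain ⟨l', hl', -, hw', -⟩ := h'.exists_reduced_walk hg'
    refine ⟨basisWord b g, ?_, by rw [← hw]; exact hval⟩
    exact Path.componentGraph (Path.pullback (path_iff.2 ⟨l, hl, hw⟩) (path_iff.2 ⟨l', hl', hw'⟩))
      _ _
  · rintro ⟨u, hu, rfl⟩
    constructor
    · refine (h.2.2.2.2 _).2 ⟨u, ?_, rfl⟩
      exact Path.map (Γ := intersectionGraph Γ Δ v w) (f := fun u => u.1.1) (g := fun e => e.1.1.1)
        (fun _ => rfl) (fun _ => rfl) (fun _ => rfl) hu
    · refine (h'.2.2.2.2 _).2 ⟨u, ?_, rfl⟩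
      exact Path.map (Γ := intersectionGraph Γ Δ v w) (f := fun u => u.1.2) (g := fun e => e.1.1.2)
        (fun _ => rfl) (fun _ => rfl) (fun e => e.1.2.symm) hu

/-- If the essential edges of a graph have different labels, then the intersection of the subgroup
that it represents with another subgroup does not need more generators than the latter. -/
theorem _root_.RepresentsSubgroup.card_basis_inf_le [LinearOrder (FreeGroup (Fin n))]
    [MulLeftStrictMono (FreeGroup (Fin n))] {κ : Fin n → ℕ} (hκ : Function.Injective κ)
    (h : RepresentsSubgroup b Γ v H)
    (hinj : Set.InjOn Γ.lab (essentialEdges κ (Set.univ : Set Γ.E)))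
    (h' : RepresentsSubgroup b Δ w K) {r : ℕ} {g : Fin r → F}
    (hg : Subgroup.closure (Set.range g) = K) {ι : Type*}
    (y : FreeGroupBasis ι ↥(H ⊓ K)) : Finite ι ∧ Nat.card ι ≤ r := by
  let P := intersectionGraph Γ Δ v w
  have hP : RepresentsSubgroup b P ⟨(v, w), Reach.refl _ _⟩ (H ⊓ K) := h.inf h'
  obtain ⟨hfin, hcard⟩ := hP.card_basis y
  refine ⟨hfin, ?_⟩
  have := h'.1
  have := h'.2.1
  have := Fintype.ofFinite Δ.V
  have := Fintype.ofFinite Δ.E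
  have := hP.1
  have := hP.2.1
  have := Fintype.ofFinite P.V
  have := Fintype.ofFinite P.E
  obtain ⟨lam, hlam⟩ := exists_isPrimeWeight Δ
  obtain ⟨lam', hlam'⟩ := exists_isPrimeWeight P
  have h1 := hlam.ncard_essentialEdges (T := Set.univ) h'.2.2.2.1 hκ
  have h2 := hlam'.ncard_essentialEdges (T := Set.univ) hP.2.2.2.1 hκ
  have h3 : (essentialEdges κ (Set.univ : Set P.E)).ncard ≤
      (essentialEdges κ (Set.univ : Set Δ.E)).ncard := by
    refine Set.ncard_le_ncard_of_injOn (fun e : P.E => e.1.1.2) (fun e he => ?_)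
      (fun e he e' he' heq => ?_)
    · exact map_mem_essentialEdges hP.2.2.2.1 (fun u : P.V => u.1.2) (fun e : P.E => e.1.1.2)
        (fun _ => rfl) (fun _ => rfl) (fun e => e.1.2.symm) he
    · have h4 : ∀ e ∈ essentialEdges κ (Set.univ : Set P.E), e.1.1.1 ∈ essentialEdges κ Set.univ :=
        fun e he => map_mem_essentialEdges hP.2.2.2.1 (fun u : P.V => u.1.1)
          (fun e : P.E => e.1.1.1) (fun _ => rfl) (fun _ => rfl) (fun _ => rfl) he
      have h5 : e.1.1.1 = e'.1.1.1 := hinj (h4 e he) (h4 e' he') (by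
        rw [e.1.2, e'.1.2]
        exact congrArg Δ.lab heq)
      exact Subtype.ext (Subtype.ext (Prod.ext h5 heq))
  have h4 := finrank_cycles_add lam (Set.univ : Set Δ.E)
  have h5 := finrank_cycles_add lam' (Set.univ : Set P.E)
  have h6 := h'.card_edges_le hg
  rw [Set.ncard_univ] at h4 h5
  -- Reduced ranks see ranks only from two on, so small ranks are treated apart; `r = 0` makes `K`
  -- trivial.
  rcases Nat.lt_or_ge (Nat.card ι) 2 with hι | hι
  · rcases Nat.eq_zero_or_pos r with rfl | hr
    · have hK : K = ⊥ := by
        rw [← hg, Set.range_eq_empty, Subgroup.closure_empty]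
      have : IsEmpty ι := ⟨fun i => by
        have h7 : (y i : F) ∈ K := (y i).2.2
        have h8 : y i = 1 := Subtype.ext (Subgroup.mem_bot.1 (hK.le h7))
        have h9 := congrArg y.repr h8
        rw [map_one] at h9
        exact FreeGroup.of_ne_one i (by rw [← h9]; simp)⟩
      simp
    · omega
  · have h8 : Module.finrank ℚ (Δ.cycles lam Set.univ) ≠ 0 := by omega
    -- A non-zero potential on the connected graph `Δ` is nowhere zero and would leave no cycles.
    -- Without potentials the Euler formula gives `r - 1` as a bound.
    have h9 : Module.finrank ℚ (Δ.potentials lam Set.univ) = 0 := by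
      rw [Submodule.finrank_eq_zero]
      by_contra hne
      obtain ⟨φ, hφ, hφ0⟩ := Submodule.exists_mem_ne_zero_of_ne_bot hne
      obtain ⟨u, hu⟩ := Function.ne_iff.1 hφ0
      refine h8 (Submodule.finrank_eq_zero.2 ((Submodule.eq_bot_iff _).2 fun z hz => ?_))
      ext e
      exact hlam.cycle_eq_zero hφ hz
        (hlam.potential_ne_zero_of_reach hφ ((isConnected_iff.1 h'.2.2.1).2 u _) hu)
    omega

end Intersection

/-! ### Inertness and the labels of essential edges -/

section Rank

universe u

variable {n : ℕ} {F : Type u} [Group F] {b : FreeGroupBasis (Fin n) F} {H K : Subgroup F}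
  {Γ : LabelledGraph (Fin n)} {v : Γ.V}

lemma _root_.groupRank_le {G : Type u} [Group G] {S : Set G} (hS : Subgroup.closure S = ⊤) :
    groupRank G ≤ Cardinal.mk S :=
  csInf_le' ⟨S, hS, rfl⟩

/-- A subgroup is inert if the essential edges of a graph that represents it have different
labels. -/
theorem _root_.RepresentsSubgroup.isInertSubgroup [LinearOrder (FreeGroup (Fin n))]
    [MulLeftStrictMono (FreeGroup (Fin n))] {κ : Fin n → ℕ} (hκ : Function.Injective κ)
    (h : RepresentsSubgroup b Γ v H)
    (hinj : Set.InjOn Γ.lab (essentialEdges κ (Set.univ : Set Γ.E))) : IsInertSubgroup H := by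
  intro K
  obtain ⟨S, hS, hSK⟩ : groupRank ↥K ∈
      {c : Cardinal.{u} | ∃ S : Set ↥K, Subgroup.closure S = ⊤ ∧ Cardinal.mk S = c} :=
    csInf_mem ⟨_, Set.univ, Subgroup.closure_univ, rfl⟩
  rw [← hSK]
  rcases lt_or_ge (Cardinal.mk S) Cardinal.aleph0 with hfin | hinf
  · have : Finite S := Cardinal.mk_lt_aleph0_iff.1 hfin
    obtain ⟨r, ⟨e⟩⟩ := Finite.exists_equiv_fin S
    have hg : Subgroup.closure (Set.range fun i => ((e.symm i : ↥K) : F)) = K := by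
      have h1 : (Set.range fun i => ((e.symm i : ↥K) : F)) = K.subtype '' S := by
        refine (e.symm.surjective.range_comp fun s : S => ((s : ↥K) : F)).trans ?_
        ext; simp
      rw [h1, ← MonoidHom.map_closure, hS, ← MonoidHom.range_eq_map, Subgroup.range_subtype]
    have h' := stallingsGraph_represents b fun i => ((e.symm i : ↥K) : F)
    rw [hg] at h'
    -- The Nielsen-Schreier theorem provides a free basis of the intersection.
    have hF := b.isFreeGroup
    let y := IsFreeGroup.basis ↥(H ⊓ K)
    obtain ⟨hι, hle⟩ := h.card_basis_inf_le hκ hinj h' hg y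
    calc groupRank ↥(H ⊓ K) ≤ Cardinal.mk (Set.range y) := groupRank_le (closure_range_basis_top y)
      _ ≤ Cardinal.mk (IsFreeGroup.Generators ↥(H ⊓ K)) := Cardinal.mk_range_le
      _ ≤ Cardinal.mk S := by
        have := Fintype.ofFinite S
        rw [← Nat.cast_card, ← Nat.cast_card]
        have h1 : Nat.card S = r := by rw [Nat.card_congr e, Nat.card_eq_fintype_card]; simp
        exact_mod_cast hle.trans h1.ge
  -- If `K` is not finitely generated, countability of `F` suffices.
  · have hF : Countable F := b.repr.injective.countable
    exact (groupRank_le Subgroup.closure_univ).trans ((Cardinal.mk_le_aleph0).trans hinf)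

/-- Letters can be ordered such that the new letters come last. -/
lemma exists_height {m : ℕ} {x : Fin m → Fin n} (hx : Function.Injective x) :
    ∃ κ : Fin n → ℕ, Function.Injective κ ∧ (∀ l, κ (x l) = n + l) ∧
      ∀ a, (∀ l, x l ≠ a) → κ a < n := by
  classical
  refine ⟨fun a => if h : ∃ l, x l = a then n + h.choose else a, fun a a' haa => ?_, fun l => ?_,
    fun a ha => ?_⟩
  · by_cases h : ∃ l, x l = a <;> by_cases h' : ∃ l, x l = a' <;>
      simp only [h, h', dite_true, dite_false] at haa
    · rw [← h.choose_spec, ← h'.choose_spec, Fin.ext (Nat.add_left_cancel haa)]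
    · omega
    · omega
    · exact Fin.ext haa
  · have h : ∃ l', x l' = x l := ⟨l, rfl⟩
    simp only [h, dite_true]
    rw [hx h.choose_spec]
  · have h : ¬ ∃ l, x l = a := fun ⟨l, hl⟩ => ha l hl
    simp only [h, dite_false]
    exact a.2

variable {m : ℕ} {y : FreeGroupBasis (Fin m) H} {x : Fin m → Fin n}

/-- In a graph that represents a subgroup in echelon form, the essential edges have different
labels. -/
theorem _root_.RepresentsSubgroup.injOn_essentialEdges [LinearOrder (FreeGroup (Fin n))]
    [MulLeftStrictMono (FreeGroup (Fin n))] {κ : Fin n → ℕ} (hκ : Function.Injective κ)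
    (hκx : ∀ l, κ (x l) = n + l) (hκn : ∀ a, (∀ l, x l ≠ a) → κ a < n)
    (h : RepresentsSubgroup b Γ v H) (hx : IsNewLetterChoice b (fun i => (y i : F)) x) :
    Set.InjOn Γ.lab (essentialEdges κ (Set.univ : Set Γ.E)) := by
  have := h.1
  have := h.2.1
  have := Fintype.ofFinite Γ.V
  have := Fintype.ofFinite Γ.E
  obtain ⟨lam, hlam⟩ := exists_isPrimeWeight Γ
  set S := essentialEdges κ (Set.univ : Set Γ.E) with hSdef
  -- By the choice of `κ`, every edge whose label is no higher than that of an edge of `edgesBelow x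
  -- k` belongs to this set, so essential means the same there and in the whole graph.
  have hcount : ∀ k ≤ m, (S ∩ Γ.edgesBelow x k).ncard = k - 1 := by
    intro k hk
    rw [← finrank_cycles_edgesBelow h hx hlam hk,
      ← hlam.ncard_essentialEdges (T := Γ.edgesBelow x k) h.2.2.2.1 hκ]
    congr 1
    have hiff : ∀ e ∈ Γ.edgesBelow x k, e ∈ essentialEdges κ (Γ.edgesBelow x k) ↔ e ∈ S := by
      refine fun e he => mem_essentialEdges_iff he fun e' hle l hl hlab => ?_
      rw [hlab, hκx] at hle
      by_cases hex : ∃ l', x l' = Γ.lab e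
      · obtain ⟨l', hl'⟩ := hex
        rw [← hl', hκx] at hle
        exact he l' (by omega) hl'.symm
      · have := hκn _ (not_exists.1 hex)
        omega
    ext e
    exact ⟨fun he => (hiff e he.2).2 he.1, fun he => ⟨(hiff e he.1).1 he, he.1⟩⟩
  intro e he e' he' hlab
  by_contra hne
  by_cases hex : ∃ l, x l = Γ.lab e
  · obtain ⟨l, hl⟩ := hex
    have hmem : ∀ f ∈ S, Γ.lab f = x l → f ∈ S ∩ Γ.edgesBelow x (l + 1) := fun f hf hfl =>
      ⟨hf, fun l' hl' hlab' => by
        have := hx.injective (hfl.symm.trans hlab')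
        subst this
        omega⟩
    have hnot : ∀ f, Γ.lab f = x l → f ∉ S ∩ Γ.edgesBelow x l := fun f hf hf' =>
      hf'.2 l le_rfl hf
    -- Two essential edges with label `x l` would raise the count by two, but it grows by at most
    -- one from `l` to `l + 1`.
    have h1 : insert e (insert e' (S ∩ Γ.edgesBelow x l)) ⊆ S ∩ Γ.edgesBelow x (l + 1) := by
      rintro f (rfl | rfl | hf)
      · exact hmem _ he hl.symm
      · exact hmem _ he' (hlab.symm.trans hl.symm)
      · exact ⟨hf.1, edgesBelow_mono (Nat.le_succ _) hf.2⟩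
    have h2 := Set.ncard_le_ncard h1
    rw [Set.ncard_insert_of_notMem, Set.ncard_insert_of_notMem, hcount _ l.2.le, hcount _ l.2] at h2
    · omega
    · exact hnot e' (hlab.symm.trans hl.symm)
    · rintro (h3 | h3)
      · exact hne h3
      · exact hnot e hl.symm h3
  · have h1 := hcount 0 (Nat.zero_le _)
    rw [Nat.zero_sub, Set.ncard_eq_zero] at h1
    have h2 : e ∈ S ∩ Γ.edgesBelow x 0 := ⟨he, fun l _ hl => hex ⟨l, hl.symm⟩⟩
    rw [h1] at h2
    exact h2

end Rank

end LabelledGraph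

/-! ### The three assertions assembled -/

theorem IsEchelonSubgroup.isInertSubgroup {F : Type*} [Group F] {H : Subgroup F}
    (h : IsEchelonSubgroup H) : IsInertSubgroup H := by
  obtain ⟨n, b, m, y, x, hx⟩ := h
  obtain ⟨_, hord⟩ := FreeGroup.exists_linearOrder (Fin n)
  have : MulLeftStrictMono (FreeGroup (Fin n)) := ⟨fun a _ _ h => hord a _ _ h⟩
  obtain ⟨κ, hκ, hκx, hκn⟩ := LabelledGraph.exists_height hx.injective
  have hΓ := LabelledGraph.stallingsGraph_represents b fun i => (y i : F)
  rw [LabelledGraph.closure_range_basis] at hΓ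
  exact hΓ.isInertSubgroup hκ (hΓ.injOn_essentialEdges hκ hκx hκn hx)

theorem mainTheorem2 {F : Type*} [Group F] :
    (∀ {n m : ℕ} (b : FreeGroupBasis (Fin n) F) (H : Subgroup F) (y : FreeGroupBasis (Fin m) H)
      (x : Fin m → Fin n), IsNewLetterChoice b (fun i => (y i : F)) x →
      RepresentsSubgroup b (stallingsGraph b fun i => (y i : F))
        (stallingsBase b fun i => (y i : F)) H ∧
      ∀ (Γ : LabelledGraph (Fin n)) (v : Γ.V), RepresentsSubgroup b Γ v H →
        Γ.IsGeneralizedEchelon ∧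
        (∀ i : Fin m, ∃ e : Γ.E,
          Γ.OnClosedPath v (basisWord b (y i : F)) e ∧ Γ.lab e = x i) ∧
        ∀ e : Fin (m - 1) → Γ.E,
          (∀ i, Γ.OnClosedPath v (basisWord b (y (laterIndex i) : F)) (e i) ∧
            Γ.lab (e i) = x (laterIndex i)) →
          Γ.IsEchelonSystem e) ∧
    (∀ (n : ℕ) (b : FreeGroupBasis (Fin n) F) (H : Subgroup F),
      IsInEchelonForm b H → IsGeneralizedEchelonSubgroup b H) ∧
    (∀ H : Subgroup F, IsEchelonSubgroup H → IsInertSubgroup H) := by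
  refine ⟨fun b H y x hx => ⟨?_, fun Γ v h => ⟨h.isGeneralizedEchelon hx,
    fun i => h.exists_edge (y i).2 (hx i).1, fun e he => h.isEchelonSystem hx he⟩⟩,
    fun n b H hH => ?_, fun H hH => hH.isInertSubgroup⟩
  · have h := LabelledGraph.stallingsGraph_represents b fun i => (y i : F)
    rwa [LabelledGraph.closure_range_basis] at h
  · obtain ⟨m, y, x, hx⟩ := hH
    refine ⟨(Subgroup.fg_iff H).2 ⟨_, LabelledGraph.closure_range_basis y, Set.finite_range _⟩,
      fun r h hr => ?_⟩
    have hΓ := LabelledGraph.stallingsGraph_represents b h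
    rw [hr] at hΓ
    exact hΓ.isGeneralizedEchelon hx
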